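/- Let $0<v<1$ and $n\ge 1$. Let $\mathscr{UC}$ be the set of upper semicontinuous functions $\mathbb R\to\mathbb Z_{\ge 0}$ with the topology of local Hausdorff convergence of hypographs. The upper semicontinuous modification of a step function takes at each point the larger of the two one-sided limits. **Growth process.** Fix $L>0$ and put $h^{(L)}_0\equiv 0$. For odd $t\ge 1$ let $g$ be the càdlàg modification of $h^{(L)}_{t-1}$. Put $\xi(u)=g(u)$ for $u\le -L$, and let $(\xi(u))_{u\ge -L}$ be the (time-inhomogeneous) continuous-time Markov process started from $g(-L)$ which increases by $1$ at rate $v$ while $u\in[-L,L]$, decreases by $1$ at rate $v^{-1}$ while $\xi(u)>g(u)$, and is pushed, $\xi(u)=\xi(u-)+1$, whenever $g(u)=g(u-)+1$ and $g(u-)=\xi(u-)$. (The rates are realised by independent Poisson clocks, fresh for each $t$.) Then $h^{(L)}_t$ is the upper semicontinuous modification of $\xi$. For even $t$ the same is done with $g$ the càdlàg modification of $u\mapsto h^{(L)}_{t-1}(-u)$, and $h^{(L)}_t$ is the upper semicontinuous modification of $u\mapsto\xi(-u)$. For real $t\ge0$ put $h^{(L)}_t=h^{(L)}_{\lfloor t\rfloor}$.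 **Particle system.** Let $\mathcal N_t$ be independent Poisson point processes of rate $v$ on $[-L,L]$ and $\zeta_t^j$ independent exponential variables of rate $v^{-1}$, independent of the $\mathcal N_t$ ($t,j\ge 1$). There are two kinds of particles on $\mathbb R$, up-steps $\mathcal Y$ and down-steps $\mathcal Z$; there are none at time $0$. At an odd time $t$, first a down-step is added at each point of $\mathcal N_t$, and the down-steps are labelled $\mathcal Z^1<\mathcal Z^2<\cdots$. In this order, $\mathcal Z^j$ is first pushed to $\max(\mathcal Z^j,p)$, where $p$ is the place where $\mathcal Z^{j-1}$ has ended its move (its new position, or the place of its annihilation; no push if $j=1$), and then jumps to the right by $\zeta_t^j$. If this takes it to or beyond the first remaining up-step to the right of its position before the push, then both particles are annihilated at the position of that up-step. Finally an up-step is added at each point of $\mathcal N_t$. At even times the mirror image takes place: up-steps are added at the points of $\mathcal N_t$, the up-steps move to the left in decreasing order (the $j$-th up-step from the left using $\zeta^j_t$) with pushing and with annihilation at down-steps, and then down-steps are added at the points of $\mathcal N_t$. Draw in the space-time plane the paths of all particles: vertical between integer times, with a horizontal segment at height $t$ from the old position of a particle to its new position or to the place of its annihilation. For real $t\ge 0$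 let $\mathfrak h^{(L)}_t(x)$ be the number of paths crossed by the straight line from $(t,x)$ to $(0,x)$, taken as a function of $x$ in its upper semicontinuous modification. **Claim.** As $L\to\infty$, the $\mathscr{UC}$-valued processes $(h^{(L)}_t)_{t\in[0,2n]}$ and $(\mathfrak h^{(L)}_t)_{t\in[0,2n]}$ (which are constant in $t$ on every $[k,k+1)$) converge weakly, in the sense of their finite-dimensional distributions in $t$, to processes $(h_t)_{t\in[0,2n]}$ and $(\mathfrak h_t)_{t\in[0,2n]}$ respectively, and $$(h_t(x))_{t\in[0,2n],\,x\in\mathbb R}\ \stackrel{d}{=}\ (\mathfrak h_t(x))_{t\in[0,2n],\,x\in\mathbb R}.$$ -/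

import Mathlib

open MeasureTheory ProbabilityTheory Filter Topology Set Function

open scoped Classical

noncomputable section

/-! ### The state space of upper semicontinuous functions -/

/-- Upper semicontinuous functions from `ℝ` to the nonnegative integers. -/
def UC : Type := {f : ℝ → ℕ // UpperSemicontinuous f}

/-- The hypograph `{(x, y) : y ≤ f x}`. -/
def UC.hypo (f : UC) : Set (ℝ × ℝ) := {p | p.2 ≤ (f.1 p.1 : ℝ)}

/-- The distance to the hypograph, as a continuous function on the plane. -/
def UC.distHypo (f : UC) : C(ℝ × ℝ, ℝ) :=
  ⟨fun p => Metric.infDist p f.hypo, Metric.continuous_infDist_pt _⟩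

/-- Local Hausdorff convergence of hypographs: `f_k → f` if and only if the distance functions of
the hypographs converge uniformly on compact subsets of the plane (`C(ℝ × ℝ, ℝ)` carries the
topology of uniform convergence on compact sets). -/
instance : TopologicalSpace UC := TopologicalSpace.induced UC.distHypo inferInstance

instance : SecondCountableTopology UC :=
  (Topology.IsInducing.mk rfl : Topology.IsInducing UC.distHypo).secondCountableTopology

instance : MeasurableSpace UC := borel UC

instance : BorelSpace UC := ⟨rfl⟩

/-- The upper semicontinuous modification of a step function (one with locally finitely many
jumps): at every point, the larger of the two one-sided limits. -/
def uscMod (f : ℝ → ℕ) (x : ℝ) : ℕ := max (leftLim f x) (rightLim f x)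

/-- A step function as an element of `UC`, through its upper semicontinuous modification.  (The
modification of a step function is always upper semicontinuous; the other case is a default
value.) -/
def toUC (f : ℝ → ℕ) : UC :=
  if hf : UpperSemicontinuous (uscMod f) then ⟨uscMod f, hf⟩
  else ⟨fun _ => 0, upperSemicontinuous_const⟩

/-! ### Poisson processes -/

/-- The `k`-th arrival time (counted from `0`) of a renewal process with interarrival times `e`. -/
def arrival (e : ℕ → ℝ) (k : ℕ) : ℝ := ∑ i ∈ Finset.range (k + 1), e i

/-- The points on `ℝ` whose spacings to the right of `0` are `e (true, 0), e (true, 1), …` and to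
the left of `0` are `e (false, 0), e (false, 1), …`.  For independent exponential variables of
rate `r` this is a Poisson point process of rate `r` on `ℝ`. -/
def poissonLine (e : Bool × ℕ → ℝ) : Set ℝ :=
  {x | ∃ k, x = arrival (fun i => e (true, i)) k ∨ x = -arrival (fun i => e (false, i)) k}

/-- The points to the right of `a` with spacings `e 0, e 1, …`.  For independent exponential
variables of rate `r` this is a Poisson process of rate `r` on the half-line `(a, ∞)`. -/
def poissonHalfLine (a : ℝ) (e : ℕ → ℝ) : Set ℝ := {x | ∃ k, x = a + arrival e k}

/-- The elements of a finite set of reals in increasing order (the empty list if the set is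
infinite, which has probability zero wherever this is used). -/
def sortedList (S : Set ℝ) : List ℝ := if hS : S.Finite then hS.toFinset.sort else []

/-! ### The growth process: random walks reflected off the previous interface -/

/-- What happens at `u` to the walk with value `k` just before `u`, for a càdlàg barrier `g`:
it goes up by one if the up-clock `U` rings and `u ∈ [-L, L]`; it goes down by one if the
down-clock `D` rings and the walk is strictly above the barrier; it is pushed up by one if the
barrier goes up by one and the walk was on the barrier. -/
def walkStep (L : ℝ) (U D : Set ℝ) (g : ℝ → ℕ) (k : ℕ) (u : ℝ) : ℕ :=
  if u ∈ U ∩ Icc (-L) L then k + 1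
  else if u ∈ D then (if g u < k then k - 1 else k)
  else if g u = leftLim g u + 1 ∧ leftLim g u = k then k + 1
  else k

/-- The walk `ξ` reflected off the càdlàg barrier `g`: it agrees with `g` on `(-∞, -L]`, and from
`ξ(-L) = g(-L)` on it is changed according to `walkStep` at all ringing times of the clocks and
all jumps of the barrier in `(-L, u]`, in increasing order. -/
def reflectedWalk (L : ℝ) (U D : Set ℝ) (g : ℝ → ℕ) (u : ℝ) : ℕ :=
  if u ≤ -L then g u
  else (sortedList (((U ∩ Icc (-L) L) ∪ D ∪ {w | g w ≠ leftLim g w}) ∩ Ioc (-L) u)).foldl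
    (walkStep L U D g) (g (-L))

/-- The interface at time `t` of the growth process with cutoff `L`, in terms of the spacings `a`
of the up-clocks and `d` of the down-clocks.  At odd times the walk runs from left to right, at
even times from right to left; `rightLim` takes the càdlàg modification of the barrier. -/
def growth (L : ℝ) (a : ℕ × Bool × ℕ → ℝ) (d : ℕ × ℕ → ℝ) : ℕ → ℝ → ℕ
  | 0 => fun _ => 0
  | t + 1 =>
    let h := growth L a d t
    let U := poissonLine fun i => a (t + 1, i)
    let D := poissonHalfLine (-L) fun i => d (t + 1, i)
    if Odd (t + 1) then
      uscMod (reflectedWalk L U D (rightLim h))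
    else
      uscMod fun x => reflectedWalk L U D (rightLim fun u => h (-u)) (-x)

/-- The growth process as a `UC`-valued process in continuous time `t ≥ 0`, constant in `t` on
`[k, k + 1)`. -/
def growthProcess (L : ℝ) (a : ℕ × Bool × ℕ → ℝ) (d : ℕ × ℕ → ℝ) (t : ℝ) : UC :=
  toUC (growth L a d ⌊t⌋₊)

/-! ### The particle system and its height function -/

/-- The outcome of one round of jumps: the surviving moving particles, the surviving fixed
particles, and the horizontal segments `(start, end)` drawn by the moving particles. -/
structure SweepResult where
  moved : List ℝ
  fixed : List ℝ
  segments : List (ℝ × ℝ)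

/-- One round of jumps to the right.  The first argument lists the moving particles, in increasing
order, each with its jump length; the second one lists the fixed particles in increasing order; `p`
is the place where the preceding moving particle ended, if there is one (its new position if it
survives, the place of the annihilation otherwise).  The particle at `z` is first pushed to
`max z p` and then jumps by `e`; if this takes it to or beyond the first remaining fixed particle
`y > z`, both particles are removed and the drawn path ends at `y`. -/
def sweep : List (ℝ × ℝ) → List ℝ → Option ℝ → SweepResult
  | [], fixed, _ => ⟨[], fixed, []⟩
  | (z, e) :: rest, fixed, p =>
    let target := (p.elim z fun q => max z q) + e
    match fixed.find? (fun y => z < y) with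
    | none =>
      let r := sweep rest fixed (some target)
      ⟨target :: r.moved, r.fixed, (z, target) :: r.segments⟩
    | some y =>
      if y ≤ target then
        let r := sweep rest (fixed.erase y) (some y)
        ⟨r.moved, r.fixed, (z, y) :: r.segments⟩
      else
        let r := sweep rest fixed (some target)
        ⟨target :: r.moved, r.fixed, (z, target) :: r.segments⟩

/-- The particles present at some time, both lists in increasing order, and the horizontal segments
`(left end, right end)` which the particles have drawn at this time. -/
structure ParticleState where
  up : List ℝ
  down : List ℝ
  segments : List (ℝ × ℝ)

/-- Attach to the `j`-th particle (`j ≥ 1`) of an increasing list its jump length `ζ j`. -/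
def withJumps (l : List ℝ) (ζ : ℕ → ℝ) : List (ℝ × ℝ) :=
  l.zipIdx.map fun q => (q.1, ζ (q.2 + 1))

/-- Evolution at odd times: the nucleations `N` are added to the down-steps, the down-steps jump to
the right, one after the other from the left, and then `N` is added to the up-steps. -/
def oddStep (N : List ℝ) (ζ : ℕ → ℝ) (s : ParticleState) : ParticleState :=
  let r := sweep (withJumps ((s.down ++ N).insertionSort (· ≤ ·)) ζ) s.up none
  ⟨(r.fixed ++ N).insertionSort (· ≤ ·), r.moved, r.segments⟩

/-- Evolution at even times, the mirror image: the nucleations `N` are added to the up-steps, the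
up-steps jump to the left, one after the other from the right, and then `N` is added to the
down-steps. -/
def evenStep (N : List ℝ) (ζ : ℕ → ℝ) (s : ParticleState) : ParticleState :=
  let moving := (withJumps ((s.up ++ N).insertionSort (· ≤ ·)) ζ).reverse.map fun q => (-q.1, q.2)
  let r := sweep moving (s.down.reverse.map fun z => -z) none
  ⟨r.moved.reverse.map fun y => -y,
    ((r.fixed.map fun z => -z) ++ N).insertionSort (· ≤ ·),
    r.segments.map fun q => (-q.2, -q.1)⟩

/-- The particle system with nucleations restricted to `[-L, L]`, in terms of the spacings `a` of
the nucleation processes and the jump lengths `ζ`. -/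
def particles (L : ℝ) (a : ℕ × Bool × ℕ → ℝ) (ζ : ℕ × ℕ → ℝ) : ℕ → ParticleState
  | 0 => ⟨[], [], []⟩
  | t + 1 =>
    let N := sortedList ((poissonLine fun i => a (t + 1, i)) ∩ Icc (-L) L)
    if Odd (t + 1) then oddStep N (fun j => ζ (t + 1, j)) (particles L a ζ t)
    else evenStep N (fun j => ζ (t + 1, j)) (particles L a ζ t)

/-- The number of paths crossed by the straight line from `(t, x)` to `(0, x)`: every particle path
is a monotone staircase, so this counts the horizontal segments at heights `s ≤ t` above `x`. -/
def crossings (L : ℝ) (a : ℕ × Bool × ℕ → ℝ) (ζ : ℕ × ℕ → ℝ) (t x : ℝ) : ℕ :=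
  ∑ s ∈ Finset.Icc 1 ⌊t⌋₊,
    (particles L a ζ s).segments.countP fun q => q.1 ≤ x ∧ x < q.2

/-- The height function of the particle system, as a `UC`-valued process in continuous time. -/
def heightProcess (L : ℝ) (a : ℕ × Bool × ℕ → ℝ) (ζ : ℕ × ℕ → ℝ) (t : ℝ) : UC :=
  toUC (crossings L a ζ t)

/-! ### Driving noise and weak limits -/

/-- The random variables `a i` and `b j` are all independent, the `a i` are exponential with
rate `r` and the `b j` are exponential with rate `r'`. -/
structure IsExponentialNoise {Ω : Type*} [MeasurableSpace Ω] (P : Measure Ω) {ι κ : Type*}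
    (r r' : ℝ) (a : ι → Ω → ℝ) (b : κ → Ω → ℝ) : Prop where
  law_left : ∀ i, HasLaw (a i) (expMeasure r) P
  law_right : ∀ j, HasLaw (b j) (expMeasure r') P
  indep : iIndepFun (Sum.elim a b) P

/-- The processes `X L`, with time in `[0, T]`, converge weakly as `L → ∞` to a process whose law
is `μ`: all finite-dimensional marginals converge weakly.  (All processes considered here are
constant in time on `[k, k + 1)`, so this is joint weak convergence at all times.) -/
def IsWeakLimit {Ω : Type*} [MeasurableSpace Ω] (P : Measure Ω) [IsProbabilityMeasure P] {T : ℝ}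
    (X : ℝ → Ω → Icc (0 : ℝ) T → UC) (μ : Measure (Icc (0 : ℝ) T → UC))
    [IsProbabilityMeasure μ] : Prop :=
  ∀ I : Finset (Icc (0 : ℝ) T),
    TendstoInDistribution (fun (L : ℝ) ω (i : I) => X L ω i) atTop
      (fun p (i : I) => p i) (fun _ => P) μ

end

noncomputable section

section

/-! ### Infinite products of exponential laws -/

/-! For a fixed cutoff the two processes have the same law, by a queueing argument; the limits exist
because of a coupling of all cutoffs and a variational formula with negative drift.

Queues. An interface is coded by the positions of its up-steps and down-steps. In one odd growth
step, `ξ - g` is the length of a queue: customers arrive at the down-steps of `g` and at the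
nucleations (there `ξ - g` grows by one), and service is offered at the up-steps of `g` and at the
rings of the down-clock (there it drops by one unless it is zero). With first-in-first-out service,
each customer leaves at the first service time after its arrival and the departure of its
predecessor. A customer served at an up-step annihilates with it; one served at a ring becomes a
down-step of the new interface; each nucleation also creates an up-step. These are the rules of the
particle system, except that the jump lengths are residual waiting times of a Poisson clock
(`clockSweep`) and not independent exponentials (`queueSweep`). Since the exponential law has no
memory, the surviving configuration has the same law in both cases (`lintegral_clockSweep_eq`).
Reflection in the origin gives the even steps. The two configuration chains therefore have equal
transition laws (`map_clockTransition_eq`), hence equal laws (`map_noiseChain_eq`). Each interface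
is the height function of its configuration: for the growth process almost surely, once the noise is
in general position (`reflectedWalk_eq_stepHeight`, `ae_isGoodNoise`), and for the particle system
by counting path crossings (`particles_eq`).

Limit. Nucleations for all cutoffs are cut out of one Poisson process on the line, and the
down-clocks on `(-L, ∞)` out of one locally finite set assembled from unit blocks (`clockFrom`). The
reflected walk at `u` is the maximum over `y ≤ u` of the barrier at `y` plus the nucleations minus
the rings in `(y, u]` (`IsConfig.clockStep_isGreatest`). Nucleations have density `v`, rings have
density `v⁻¹ > v`, and by induction on time the barrier grows sublinearly, uniformly in `L`. So the
maximiser stays within a bounded distance, uniformly in `L`, and on every bounded interval the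
interface no longer depends on `L` once `L` is large (`IsTame.clockStep`). Along any sequence of
cutoffs the coupled interfaces thus converge almost surely to one limit, whose law is the weak limit
of both processes. Uniqueness of weak limits finishes the proof. -/

instance expMeasure.isProbabilityMeasure {r : ℝ} [hr : Fact (0 < r)] :
    IsProbabilityMeasure (expMeasure r) := isProbabilityMeasure_expMeasure hr.out

/-- The law of a sequence of independent exponential variables of rate `r`. -/
def expSeq (r : ℝ) [Fact (0 < r)] : Measure (ℕ → ℝ) := Measure.infinitePi fun _ => expMeasure r

instance {r : ℝ} [Fact (0 < r)] : IsProbabilityMeasure (expSeq r) := by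
  unfold expSeq; infer_instance

/-- Prepend a term to a sequence. -/
def scons {E : Type*} (x : E) (d : ℕ → E) : ℕ → E
  | 0 => x
  | n + 1 => d n

@[simp] lemma scons_zero {E : Type*} (x : E) (d : ℕ → E) : scons x d 0 = x := rfl

@[simp] lemma scons_succ {E : Type*} (x : E) (d : ℕ → E) (n : ℕ) : scons x d (n + 1) = d n := rfl

lemma scons_head_tail {E : Type*} (d : ℕ → E) : scons (d 0) (fun n => d (n + 1)) = d := by
  funext n; cases n <;> rfl

lemma measurable_scons {E : Type*} [MeasurableSpace E] : Measurable fun p : E × (ℕ → E) => scons p.1 p.2 := by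
  refine measurable_pi_lambda _ fun n => ?_
  cases n with
  | zero => exact measurable_fst
  | succ n => exact (measurable_pi_apply n).comp measurable_snd

@[fun_prop]
lemma Measurable.scons {α E : Type*} [MeasurableSpace α] [MeasurableSpace E] {f : α → E}
    {g : α → ℕ → E}
    (hf : Measurable f) (hg : Measurable g) : Measurable fun a => scons (f a) (g a) :=
  measurable_scons.comp (hf.prodMk hg)

instance isProbabilityMeasure_sumElim {ι κ : Type*} {μ : ι → Measure ℝ} {ν : κ → Measure ℝ}
    [hμ : ∀ i, IsProbabilityMeasure (μ i)] [hν : ∀ i, IsProbabilityMeasure (ν i)] (i : ι ⊕ κ) :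
    IsProbabilityMeasure (Sum.elim μ ν i) := by
  cases i
  · exact hμ _
  · exact hν _

/-- An infinite product over a disjoint union is the product of the two infinite products. -/
lemma map_sumElim_prod_infinitePi {ι κ : Type*} (μ : ι → Measure ℝ) (ν : κ → Measure ℝ)
    [∀ i, IsProbabilityMeasure (μ i)] [∀ i, IsProbabilityMeasure (ν i)] :
    ((Measure.infinitePi μ).prod (Measure.infinitePi ν)).map (fun p => Sum.elim p.1 p.2) =
      Measure.infinitePi (Sum.elim μ ν) := by
  have hm : Measurable fun p : (ι → ℝ) × (κ → ℝ) => Sum.elim p.1 p.2 := by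
    refine measurable_pi_lambda _ fun i => ?_
    cases i with
    | inl i => exact (measurable_pi_apply i).comp measurable_fst
    | inr i => exact (measurable_pi_apply i).comp measurable_snd
  refine Measure.eq_infinitePi _ fun s t ht => ?_
  rw [Measure.map_apply hm (.pi s.countable_toSet fun _ _ => ht _)]
  have : (fun p : (ι → ℝ) × (κ → ℝ) => Sum.elim p.1 p.2) ⁻¹' (Set.pi s t) =
      (Set.pi (s.toLeft : Set ι) fun i => t (Sum.inl i)) ×ˢ
        (Set.pi (s.toRight : Set κ) fun i => t (Sum.inr i)) := by
    ext p
    simp only [mem_preimage, Set.mem_pi, mem_prod, Finset.mem_coe, Finset.mem_toLeft,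
      Finset.mem_toRight]
    constructor
    · intro h
      exact ⟨fun i hi => h _ hi, fun i hi => h _ hi⟩
    · rintro ⟨h1, h2⟩ (i | i) hi
      · exact h1 i hi
      · exact h2 i hi
  rw [this, Measure.prod_prod, Measure.infinitePi_pi _ (fun i _ => ht _),
    Measure.infinitePi_pi _ (fun i _ => ht _)]
  conv_rhs => rw [← s.toLeft_disjSum_toRight, Finset.prod_disjSum]
  rfl

lemma measurePreserving_sumElim {ι κ : Type*} (μ : ι → Measure ℝ) (ν : κ → Measure ℝ)
    [∀ i, IsProbabilityMeasure (μ i)] [∀ i, IsProbabilityMeasure (ν i)] :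
    MeasurePreserving (fun p : (ι → ℝ) × (κ → ℝ) => (Sum.elim p.1 p.2 : ι ⊕ κ → ℝ))
      ((Measure.infinitePi μ).prod (Measure.infinitePi ν))
      (Measure.infinitePi (Sum.elim μ ν)) := by
  refine ⟨?_, map_sumElim_prod_infinitePi μ ν⟩
  refine measurable_pi_lambda _ fun i => ?_
  cases i with
  | inl i => exact (measurable_pi_apply i).comp measurable_fst
  | inr i => exact (measurable_pi_apply i).comp measurable_snd

variable {r : ℝ} [Fact (0 < r)]

/-- An i.i.d. sequence is an independent first term followed by an i.i.d. sequence. This is checked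
on boxes and is the basis of every conditioning on the first spacing or the first time step. -/
lemma measurePreserving_scons_infinitePi {E : Type*} [MeasurableSpace E] (μ : Measure E)
    [IsProbabilityMeasure μ] : MeasurePreserving (fun p : E × (ℕ → E) => scons p.1 p.2)
      (μ.prod (Measure.infinitePi fun _ => μ)) (Measure.infinitePi fun _ => μ) := by
  refine ⟨measurable_scons, ?_⟩
  refine Measure.eq_infinitePi _ fun s t ht => ?_
  rw [Measure.map_apply measurable_scons (.pi s.countable_toSet fun _ _ => ht _)]
  -- Unconstrained coordinates get `univ`, so that the box is indexed by a full initial segment and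
  -- its first factor splits off.
  set u : ℕ → Set E := fun n => if n ∈ s then t n else univ with hu
  have hum : ∀ n, MeasurableSet (u n) := fun n => by
    simp only [hu]; split_ifs
    · exact ht n
    · exact .univ
  obtain ⟨K, hK⟩ : ∃ K, s ⊆ Finset.range (K + 1) :=
    ⟨s.sup id, fun i hi => Finset.mem_range.2 (Nat.lt_succ_of_le (Finset.le_sup (f := id) hi))⟩
  have : (fun p : E × (ℕ → E) => scons p.1 p.2) ⁻¹' (Set.pi s t) =
      u 0 ×ˢ (Set.pi (Finset.range K : Set ℕ) fun i => u (i + 1)) := by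
    ext p
    simp only [mem_preimage, Set.mem_pi, mem_prod, Finset.mem_coe, hu, Finset.mem_range]
    constructor
    · intro h
      refine ⟨?_, fun i _ => ?_⟩
      · split_ifs with h0
        · exact h 0 h0
        · trivial
      · split_ifs with h0
        · exact h _ h0
        · trivial
    · rintro ⟨h1, h2⟩ i hi
      cases i with
      | zero => simpa [hi] using h1
      | succ i =>
        have := h2 i (by have := Finset.mem_range.1 (hK hi); omega)
        simpa [hi] using this
  rw [this, Measure.prod_prod, Measure.infinitePi_pi _ (fun i _ => hum _), mul_comm,
    ← Finset.prod_range_succ' (fun i => μ (u i)), ← Finset.prod_subset hK]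
  · exact Finset.prod_congr rfl fun i hi => by simp [hu, hi]
  · intro i _ hi
    simp [hu, hi]

lemma measurePreserving_scons : MeasurePreserving (fun p : ℝ × (ℕ → ℝ) => scons p.1 p.2)
    ((expMeasure r).prod (expSeq r)) (expSeq r) :=
  measurePreserving_scons_infinitePi _

lemma lintegral_expSeq {F : (ℕ → ℝ) → ENNReal} (hF : Measurable F) :
    ∫⁻ d, F d ∂expSeq r = ∫⁻ x, ∫⁻ d, F (scons x d) ∂expSeq r ∂expMeasure r := by
  rw [← measurePreserving_scons.lintegral_comp hF,
    lintegral_prod _ (by exact (hF.comp measurable_scons).aemeasurable)]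

/-- Splitting into head and tail is measure preserving and inverts `scons`, so null sets can be
tested after conditioning on the tail. -/
lemma ae_expSeq_of_scons {p : (ℕ → ℝ) → Prop}
    (h : ∀ᵐ q ∂(expMeasure r).prod (expSeq r), p (scons q.1 q.2)) : ∀ᵐ d ∂expSeq r, p d := by
  have hp : MeasurePreserving (fun d : ℕ → ℝ => (d 0, fun n => d (n + 1))) (expSeq r)
      ((expMeasure r).prod (expSeq r)) := by
    refine ⟨by fun_prop, ?_⟩
    conv_lhs => rw [← (measurePreserving_scons (r := r)).map_eq]
    rw [Measure.map_map (by fun_prop) measurable_scons]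
    exact Measure.map_id
  filter_upwards [hp.quasiMeasurePreserving.ae h] with d hd
  simpa [scons_head_tail] using hd

/-! ### The exponential law -/

omit [Fact (0 < r)] in
lemma lintegral_expMeasure {f : ℝ → ENNReal} (hf : Measurable f) :
    ∫⁻ x, f x ∂expMeasure r = ∫⁻ x, exponentialPDF r x * f x := by
  have : expMeasure r = volume.withDensity (exponentialPDF r) := rfl
  have hm : Measurable (exponentialPDF r) := (measurable_exponentialPDFReal r).ennreal_ofReal
  rw [this, lintegral_withDensity_eq_lintegral_mul _ hm hf]
  rfl

omit [Fact (0 < r)] in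
lemma expMeasure_absolutelyContinuous : expMeasure r ≪ volume :=
  withDensity_absolutelyContinuous _ _

instance : NullSingletonClass (expMeasure r) :=
  ⟨fun x => expMeasure_absolutelyContinuous (by simp)⟩

lemma expMeasure_Ioi {s : ℝ} (hs : 0 ≤ s) :
    expMeasure r (Ioi s) = ENNReal.ofReal (Real.exp (-(r * s))) := by
  have h1 := cdf_expMeasure_eq (r := r) Fact.out s
  rw [if_pos hs, cdf_eq_real] at h1
  have h2 : (expMeasure r).real (Ioi s) = Real.exp (-(r * s)) := by
    rw [← compl_Iic, probReal_compl_eq_one_sub measurableSet_Iic, h1]; ring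
  rw [← h2, ofReal_measureReal]

lemma expMeasure_Iic_zero : expMeasure r (Iic 0) = 0 := by
  have h1 := cdf_expMeasure_eq (r := r) Fact.out 0
  rw [cdf_eq_real] at h1
  simp only [le_refl, ↓reduceIte, mul_zero, neg_zero, Real.exp_zero, sub_self] at h1
  exact (measureReal_eq_zero_iff).1 h1

lemma ae_pos_expMeasure : ∀ᵐ x ∂expMeasure r, 0 < x := by
  rw [ae_iff]
  have : {x : ℝ | ¬ 0 < x} = Iic 0 := by ext; simp
  rw [this, expMeasure_Iic_zero]

/-- This is the contraction factor in the renewal iterations below: each spacing exceeds `s` with a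
fixed positive probability. -/
lemma expMeasure_Iic_lt_one {s : ℝ} : expMeasure r (Iic s) < 1 := by
  have h : expMeasure r (Iic (max s 0)) < 1 := by
    rw [← compl_Ioi, prob_compl_eq_one_sub measurableSet_Ioi, expMeasure_Ioi (le_max_right _ _)]
    refine ENNReal.sub_lt_self (by simp) (by simp) ?_
    simp [Real.exp_pos]
  exact (measure_mono (Iic_subset_Iic.2 (le_max_left _ _))).trans_lt h

/-- The exponential law has no memory. -/
lemma setLIntegral_Ioi_expMeasure {s : ℝ} (hs : 0 ≤ s) {f : ℝ → ENNReal} (hf : Measurable f) :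
    ∫⁻ x in Ioi s, f x ∂expMeasure r = expMeasure r (Ioi s) * ∫⁻ x, f (x + s) ∂expMeasure r := by
  have hm : Measurable (exponentialPDF r) := (measurable_exponentialPDFReal r).ennreal_ofReal
  rw [← lintegral_indicator measurableSet_Ioi, lintegral_expMeasure (hf.indicator measurableSet_Ioi),
    lintegral_expMeasure (f := fun x => f (x + s)) (hf.comp (measurable_id.add_const s)), expMeasure_Ioi hs,
    ← lintegral_const_mul _ (by exact hm.mul (hf.comp (measurable_id.add_const s))),
    ← lintegral_add_right_eq_self _ s]
  refine lintegral_congr_ae ?_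
  -- The origin must be left out: there the density on the right is positive, but the indicator of
  -- the open half-line vanishes on the left.
  filter_upwards [(measure_eq_zero_iff_ae_notMem (μ := volume) (s := {(0 : ℝ)})).1 (by simp)] with x hx
  rcases lt_or_gt_of_ne (show x ≠ 0 from hx) with h | h
  · rw [indicator_of_notMem (by simp [h.le]), exponentialPDF_of_neg h]
    simp
  · rw [indicator_of_mem (by simpa using h), exponentialPDF_of_nonneg h.le,
      exponentialPDF_of_nonneg (by linarith), ← mul_assoc, ← ENNReal.ofReal_mul (Real.exp_pos _).le]
    congr 2
    rw [mul_left_comm, ← Real.exp_add]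
    congr 2
    ring

lemma lintegral_id_expMeasure : ∫⁻ x, ENNReal.ofReal x ∂expMeasure r = ENNReal.ofReal r⁻¹ := by
  have hr : 0 < r := Fact.out
  rw [lintegral_eq_lintegral_meas_lt (f := fun x : ℝ => x) (expMeasure r)
    (ae_pos_expMeasure.mono fun x hx => hx.le) measurable_id.aemeasurable]
  have : ∀ t ∈ Ioi (0 : ℝ), expMeasure r {a | t < a} = ENNReal.ofReal (Real.exp (-r * t)) := by
    intro t ht
    rw [neg_mul]
    exact expMeasure_Ioi (le_of_lt ht)
  rw [setLIntegral_congr_fun measurableSet_Ioi this, ← ofReal_integral_eq_lintegral_ofReal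
    (integrableOn_exp_mul_Ioi (by linarith) 0) (ae_of_all _ fun _ => (Real.exp_pos _).le),
    integral_exp_mul_Ioi (by linarith)]
  simp [div_eq_mul_inv]

lemma integrable_id_expMeasure : Integrable (fun x => x) (expMeasure r) := by
  refine ⟨measurable_id.aestronglyMeasurable, ?_⟩
  rw [hasFiniteIntegral_iff_norm]
  have : ∫⁻ x, ENNReal.ofReal ‖x‖ ∂expMeasure r = ∫⁻ x, ENNReal.ofReal x ∂expMeasure r := by
    refine lintegral_congr_ae (ae_pos_expMeasure.mono fun x hx => ?_)
    simp [abs_of_pos hx]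
  rw [this, lintegral_id_expMeasure]
  exact ENNReal.ofReal_lt_top

lemma integral_id_expMeasure : ∫ x, x ∂expMeasure r = r⁻¹ := by
  have hr : 0 < r := Fact.out
  rw [integral_eq_lintegral_of_nonneg_ae (ae_pos_expMeasure.mono fun x hx => hx.le)
    measurable_id.aestronglyMeasurable, lintegral_id_expMeasure, ENNReal.toReal_ofReal (by positivity)]

/-! ### Renewal sequences -/

/-- Positive spacings with divergent sum. -/
structure IsSpacing (d : ℕ → ℝ) : Prop where
  pos : ∀ n, 0 < d n
  tendsto : Tendsto (arrival d) atTop atTop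

/-- The spacings have the asymptotic mean `r⁻¹`. -/
lemma ae_expSeq_tendsto_arrival_div :
    ∀ᵐ d ∂expSeq r, Tendsto (fun n : ℕ => (∑ i ∈ Finset.range n, d i) / (n : ℝ)) atTop (𝓝 r⁻¹) := by
  have hmp : ∀ i : ℕ, MeasurePreserving (fun d : ℕ → ℝ => d i) (expSeq r) (expMeasure r) :=
    fun i => measurePreserving_eval_infinitePi _ i
  have hind : iIndepFun (fun i (d : ℕ → ℝ) => d i) (expSeq r) :=
    iIndepFun_infinitePi (X := fun _ x => x) fun _ => measurable_id
  have h := strong_law_ae_real (μ := expSeq r) (fun i d => d i)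
    ((hmp 0).integrable_comp_of_integrable integrable_id_expMeasure)
    (fun i j hij => hind.indepFun hij)
    (fun i => ⟨(hmp i).aemeasurable, (hmp 0).aemeasurable, by rw [(hmp i).map_eq, (hmp 0).map_eq]⟩)
  have h0 : ∫ d : ℕ → ℝ, d 0 ∂expSeq r = r⁻¹ := by
    rw [← integral_id_expMeasure (r := r), ← (hmp 0).map_eq]
    exact (integral_map (hmp 0).aemeasurable measurable_id.aestronglyMeasurable).symm
  rw [h0] at h
  exact h

lemma ae_isSpacing : ∀ᵐ d ∂expSeq r, IsSpacing d := by
  have hr : 0 < r := Fact.out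
  have hpos : ∀ᵐ d ∂expSeq r, ∀ n, 0 < d n := by
    rw [ae_all_iff]
    intro n
    exact (measurePreserving_eval_infinitePi (fun _ => expMeasure r) n).quasiMeasurePreserving.ae
      ae_pos_expMeasure
  filter_upwards [hpos, ae_expSeq_tendsto_arrival_div (r := r)] with d h1 h2
  refine ⟨h1, ?_⟩
  have h3 : Tendsto (fun n : ℕ => ∑ i ∈ Finset.range n, d i) atTop atTop := by
    have := h2.pos_mul_atTop (inv_pos.2 hr) tendsto_natCast_atTop_atTop
    refine this.congr' ?_
    filter_upwards [eventually_gt_atTop 0] with n hn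
    field_simp
  exact h3.comp (tendsto_add_atTop_nat 1)

end

section

/-! ### Shifting and concatenating renewal sequences -/

lemma arrival_zero (d : ℕ → ℝ) : arrival d 0 = d 0 := by simp [arrival]

lemma arrival_succ (d : ℕ → ℝ) (n : ℕ) : arrival d (n + 1) = arrival d n + d (n + 1) := by
  simp [arrival, Finset.sum_range_succ]

lemma arrival_scons_succ (x : ℝ) (d : ℕ → ℝ) (n : ℕ) :
    arrival (scons x d) (n + 1) = x + arrival d n := by
  rw [arrival, Finset.sum_range_succ', add_comm]; rfl

lemma IsSpacing.strictMono {d : ℕ → ℝ} (hd : IsSpacing d) : StrictMono (arrival d) :=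
  strictMono_nat_of_lt_succ fun n => by rw [arrival_succ]; linarith [hd.pos (n + 1)]

lemma IsSpacing.arrival_pos {d : ℕ → ℝ} (hd : IsSpacing d) (n : ℕ) : 0 < arrival d n :=
  Finset.sum_pos (fun i _ => hd.pos i) (by simp)

lemma IsSpacing.scons_iff {x : ℝ} {d : ℕ → ℝ} (hd : IsSpacing (scons x d)) : 0 < x ∧ IsSpacing d := by
  refine ⟨hd.pos 0, fun n => hd.pos (n + 1), ?_⟩
  have h := hd.tendsto.comp (tendsto_add_atTop_nat 1)
  have h2 : Tendsto (fun n => -x + arrival (scons x d) (n + 1)) atTop atTop :=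
    tendsto_atTop_add_const_left _ _ h
  refine h2.congr fun n => ?_
  rw [arrival_scons_succ]; ring

/-- The index of the first arrival after `s`. -/
def firstIndex (s : ℝ) (d : ℕ → ℝ) : ℕ := sInf {m | s < arrival d m}

lemma IsSpacing.lt_arrival_firstIndex {d : ℕ → ℝ} (hd : IsSpacing d) (s : ℝ) :
    s < arrival d (firstIndex s d) := by
  have : {m | s < arrival d m}.Nonempty := (hd.tendsto.eventually_gt_atTop s).exists
  exact Nat.sInf_mem this

lemma arrival_le_of_lt_firstIndex {s : ℝ} {d : ℕ → ℝ} {k : ℕ} (hk : k < firstIndex s d) :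
    arrival d k ≤ s := not_lt.1 (Nat.notMem_of_lt_sInf hk)

lemma firstIndex_eq {s : ℝ} {d : ℕ → ℝ} {m : ℕ} (h1 : s < arrival d m)
    (h2 : ∀ k < m, arrival d k ≤ s) : firstIndex s d = m :=
  le_antisymm (Nat.sInf_le h1) (le_csInf ⟨m, h1⟩ fun k hk => by
    by_contra h
    exact absurd (h2 k (not_le.1 h)) (not_le.2 hk))

lemma firstIndex_scons_of_lt {s x : ℝ} (d : ℕ → ℝ) (h : s < x) : firstIndex s (scons x d) = 0 :=
  firstIndex_eq (by simpa [arrival_zero] using h) (by simp)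

lemma firstIndex_scons_of_le {s x : ℝ} {d : ℕ → ℝ} (hd : IsSpacing d) (h : x ≤ s) :
    firstIndex s (scons x d) = firstIndex (s - x) d + 1 := by
  refine firstIndex_eq ?_ ?_
  · rw [arrival_scons_succ]
    linarith [hd.lt_arrival_firstIndex (s - x)]
  · intro k hk
    cases k with
    | zero => simpa [arrival_zero] using h
    | succ k =>
      rw [arrival_scons_succ]
      have := arrival_le_of_lt_firstIndex (Nat.lt_of_succ_lt_succ hk)
      linarith

lemma measurable_arrival (k : ℕ) : Measurable fun d : ℕ → ℝ => arrival d k := by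
  unfold arrival; fun_prop

lemma measurable_firstIndex : Measurable fun p : ℝ × (ℕ → ℝ) => firstIndex p.1 p.2 := by
  have hm : ∀ k, MeasurableSet {p : ℝ × (ℕ → ℝ) | p.1 < arrival p.2 k} := fun k =>
    measurableSet_lt measurable_fst ((measurable_arrival k).comp measurable_snd)
  refine measurable_to_countable' fun k => ?_
  -- The second set accounts for the value `sInf ∅ = 0` when no arrival exceeds `s`.
  have : (fun p : ℝ × (ℕ → ℝ) => firstIndex p.1 p.2) ⁻¹' {k} =
      ({p | p.1 < arrival p.2 k} ∩ ⋂ j : ℕ, ⋂ _ : j < k, {p | p.1 < arrival p.2 j}ᶜ) ∪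
        (if k = 0 then ⋂ j : ℕ, {p | p.1 < arrival p.2 j}ᶜ else ∅) := by
    ext p
    simp only [mem_preimage, mem_singleton_iff, mem_union, mem_inter_iff, mem_ofPred_eq, mem_iInter,
      mem_compl_iff, not_lt]
    constructor
    · rintro rfl
      by_cases hne : {m | p.1 < arrival p.2 m}.Nonempty
      · exact Or.inl ⟨Nat.sInf_mem hne, fun j hj => arrival_le_of_lt_firstIndex hj⟩
      · right
        have h0 : {m | p.1 < arrival p.2 m} = ∅ := not_nonempty_iff_eq_empty.1 hne
        rw [if_pos (by rw [firstIndex, h0, Nat.sInf_empty])]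
        simp only [mem_iInter, mem_compl_iff]
        intro j hj
        exact hne ⟨j, hj⟩
    · rintro (⟨h1, h2⟩ | h)
      · exact firstIndex_eq h1 h2
      · split_ifs at h with hk
        · simp only [mem_iInter, mem_compl_iff] at h
          have h0 : {m | p.1 < arrival p.2 m} = ∅ := by
            ext j; simpa using h j
          rw [firstIndex, h0, Nat.sInf_empty, hk]
        · exact absurd h (notMem_empty _)
  rw [this]
  refine ((hm k).inter (.iInter fun j => .iInter fun _ => (hm j).compl)).union ?_
  split_ifs
  · exact .iInter fun j => (hm j).compl
  · exact .empty

lemma Measurable.apply_nat {α β : Type*} [MeasurableSpace α] [MeasurableSpace β] {f : ℕ → α → β}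
    {m : α → ℕ} (hf : ∀ k, Measurable (f k)) (hm : Measurable m) :
    Measurable fun a => f (m a) a := by
  have : Measurable fun p : ℕ × α => f p.1 p.2 := measurable_from_prod_countable_right hf
  exact this.comp (hm.prodMk measurable_id)

/-- The spacings after time `max s 0`: the arrivals up to then are dropped. -/
def theta (s : ℝ) (d : ℕ → ℝ) : ℕ → ℝ := fun n =>
  if n = 0 then arrival d (firstIndex (max s 0) d) - max s 0 else d (firstIndex (max s 0) d + n)

/-- The spacings of the arrivals of `d` up to time `s`, followed by those of `d'` restarted at
time `s`. -/
def kappa (s : ℝ) (d d' : ℕ → ℝ) : ℕ → ℝ := fun n =>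
  if n < firstIndex s d then d n
  else if n = firstIndex s d then s - (arrival d n - d n) + d' 0
  else d' (n - firstIndex s d)

lemma measurable_theta : Measurable fun p : ℝ × (ℕ → ℝ) => theta p.1 p.2 := by
  have hm : Measurable fun p : ℝ × (ℕ → ℝ) => firstIndex (max p.1 0) p.2 :=
    measurable_firstIndex.comp ((measurable_fst.max measurable_const).prodMk measurable_snd)
  refine measurable_pi_lambda _ fun n => ?_
  unfold theta
  split_ifs
  · exact (Measurable.apply_nat (f := fun k (p : ℝ × (ℕ → ℝ)) => arrival p.2 k)
      (fun k => (measurable_arrival k).comp measurable_snd) hm).sub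
      (measurable_fst.max measurable_const)
  · exact Measurable.apply_nat (f := fun k (p : ℝ × (ℕ → ℝ)) => p.2 (k + n))
      (fun k => (measurable_pi_apply _).comp measurable_snd) hm

lemma Measurable.comp_theta {α : Type*} [MeasurableSpace α] {f : α → ℝ} {g : α → ℕ → ℝ}
    (hf : Measurable f) (hg : Measurable g) : Measurable fun a => theta (f a) (g a) :=
  Measurable.comp (g := fun p : ℝ × (ℕ → ℝ) => theta p.1 p.2) (f := fun a => (f a, g a))
    measurable_theta (hf.prodMk hg)

lemma measurable_kappa (s : ℝ) : Measurable fun p : (ℕ → ℝ) × (ℕ → ℝ) => kappa s p.1 p.2 := by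
  have hm : Measurable fun p : (ℕ → ℝ) × (ℕ → ℝ) => firstIndex s p.1 :=
    measurable_firstIndex.comp (measurable_const.prodMk measurable_fst)
  refine measurable_pi_lambda _ fun n => ?_
  refine Measurable.ite (measurableSet_lt measurable_const hm) (by fun_prop) ?_
  refine Measurable.ite (measurableSet_eq_fun measurable_const hm) ?_ ?_
  · exact (measurable_const.sub (((measurable_arrival n).comp measurable_fst).sub
      (by fun_prop))).add (by fun_prop)
  · exact Measurable.apply_nat (f := fun k (p : (ℕ → ℝ) × (ℕ → ℝ)) => p.2 (n - k))
      (fun k => by fun_prop) hm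

/-- With `theta_scons_of_le` this gives a recursion on the first spacing: it either covers the
restart time and is shortened, or is used up and the remaining time decreases. `kappa` obeys the
analogous pair of rules. -/
lemma theta_scons_of_lt {s x : ℝ} (d : ℕ → ℝ) (hs : 0 ≤ s) (h : s < x) :
    theta s (scons x d) = scons (x - s) d := by
  funext n
  cases n with
  | zero => simp [theta, max_eq_left hs, firstIndex_scons_of_lt d h, arrival_zero]
  | succ n => simp [theta, max_eq_left hs, firstIndex_scons_of_lt d h]

lemma theta_scons_of_le {s x : ℝ} {d : ℕ → ℝ} (hd : IsSpacing d) (hs : 0 ≤ s) (h : x ≤ s) :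
    theta s (scons x d) = theta (s - x) d := by
  funext n
  cases n with
  | zero =>
    simp only [theta, max_eq_left hs, max_eq_left (sub_nonneg.2 h), if_true,
      firstIndex_scons_of_le hd h, arrival_scons_succ]
    ring
  | succ n =>
    simp only [theta, max_eq_left hs, max_eq_left (sub_nonneg.2 h), firstIndex_scons_of_le hd h]
    rw [if_neg (by omega), if_neg (by omega), add_right_comm, scons_succ]

lemma theta_of_nonpos {s : ℝ} {d : ℕ → ℝ} (hd : IsSpacing d) (hs : s ≤ 0) : theta s d = d := by
  have : firstIndex 0 d = 0 := firstIndex_eq (by simpa [arrival_zero] using hd.pos 0) (by simp)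
  funext n
  cases n with
  | zero => simp [theta, max_eq_right hs, this, arrival_zero]
  | succ n => simp [theta, max_eq_right hs, this]

lemma kappa_scons_of_lt {s x : ℝ} (d d' : ℕ → ℝ) (h : s < x) :
    kappa s (scons x d) d' = scons (s + d' 0) fun n => d' (n + 1) := by
  funext n
  cases n with
  | zero => simp [kappa, firstIndex_scons_of_lt d h, arrival_zero]
  | succ n => simp [kappa, firstIndex_scons_of_lt d h]

lemma kappa_scons_of_le {s x : ℝ} {d : ℕ → ℝ} (d' : ℕ → ℝ) (hd : IsSpacing d) (h : x ≤ s) :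
    kappa s (scons x d) d' = scons x (kappa (s - x) d d') := by
  funext n
  cases n with
  | zero => simp [kappa, firstIndex_scons_of_le hd h]
  | succ n =>
    simp only [kappa, firstIndex_scons_of_le hd h, arrival_scons_succ, scons_succ,
      Nat.add_lt_add_iff_right, Nat.add_right_cancel_iff, Nat.add_sub_add_right]
    split_ifs <;> ring

lemma arrival_theta {s : ℝ} (d : ℕ → ℝ) (hs : 0 ≤ s) (k : ℕ) :
    arrival (theta s d) k = arrival d (firstIndex s d + k) - s := by
  induction k with
  | zero => simp [arrival_zero, theta, max_eq_left hs]
  | succ k ih =>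
    rw [arrival_succ, ih, ← add_assoc, arrival_succ]
    simp only [theta, max_eq_left hs]
    rw [if_neg (by omega), ← add_assoc]
    ring

lemma arrival_kappa_of_lt {s : ℝ} {d d' : ℕ → ℝ} {k : ℕ} (hk : k < firstIndex s d) :
    arrival (kappa s d d') k = arrival d k := by
  refine Finset.sum_congr rfl fun i hi => ?_
  rw [kappa, if_pos (by have := Finset.mem_range.1 hi; omega)]

lemma arrival_kappa_add (s : ℝ) (d d' : ℕ → ℝ) (k : ℕ) :
    arrival (kappa s d d') (firstIndex s d + k) = s + arrival d' k := by
  induction k with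
  | zero =>
    rw [add_zero, arrival, Finset.sum_range_succ,
      Finset.sum_congr rfl fun i hi => by rw [kappa, if_pos (Finset.mem_range.1 hi)]]
    have : arrival d (firstIndex s d) - d (firstIndex s d) =
        ∑ i ∈ Finset.range (firstIndex s d), d i := by
      rw [arrival, Finset.sum_range_succ]; ring
    rw [kappa, if_neg (lt_irrefl _), if_pos rfl, this, arrival_zero]
    ring
  | succ k ih =>
    rw [← add_assoc, arrival_succ, ih, arrival_succ, kappa, if_neg (by omega), if_neg (by omega)]
    rw [show firstIndex s d + k + 1 - firstIndex s d = k + 1 by omega]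
    ring

lemma IsSpacing.theta {d : ℕ → ℝ} (hd : IsSpacing d) (s : ℝ) : IsSpacing (theta s d) := by
  rcases le_or_gt s 0 with hs | hs
  · rwa [theta_of_nonpos hd hs]
  · constructor
    · intro n
      rw [_root_.theta, max_eq_left hs.le]
      split_ifs
      · linarith [hd.lt_arrival_firstIndex s]
      · exact hd.pos _
    · refine (tendsto_atTop_add_const_right _ (-s) (hd.tendsto.comp
        (tendsto_add_atTop_nat (firstIndex s d)))).congr fun k => ?_
      rw [arrival_theta d hs.le, Function.comp, add_comm k]
      ring

lemma IsSpacing.kappa {d d' : ℕ → ℝ} (hd : IsSpacing d) (hd' : IsSpacing d') {s : ℝ}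
    (hs : 0 ≤ s) :     IsSpacing (kappa s d d') := by
  constructor
  · intro n
    rw [_root_.kappa]
    split_ifs with h1 h2
    · exact hd.pos n
    · have : arrival d n - d n ≤ s := by
        cases n with
        | zero => simpa [arrival_zero] using hs
        | succ n =>
          rw [arrival_succ, add_sub_cancel_right]
          exact arrival_le_of_lt_firstIndex (by omega)
      linarith [hd'.pos 0]
    · exact hd'.pos _
  · have h : Tendsto (fun k => arrival (_root_.kappa s d d') (k + firstIndex s d)) atTop atTop := by
      refine (tendsto_atTop_add_const_left _ s hd'.tendsto).congr fun k => ?_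
      rw [add_comm k, arrival_kappa_add]
    exact (tendsto_add_atTop_iff_nat _).1 h

lemma poissonHalfLine_theta {d : ℕ → ℝ} (hd : IsSpacing d) (a : ℝ) {s : ℝ} (hs : 0 ≤ s) :
    poissonHalfLine (a + s) (theta s d) = poissonHalfLine a d ∩ Ioi (a + s) := by
  ext x
  simp only [poissonHalfLine, mem_ofPred_eq, arrival_theta d hs, mem_inter_iff, mem_Ioi]
  constructor
  · rintro ⟨k, rfl⟩
    refine ⟨⟨firstIndex s d + k, by ring⟩, ?_⟩
    have := hd.strictMono.monotone (Nat.le_add_right (firstIndex s d) k)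
    linarith [hd.lt_arrival_firstIndex s]
  · rintro ⟨⟨k, rfl⟩, h⟩
    have : firstIndex s d ≤ k := Nat.sInf_le (by simpa using h)
    obtain ⟨j, rfl⟩ := Nat.exists_eq_add_of_le this
    exact ⟨j, by ring⟩

lemma poissonHalfLine_kappa {d d' : ℕ → ℝ} (hd : IsSpacing d) (a s : ℝ) :
    poissonHalfLine a (kappa s d d') =
      (poissonHalfLine a d ∩ Iic (a + s)) ∪ poissonHalfLine (a + s) d' := by
  ext x
  simp only [poissonHalfLine, mem_ofPred_eq, mem_union, mem_inter_iff, mem_Iic]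
  constructor
  · rintro ⟨k, rfl⟩
    rcases lt_or_ge k (firstIndex s d) with hk | hk
    · rw [arrival_kappa_of_lt hk]
      exact Or.inl ⟨⟨k, rfl⟩, by linarith [arrival_le_of_lt_firstIndex hk]⟩
    · obtain ⟨j, rfl⟩ := Nat.exists_eq_add_of_le hk
      exact Or.inr ⟨j, by rw [arrival_kappa_add]; ring⟩
  · rintro (⟨⟨k, rfl⟩, h⟩ | ⟨k, rfl⟩)
    · have hk : k < firstIndex s d := by
        by_contra hk
        have := hd.strictMono.monotone (not_lt.1 hk)
        linarith [hd.lt_arrival_firstIndex s]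
      exact ⟨k, by rw [arrival_kappa_of_lt hk]⟩
    · exact ⟨firstIndex s d + k, by rw [arrival_kappa_add]; ring⟩

variable {r : ℝ} [Fact (0 < r)]

/-- A Poisson process restarted at a fixed time is again a Poisson process. -/
lemma measurePreserving_theta (s : ℝ) : MeasurePreserving (theta s) (expSeq r) (expSeq r) := by
  have hmeas : Measurable (theta s) := measurable_const.comp_theta measurable_id
  rcases le_or_gt s 0 with hs | hs0
  · refine ⟨hmeas, ?_⟩
    rw [Measure.map_congr (f := theta s) (g := id) (ae_isSpacing.mono fun d hd => theta_of_nonpos hd hs)]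
    exact Measure.map_id
  set q := expMeasure r (Iic s)
  -- expSeq r Condition on the first spacing. If it exceeds `u`, lack of memory gives the exact law;
  -- otherwise recurse with the remaining time. The error is at most the probability that the first
  -- `k` spacings are all at most `s`, which is `q ^ k`.
  have key : ∀ (k : ℕ) (B : Set (ℕ → ℝ)), MeasurableSet B → ∀ u, 0 ≤ u → u ≤ s →
      expSeq r (theta u ⁻¹' B) ≤ expSeq r B + q ^ k := by
    intro k
    induction k with
    | zero =>
      intro B _ u _ _
      rw [pow_zero]
      exact prob_le_one.trans le_add_self
    | succ k ih =>
      intro B hB u hu hus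
      have hmu : Measurable (theta u) := measurable_const.comp_theta measurable_id
      have hF : Measurable fun d : ℕ → ℝ => B.indicator (1 : (ℕ → ℝ) → ENNReal) (theta u d) :=
        (measurable_one.indicator hB).comp hmu
      have e1 : expSeq r (theta u ⁻¹' B) = ∫⁻ d, B.indicator 1 (theta u d) ∂expSeq r := by
        rw [← lintegral_indicator_one (hmu hB)]; rfl
      rw [e1, lintegral_expSeq hF, ← lintegral_add_compl _ (measurableSet_Iic (a := u)), compl_Iic]
      have h1 : ∫⁻ x in Iic u, ∫⁻ d, B.indicator 1 (theta u (scons x d)) ∂expSeq r ∂expMeasure r ≤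
          ∫⁻ _ in Iic u, (expSeq r B + q ^ k) ∂expMeasure r := by
        refine lintegral_mono_ae ?_
        filter_upwards [ae_restrict_mem measurableSet_Iic, ae_restrict_of_ae ae_pos_expMeasure]
          with x hx hx0
        have : ∫⁻ d, B.indicator 1 (theta u (scons x d)) ∂expSeq r =
            ∫⁻ d, B.indicator 1 (theta (u - x) d) ∂expSeq r := by
          refine lintegral_congr_ae (ae_isSpacing.mono fun d hd => ?_)
          simp only [theta_scons_of_le hd hu hx]
        rw [this]
        have hmx : Measurable (theta (u - x)) := measurable_const.comp_theta measurable_id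
        have e2 : expSeq r (theta (u - x) ⁻¹' B) =
            ∫⁻ d, B.indicator 1 (theta (u - x) d) ∂expSeq r := by
          rw [← lintegral_indicator_one (hmx hB)]; rfl
        rw [← e2]
        exact ih B hB _ (sub_nonneg.2 hx) (by linarith)
      have h2 : ∫⁻ x in Ioi u, ∫⁻ d, B.indicator 1 (theta u (scons x d)) ∂expSeq r ∂expMeasure r =
          expMeasure r (Ioi u) * expSeq r B := by
        have hG : Measurable fun x : ℝ => ∫⁻ d, B.indicator 1 (scons (x - u) d) ∂expSeq r :=
          Measurable.lintegral_prod_right' (f := fun p : ℝ × (ℕ → ℝ) =>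
            B.indicator 1 (scons (p.1 - u) p.2)) ((measurable_one.indicator hB).comp (by fun_prop))
        have : ∫⁻ x in Ioi u, ∫⁻ d, B.indicator 1 (theta u (scons x d)) ∂expSeq r ∂expMeasure r =
            ∫⁻ x in Ioi u, ∫⁻ d, B.indicator 1 (scons (x - u) d) ∂expSeq r ∂expMeasure r := by
          refine setLIntegral_congr_fun measurableSet_Ioi fun x hx => ?_
          simp only [theta_scons_of_lt _ hu hx]
        rw [this, setLIntegral_Ioi_expMeasure hu hG]
        simp only [add_sub_cancel_right]
        rw [← lintegral_expSeq (measurable_one.indicator hB), lintegral_indicator_one hB]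
      rw [h2]
      refine (add_le_add_left h1 _).trans ?_
      rw [setLIntegral_const, add_mul, mul_comm (expMeasure r (Ioi u))]
      have h3 : expMeasure r (Iic u) + expMeasure r (Ioi u) = 1 := by
        rw [← compl_Iic]; exact prob_add_prob_compl measurableSet_Iic
      have h4 : q ^ k * expMeasure r (Iic u) ≤ q ^ (k + 1) := by
        rw [pow_succ]
        exact mul_le_mul_right (measure_mono (Iic_subset_Iic.2 hus)) _
      calc expSeq r B * expMeasure r (Iic u) + q ^ k * expMeasure r (Iic u) +
            expSeq r B * expMeasure r (Ioi u)
          = expSeq r B * (expMeasure r (Iic u) + expMeasure r (Ioi u)) +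
            q ^ k * expMeasure r (Iic u) := by ring
        _ ≤ expSeq r B + q ^ (k + 1) := by
          rw [h3, mul_one]
          exact add_le_add_right h4 _
  -- A one-sided bound is enough, as two probability measures with `μ ≤ ν` coincide.
  have hle : (expSeq r).map (theta s) ≤ expSeq r := by
    refine Measure.le_intro fun B hB _ => ?_
    rw [Measure.map_apply hmeas hB]
    have hlim : Tendsto (fun k => expSeq r B + q ^ k) atTop (𝓝 (expSeq r B + 0)) :=
      tendsto_const_nhds.add (ENNReal.tendsto_pow_atTop_nhds_zero_of_lt_one expMeasure_Iic_lt_one)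
    rw [add_zero] at hlim
    exact ge_of_tendsto' hlim fun k => key k B hB s hs0.le le_rfl
  have : IsProbabilityMeasure ((expSeq r).map (theta s)) :=
    Measure.isProbabilityMeasure_map hmeas.aemeasurable
  exact ⟨hmeas, Measure.eq_of_le_of_isProbabilityMeasure hle⟩

/-- Two independent Poisson processes, concatenated at a fixed time, form a Poisson process. -/
lemma measurePreserving_kappa {s : ℝ} (hs : 0 ≤ s) :
    MeasurePreserving (fun p : (ℕ → ℝ) × (ℕ → ℝ) => kappa s p.1 p.2)
      ((expSeq r).prod (expSeq r)) (expSeq r) := by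
  set q := expMeasure r (Iic s)
  have hmono : ∀ u : ℝ, Measurable fun p : (ℕ → ℝ) × (ℕ → ℝ) => kappa u p.1 p.2 := measurable_kappa
  -- The same iteration as for `theta`. When the first spacing is `x ≤ u`, it stays at the head of
  -- the result, so the event `B` is replaced by its section `{d | scons x d ∈ B}`; hence the
  -- quantification over `B` inside the induction.
  have key : ∀ (k : ℕ) (B : Set (ℕ → ℝ)), MeasurableSet B → ∀ u, 0 ≤ u → u ≤ s →
      ∫⁻ d, ∫⁻ d', B.indicator 1 (kappa u d d') ∂expSeq r ∂expSeq r ≤ expSeq r B + q ^ k := by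
    intro k
    induction k with
    | zero =>
      intro B _ u _ _
      rw [pow_zero]
      refine le_trans ?_ le_add_self
      calc ∫⁻ d, ∫⁻ d', B.indicator 1 (kappa u d d') ∂expSeq r ∂expSeq r
          ≤ ∫⁻ _, ∫⁻ _, 1 ∂expSeq r ∂expSeq r :=
            lintegral_mono fun d => lintegral_mono fun d' => indicator_le_self' (by simp) _
        _ = 1 := by simp
    | succ k ih =>
      intro B hB u hu hus
      have hF : Measurable fun p : (ℕ → ℝ) × (ℕ → ℝ) =>
          B.indicator (1 : (ℕ → ℝ) → ENNReal) (kappa u p.1 p.2) :=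
        (measurable_one.indicator hB).comp (hmono u)
      have hB1 : ∀ x, MeasurableSet {d | scons x d ∈ B} := fun x =>
        (show Measurable fun d => scons x d by fun_prop) hB
      have hI : ∀ x, ∫⁻ d, B.indicator 1 (scons x d) ∂expSeq r = expSeq r {d | scons x d ∈ B} :=
        fun x => by rw [← lintegral_indicator_one (hB1 x)]; rfl
      have hBsum : expSeq r B = ∫⁻ x in Iic u, expSeq r {d | scons x d ∈ B} ∂expMeasure r +
          ∫⁻ x in Ioi u, expSeq r {d | scons x d ∈ B} ∂expMeasure r := by
        rw [← lintegral_indicator_one hB, lintegral_expSeq (measurable_one.indicator hB),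
          ← lintegral_add_compl _ (measurableSet_Iic (a := u)), compl_Iic]
        simp only [hI]
      rw [lintegral_expSeq hF.lintegral_prod_right', ← lintegral_add_compl _ (measurableSet_Iic (a := u)),
        compl_Iic]
      have h1 : ∫⁻ x in Iic u, ∫⁻ d, ∫⁻ d', B.indicator 1 (kappa u (scons x d) d') ∂expSeq r
            ∂expSeq r ∂expMeasure r ≤
          ∫⁻ x in Iic u, (expSeq r {d | scons x d ∈ B} + q ^ k) ∂expMeasure r := by
        refine lintegral_mono_ae ?_
        filter_upwards [ae_restrict_mem measurableSet_Iic, ae_restrict_of_ae ae_pos_expMeasure]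
          with x hx hx0
        have : ∫⁻ d, ∫⁻ d', B.indicator 1 (kappa u (scons x d) d') ∂expSeq r ∂expSeq r =
            ∫⁻ d, ∫⁻ d', {d | scons x d ∈ B}.indicator 1 (kappa (u - x) d d') ∂expSeq r ∂expSeq r := by
          refine lintegral_congr_ae (ae_isSpacing.mono fun d hd => ?_)
          refine lintegral_congr fun d' => ?_
          rw [kappa_scons_of_le d' hd hx]; rfl
        rw [this]
        exact ih _ (hB1 x) _ (sub_nonneg.2 hx) (by linarith)
      have h2 : ∫⁻ x in Ioi u, ∫⁻ d, ∫⁻ d', B.indicator 1 (kappa u (scons x d) d') ∂expSeq r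
            ∂expSeq r ∂expMeasure r =
          ∫⁻ x in Ioi u, expSeq r {d | scons x d ∈ B} ∂expMeasure r := by
        have hG : Measurable fun x : ℝ => ∫⁻ d, B.indicator 1 (scons x d) ∂expSeq r :=
          Measurable.lintegral_prod_right' (f := fun p : ℝ × (ℕ → ℝ) =>
            B.indicator 1 (scons p.1 p.2)) ((measurable_one.indicator hB).comp (by fun_prop))
        have : ∫⁻ x in Ioi u, ∫⁻ d, ∫⁻ d', B.indicator 1 (kappa u (scons x d) d') ∂expSeq r
              ∂expSeq r ∂expMeasure r =
            ∫⁻ _ in Ioi u, (∫⁻ x, ∫⁻ d, B.indicator 1 (scons (x + u) d) ∂expSeq r ∂expMeasure r)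
              ∂expMeasure r := by
          refine setLIntegral_congr_fun measurableSet_Ioi fun x hx => ?_
          simp only [kappa_scons_of_lt _ _ hx, lintegral_const, measure_univ, mul_one]
          have hK : Measurable fun d : ℕ → ℝ =>
              B.indicator (1 : (ℕ → ℝ) → ENNReal) (scons (u + d 0) fun n => d (n + 1)) :=
            (measurable_one.indicator hB).comp (by fun_prop)
          rw [lintegral_expSeq hK]
          simp only [scons_zero, scons_succ, add_comm u]
        -- If the first spacing passes `u`, the new one is `u + d' 0` with `d' 0` exponential; by
        -- lack of memory this is the law of a spacing conditioned to exceed `u`.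
        rw [this, setLIntegral_const, mul_comm, ← setLIntegral_Ioi_expMeasure hu hG]
        simp only [hI]
      rw [h2]
      refine (add_le_add_left h1 _).trans ?_
      have hm1 : Measurable fun x : ℝ => expSeq r {d | scons x d ∈ B} := by
        simp only [← hI]
        exact Measurable.lintegral_prod_right' (f := fun p : ℝ × (ℕ → ℝ) =>
            B.indicator 1 (scons p.1 p.2)) ((measurable_one.indicator hB).comp (by fun_prop))
      rw [lintegral_add_left hm1, setLIntegral_const, add_right_comm, ← hBsum]
      refine add_le_add_right ?_ _
      rw [pow_succ]
      exact mul_le_mul_right (measure_mono (Iic_subset_Iic.2 hus)) _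
  have hle : ((expSeq r).prod (expSeq r)).map (fun p => kappa s p.1 p.2) ≤ expSeq r := by
    refine Measure.le_intro fun B hB _ => ?_
    have e : ((expSeq r).prod (expSeq r)).map (fun p => kappa s p.1 p.2) B =
        ∫⁻ d, ∫⁻ d', B.indicator 1 (kappa s d d') ∂expSeq r ∂expSeq r := by
      rw [← lintegral_indicator_one hB, lintegral_map (measurable_one.indicator hB) (hmono s),
        lintegral_prod _ (by exact ((measurable_one.indicator hB).comp (hmono s)).aemeasurable)]
    rw [e]
    have hlim : Tendsto (fun k => expSeq r B + q ^ k) atTop (𝓝 (expSeq r B + 0)) :=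
      tendsto_const_nhds.add (ENNReal.tendsto_pow_atTop_nhds_zero_of_lt_one expMeasure_Iic_lt_one)
    rw [add_zero] at hlim
    exact ge_of_tendsto' hlim fun k => key k B hB s hs le_rfl
  have : IsProbabilityMeasure (((expSeq r).prod (expSeq r)).map (fun p => kappa s p.1 p.2)) :=
    Measure.isProbabilityMeasure_map (hmono s).aemeasurable
  exact ⟨hmono s, Measure.eq_of_le_of_isProbabilityMeasure hle⟩

end

section

/-! ### Lists of reals as a measurable space -/

/-- A list is determined by its length and its entries. -/
instance : MeasurableSpace (List ℝ) :=
  MeasurableSpace.comap (fun l => ((l.length, fun i => l.getD i 0) : ℕ × (ℕ → ℝ))) inferInstance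

/-- The list of the first `n` terms of a sequence. -/
def takeSeq : ℕ → (ℕ → ℝ) → List ℝ
  | 0, _ => []
  | n + 1, u => u 0 :: takeSeq n fun i => u (i + 1)

lemma takeSeq_getD (l : List ℝ) : takeSeq l.length (fun i => l.getD i 0) = l := by
  induction l with
  | nil => rfl
  | cons a l ih => simpa [takeSeq] using ih

lemma takeSeq_eq_map (n : ℕ) (u : ℕ → ℝ) : takeSeq n u = (List.range n).map u := by
  induction n generalizing u with
  | zero => rfl
  | succ n ih => rw [takeSeq, ih, List.range_succ_eq_map]; simp [Function.comp_def]

variable {α β γ : Type*} [MeasurableSpace α] [MeasurableSpace β] [MeasurableSpace γ]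

lemma measurable_listLength : Measurable fun l : List ℝ => l.length :=
  measurable_fst.comp (comap_measurable _)

lemma measurable_listGetD (i : ℕ) : Measurable fun l : List ℝ => l.getD i 0 :=
  ((measurable_pi_apply i).comp measurable_snd).comp
    (comap_measurable (fun l : List ℝ => ((l.length, fun i => l.getD i 0) : ℕ × (ℕ → ℝ))))

lemma measurable_list_iff {f : α → List ℝ} : Measurable f ↔
    Measurable (fun a => (f a).length) ∧ ∀ i, Measurable fun a => (f a).getD i 0 := by
  refine ⟨fun h => ⟨measurable_listLength.comp h, fun i => (measurable_listGetD i).comp h⟩, ?_⟩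
  rintro ⟨h1, h2⟩
  exact measurable_comap_iff.2 (h1.prodMk (measurable_pi_lambda _ h2))

@[fun_prop]
lemma Measurable.listCons {f : α → ℝ} {g : α → List ℝ} (hf : Measurable f) (hg : Measurable g) :
    Measurable fun a => f a :: g a := by
  refine measurable_list_iff.2 ⟨?_, fun i => ?_⟩
  · simp only [List.length_cons]
    exact (measurable_listLength.comp hg).add_const 1
  · cases i with
    | zero => simpa using hf
    | succ i => simpa [Function.comp_def] using (measurable_listGetD i).comp hg

lemma measurable_takeSeq (n : ℕ) : Measurable (takeSeq n) := by
  induction n with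
  | zero => exact measurable_const
  | succ n ih =>
    have h : Measurable fun u : ℕ → ℝ => takeSeq n fun i => u (i + 1) :=
      ih.comp (measurable_pi_lambda _ fun i => measurable_pi_apply (i + 1))
    exact (measurable_pi_apply 0).listCons h

/-- Functions of lists may be checked for measurability by recursion over the list. -/
lemma measurable_listRec {f : List ℝ → β → γ} (h0 : Measurable (f []))
    (hs : ∀ n, Measurable (fun p : (ℕ → ℝ) × β => f (takeSeq n p.1) p.2) →
      Measurable fun p : ℝ × (ℕ → ℝ) × β => f (p.1 :: takeSeq n p.2.1) p.2.2) :
    Measurable fun p : List ℝ × β => f p.1 p.2 := by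
  have h : ∀ n, Measurable fun p : (ℕ → ℝ) × β => f (takeSeq n p.1) p.2 := by
    intro n
    induction n with
    | zero => exact h0.comp measurable_snd
    | succ n ih =>
      exact (hs n ih).comp (((measurable_pi_apply 0).comp measurable_fst).prodMk
        ((measurable_pi_lambda (fun p : (ℕ → ℝ) × β => fun i => p.1 (i + 1)) (fun i =>
          (measurable_pi_apply (i + 1)).comp measurable_fst)).prodMk measurable_snd))
  have h2 : Measurable fun q : ℕ × ((ℕ → ℝ) × β) => f (takeSeq q.1 q.2.1) q.2.2 :=
    measurable_from_prod_countable_right h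
  have h3 : Measurable fun p : List ℝ × β => (p.1.length, ((fun i => p.1.getD i 0), p.2)) :=
    (measurable_listLength.comp measurable_fst).prodMk
      ((measurable_pi_lambda _ fun i => (measurable_listGetD i).comp measurable_fst).prodMk
        measurable_snd)
  have h4 := h2.comp h3
  simp only [Function.comp_def, takeSeq_getD] at h4
  exact h4

lemma measurable_listRec_comp {f : List ℝ → β → γ} {l : α → List ℝ} {b : α → β}
    (hl : Measurable l) (hb : Measurable b) (h0 : Measurable (f []))
    (hs : ∀ n, Measurable (fun p : (ℕ → ℝ) × β => f (takeSeq n p.1) p.2) →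
      Measurable fun p : ℝ × (ℕ → ℝ) × β => f (p.1 :: takeSeq n p.2.1) p.2.2) :
    Measurable fun a => f (l a) (b a) :=
  (measurable_listRec h0 hs).comp (hl.prodMk hb)

@[fun_prop]
lemma Measurable.orderedInsert {f : α → ℝ} {l : α → List ℝ} (hf : Measurable f)
    (hl : Measurable l) : Measurable fun a => (l a).orderedInsert (· ≤ ·) (f a) := by
  refine measurable_listRec_comp (f := fun l b => l.orderedInsert (· ≤ ·) b) hl hf
    (by simp only [List.orderedInsert_nil]; fun_prop) fun n ih => ?_
  simp only [List.orderedInsert_cons]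
  have h1 := measurable_takeSeq n
  refine Measurable.ite (measurableSet_le (by fun_prop) (by fun_prop)) ?_ ?_
  · have : Measurable fun p : ℝ × (ℕ → ℝ) × ℝ => takeSeq n p.2.1 := h1.comp (by fun_prop)
    fun_prop
  · have : Measurable fun p : ℝ × (ℕ → ℝ) × ℝ =>
        (takeSeq n p.2.1).orderedInsert (· ≤ ·) p.2.2 :=
      ih.comp measurable_snd
    fun_prop

@[fun_prop]
lemma Measurable.insertionSort {l : α → List ℝ} (hl : Measurable l) :
    Measurable fun a => (l a).insertionSort (· ≤ ·) := by
  refine measurable_listRec_comp (β := Unit) (b := fun _ => ())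
    (f := fun l _ => l.insertionSort (· ≤ ·)) hl measurable_const measurable_const fun n ih => ?_
  simp only [List.insertionSort_cons]
  have : Measurable fun p : ℝ × (ℕ → ℝ) × Unit => (takeSeq n p.2.1).insertionSort (· ≤ ·) :=
    ih.comp measurable_snd
  fun_prop

@[fun_prop]
lemma Measurable.listAppend {l m : α → List ℝ} (hl : Measurable l) (hm : Measurable m) :
    Measurable fun a => l a ++ m a := by
  refine measurable_listRec_comp (f := fun l b => l ++ b) hl hm
    (by simp only [List.nil_append]; fun_prop) fun n ih => ?_
  simp only [List.cons_append]
  have : Measurable fun p : ℝ × (ℕ → ℝ) × List ℝ => takeSeq n p.2.1 ++ p.2.2 :=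
    ih.comp measurable_snd
  fun_prop

@[fun_prop]
lemma Measurable.listReverse {l : α → List ℝ} (hl : Measurable l) :
    Measurable fun a => (l a).reverse := by
  refine measurable_listRec_comp (β := Unit) (b := fun _ => ())
    (f := fun l _ => l.reverse) hl measurable_const measurable_const fun n ih => ?_
  simp only [List.reverse_cons]
  have : Measurable fun p : ℝ × (ℕ → ℝ) × Unit => (takeSeq n p.2.1).reverse :=
    ih.comp measurable_snd
  have h2 : Measurable fun _ : ℝ × (ℕ → ℝ) × Unit => ([] : List ℝ) := measurable_const
  fun_prop

@[fun_prop]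
lemma Measurable.listMapNeg {l : α → List ℝ} (hl : Measurable l) :
    Measurable fun a => (l a).map fun x => -x := by
  refine measurable_listRec_comp (β := Unit) (b := fun _ => ())
    (f := fun l _ => l.map fun x => -x) hl measurable_const measurable_const fun n ih => ?_
  simp only [List.map_cons]
  have : Measurable fun p : ℝ × (ℕ → ℝ) × Unit => (takeSeq n p.2.1).map fun x => -x :=
    ih.comp measurable_snd
  fun_prop

@[fun_prop]
lemma Measurable.listErase {f : α → ℝ} {l : α → List ℝ} (hf : Measurable f)
    (hl : Measurable l) : Measurable fun a => (l a).erase (f a) := by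
  refine measurable_listRec_comp (f := fun l b => l.erase b) hl hf measurable_const fun n ih => ?_
  simp only [List.erase_cons, beq_iff_eq]
  have h1 : Measurable fun p : ℝ × (ℕ → ℝ) × ℝ => takeSeq n p.2.1 :=
    (measurable_takeSeq n).comp (by fun_prop)
  have : Measurable fun p : ℝ × (ℕ → ℝ) × ℝ => (takeSeq n p.2.1).erase p.2.2 :=
    ih.comp measurable_snd
  exact Measurable.ite (measurableSet_eq_fun (by fun_prop) (by fun_prop)) h1 (by fun_prop)

/-- The first entry of `l` which is larger than `z`, or `z` if there is none. -/
def firstLarger (l : List ℝ) (z : ℝ) : ℝ := (l.find? fun y => z < y).getD z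

@[fun_prop]
lemma Measurable.firstLarger {f : α → ℝ} {l : α → List ℝ} (hl : Measurable l)
    (hf : Measurable f) : Measurable fun a => _root_.firstLarger (l a) (f a) := by
  refine measurable_listRec_comp (f := _root_.firstLarger) hl hf measurable_id fun n ih => ?_
  have h : ∀ (a z : ℝ) (l : List ℝ), _root_.firstLarger (a :: l) z =
      if z < a then a else _root_.firstLarger l z := by
    intro a z l
    by_cases h : z < a <;> simp [_root_.firstLarger, h]
  simp only [h]
  have : Measurable fun p : ℝ × (ℕ → ℝ) × ℝ => _root_.firstLarger (takeSeq n p.2.1) p.2.2 :=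
    ih.comp measurable_snd
  exact Measurable.ite (measurableSet_lt (by fun_prop) (by fun_prop)) (by fun_prop) this

/-! ### Rounds of jumps driven by a clock -/

/-- A round of jumps as in `sweep`, the jump lengths being read off from a sequence `d`: `A s d` is
the sequence after an idle period of length `s`, and `K s d` the one after an annihilation which
occurs when a particle has travelled the distance `s`. -/
def gsweep (A K : ℝ → (ℕ → ℝ) → ℕ → ℝ) : List ℝ → List ℝ → ℝ → (ℕ → ℝ) → SweepResult
  | [], fixed, _, _ => ⟨[], fixed, []⟩
  | z :: rest, fixed, p, d =>
    let d' := A (max z p - p) d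
    let target := max z p + d' 0
    let y := firstLarger fixed z
    if z < y ∧ y ≤ target then
      let r := gsweep A K rest (fixed.erase y) y (K (y - max z p) d')
      ⟨r.moved, r.fixed, (z, y) :: r.segments⟩
    else
      let r := gsweep A K rest fixed target fun i => d' (i + 1)
      ⟨target :: r.moved, r.fixed, (z, target) :: r.segments⟩

/-- The particles which are left after a round of jumps. -/
def SweepResult.particles (r : SweepResult) : List ℝ × List ℝ := (r.moved, r.fixed)

/-- A round of jumps with the successive residual times of a Poisson clock. -/
abbrev clockSweep := gsweep theta theta

/-- A round of jumps with prescribed jump lengths. -/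
abbrev queueSweep := gsweep (fun _ d => d) fun _ d n => d (n + 1)

lemma gsweep_cons_pos {A K : ℝ → (ℕ → ℝ) → ℕ → ℝ} {z : ℝ} {rest fixed : List ℝ} {p : ℝ}
    {d : ℕ → ℝ} (h1 : z < firstLarger fixed z)
    (h2 : firstLarger fixed z ≤ max z p + A (max z p - p) d 0) :
    gsweep A K (z :: rest) fixed p d =
      let r := gsweep A K rest (fixed.erase (firstLarger fixed z)) (firstLarger fixed z)
        (K (firstLarger fixed z - max z p) (A (max z p - p) d))
      ⟨r.moved, r.fixed, (z, firstLarger fixed z) :: r.segments⟩ := by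
  rw [gsweep]
  exact if_pos ⟨h1, h2⟩

lemma gsweep_cons_neg {A K : ℝ → (ℕ → ℝ) → ℕ → ℝ} {z : ℝ} {rest fixed : List ℝ} {p : ℝ}
    {d : ℕ → ℝ} (h : z < firstLarger fixed z →
      max z p + A (max z p - p) d 0 < firstLarger fixed z) :
    gsweep A K (z :: rest) fixed p d =
      let target := max z p + A (max z p - p) d 0
      let r := gsweep A K rest fixed target fun i => A (max z p - p) d (i + 1)
      ⟨target :: r.moved, r.fixed, (z, target) :: r.segments⟩ := by
  rw [gsweep]
  exact if_neg fun h' => absurd (h h'.1) (not_lt.2 h'.2)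

/-- Only the surviving particles are tracked: the configuration determines the height function, so
the law of the drawn segments is not needed. -/
lemma measurable_gsweep {A K : ℝ → (ℕ → ℝ) → ℕ → ℝ}
    (hA : Measurable fun p : ℝ × (ℕ → ℝ) => A p.1 p.2)
    (hK : Measurable fun p : ℝ × (ℕ → ℝ) => K p.1 p.2) :
    Measurable fun q : List ℝ × List ℝ × ℝ × (ℕ → ℝ) =>
      (gsweep A K q.1 q.2.1 q.2.2.1 q.2.2.2).particles := by
  refine measurable_listRec (f := fun c (q : List ℝ × ℝ × (ℕ → ℝ)) =>
    (gsweep A K c q.1 q.2.1 q.2.2).particles) ?_ fun n ih => ?_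
  · simp only [gsweep, SweepResult.particles]
    fun_prop
  set T := ℝ × (ℕ → ℝ) × List ℝ × ℝ × (ℕ → ℝ)
  have hb : Measurable fun q : T => max q.1 q.2.2.2.1 := by fun_prop
  have hd : Measurable fun q : T => A (max q.1 q.2.2.2.1 - q.2.2.2.1) q.2.2.2.2 :=
    hA.comp ((hb.sub (by fun_prop)).prodMk (by fun_prop))
  have hy : Measurable fun q : T => firstLarger q.2.2.1 q.1 := by fun_prop
  have ht : Measurable fun q : T =>
      max q.1 q.2.2.2.1 + A (max q.1 q.2.2.2.1 - q.2.2.2.1) q.2.2.2.2 0 :=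
    hb.add ((measurable_pi_apply 0).comp hd)
  have hk := hK.comp ((hy.sub hb).prodMk hd)
  have i1 := ih.comp ((show Measurable fun q : T => q.2.1 by fun_prop).prodMk
    ((show Measurable fun q : T => q.2.2.1.erase (firstLarger q.2.2.1 q.1) by fun_prop).prodMk
      (hy.prodMk hk)))
  have i2 := ih.comp ((show Measurable fun q : T => q.2.1 by fun_prop).prodMk
    ((show Measurable fun q : T => q.2.2.1 by fun_prop).prodMk
      (ht.prodMk (measurable_pi_lambda _ fun i => (measurable_pi_apply (i + 1)).comp hd))))
  simp only [gsweep, apply_ite SweepResult.particles]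
  refine Measurable.ite ((measurableSet_lt (by fun_prop) hy).inter (measurableSet_le hy ht)) i1 ?_
  exact (ht.listCons i2.fst).prodMk i2.snd

lemma measurable_clockSweep : Measurable fun q : List ℝ × List ℝ × ℝ × (ℕ → ℝ) =>
    (clockSweep q.1 q.2.1 q.2.2.1 q.2.2.2).particles :=
  measurable_gsweep measurable_theta measurable_theta

lemma measurable_queueSweep : Measurable fun q : List ℝ × List ℝ × ℝ × (ℕ → ℝ) =>
    (queueSweep q.1 q.2.1 q.2.2.1 q.2.2.2).particles :=
  measurable_gsweep measurable_snd (measurable_pi_lambda _ fun i => by fun_prop)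

variable {r : ℝ} [Fact (0 < r)]

/-- The clock after a ring-free period of length `s`. -/
lemma setLIntegral_Ici_theta {F : (ℕ → ℝ) → ENNReal} (hF : Measurable F) (s : ℝ) :
    ∫⁻ x in Ici s, ∫⁻ d, F (theta s (scons x d)) ∂expSeq r ∂expMeasure r =
      ∫⁻ _ in Ici s, ∫⁻ d, F d ∂expSeq r ∂expMeasure r := by
  rcases le_or_gt 0 s with hs | hs
  · rw [← setLIntegral_congr (Ioi_ae_eq_Ici (μ := expMeasure r) (a := s)),
      ← setLIntegral_congr (Ioi_ae_eq_Ici (μ := expMeasure r) (a := s))]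
    have hG : Measurable fun x : ℝ => ∫⁻ d, F (scons (x - s) d) ∂expSeq r :=
      Measurable.lintegral_prod_right' (f := fun p : ℝ × (ℕ → ℝ) => F (scons (p.1 - s) p.2))
        (hF.comp (by fun_prop))
    have h1 : ∫⁻ x in Ioi s, ∫⁻ d, F (theta s (scons x d)) ∂expSeq r ∂expMeasure r =
        ∫⁻ x in Ioi s, ∫⁻ d, F (scons (x - s) d) ∂expSeq r ∂expMeasure r :=
      setLIntegral_congr_fun measurableSet_Ioi fun x hx => by
        simp only [theta_scons_of_lt _ hs hx]
    rw [h1, setLIntegral_Ioi_expMeasure hs hG, setLIntegral_const, mul_comm]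
    simp only [add_sub_cancel_right]
    rw [← lintegral_expSeq hF]
  · have hfull : (Ici s : Set ℝ) =ᵐ[expMeasure r] univ :=
      eventuallyEq_univ.2 (ae_pos_expMeasure.mono fun x hx => (hs.trans hx).le)
    rw [setLIntegral_congr hfull, setLIntegral_congr hfull]
    simp only [Measure.restrict_univ, lintegral_const, measure_univ, mul_one]
    have hG : Measurable fun d => F (theta s d) :=
      hF.comp (measurable_const.comp_theta measurable_id)
    rw [← lintegral_expSeq hG]
    exact lintegral_congr_ae (ae_isSpacing.mono fun d hd => by simp only [theta_of_nonpos hd hs.le])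

/-- Since the exponential law has no memory, a round of jumps with the residual times of a
Poisson clock has the same law as one with independent exponential jump lengths. -/
lemma lintegral_clockSweep_eq (cust fixed : List ℝ) (p : ℝ) {F : List ℝ × List ℝ → ENNReal}
    (hF : Measurable F) :
    ∫⁻ d, F (clockSweep cust fixed p d).particles ∂expSeq r =
      ∫⁻ d, F (queueSweep cust fixed p d).particles ∂expSeq r := by
  induction cust generalizing fixed p F with
  | nil => rfl
  | cons z rest ih =>
    set b := max z p
    set y := firstLarger fixed z
    have hc : ∀ x : ℝ → ℝ, ∀ f : List ℝ, Measurable x → Measurable fun q : ℝ × (ℕ → ℝ) =>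
        (clockSweep rest f (x q.1) q.2).particles := fun x f hx =>
      measurable_clockSweep.comp (measurable_const.prodMk (measurable_const.prodMk
        ((hx.comp measurable_fst).prodMk measurable_snd)))
    have hcd : ∀ x : ℝ, ∀ f : List ℝ, Measurable fun d : ℕ → ℝ =>
        (clockSweep rest f x d).particles := fun x f =>
      (hc (fun _ => x) f measurable_const).comp (measurable_const.prodMk measurable_id : Measurable
        fun d : ℕ → ℝ => ((0 : ℝ), d))
    set Φ : (ℕ → ℝ) → ENNReal := fun d => F (clockSweep rest (fixed.erase y) y d).particles with hΦ
    set Ψ : ℝ → List ℝ × List ℝ → ENNReal := fun x q => F ((b + x) :: q.1, q.2) with hΨ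
    have hΦm : Measurable Φ := hF.comp (hcd _ _)
    have hΨm : ∀ x, Measurable (Ψ x) := fun x => hF.comp (by fun_prop)
    set G : (ℕ → ℝ) → ENNReal := fun d =>
      if z < y ∧ y - b ≤ d 0 then Φ (theta (y - b) d)
      else Ψ (d 0) (clockSweep rest fixed (b + d 0) fun i => d (i + 1)).particles with hG
    have hG1 : ∀ d, z < y → y - b ≤ d 0 → G d = Φ (theta (y - b) d) := fun d h1 h2 =>
      if_pos ⟨h1, h2⟩
    have hG2 : ∀ d, ¬ (z < y ∧ y - b ≤ d 0) →
        G d = Ψ (d 0) (clockSweep rest fixed (b + d 0) fun i => d (i + 1)).particles :=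
      fun d h => if_neg h
    have hGm : Measurable G := by
      refine Measurable.ite ((MeasurableSet.const (z < y)).inter
        (measurableSet_le measurable_const (measurable_pi_apply 0)))
        (hΦm.comp (measurable_const.comp_theta measurable_id)) ?_
      have h1 : Measurable fun d : ℕ → ℝ => (clockSweep rest fixed (b + d 0) fun i => d (i + 1)).particles :=
        (hc (fun x => b + x) fixed (by fun_prop)).comp
          (by fun_prop : Measurable fun d : ℕ → ℝ => (d 0, fun i => d (i + 1)))
      exact hF.comp (((by fun_prop : Measurable fun d : ℕ → ℝ => b + d 0).listCons h1.fst).prodMk h1.snd)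
    -- The idle time `b - p` enters the round only through the restarted clock, which is what `G`
    -- receives.
    have e1 : ∀ d, F (clockSweep (z :: rest) fixed p d).particles = G (theta (b - p) d) := by
      intro d
      by_cases h : z < y ∧ y ≤ b + theta (b - p) d 0
      · rw [hG1 _ h.1 (by linarith [h.2]), clockSweep, gsweep_cons_pos h.1 h.2]; rfl
      · rw [hG2 _ (fun h' => h ⟨h'.1, by linarith [h'.2]⟩), clockSweep,
          gsweep_cons_neg fun h1 => not_le.1 fun h2 => h ⟨h1, h2⟩]; rfl
    have e2 : ∀ x d, z < y → y - b ≤ x → F (queueSweep (z :: rest) fixed p (scons x d)).particles =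
        F (queueSweep rest (fixed.erase y) y d).particles := by
      intro x d h1 h2
      have h3 : y ≤ b + scons x d 0 := by rw [scons_zero]; linarith
      rw [queueSweep, gsweep_cons_pos h1 h3]; rfl
    have e3 : ∀ x d, ¬ (z < y ∧ y - b ≤ x) →
        F (queueSweep (z :: rest) fixed p (scons x d)).particles =
          Ψ x (queueSweep rest fixed (b + x) d).particles := by
      intro x d h
      rw [queueSweep, gsweep_cons_neg fun h1 => not_le.1 fun h2 => h ⟨h1, by
        have h3 : y ≤ b + scons x d 0 := h2
        rw [scons_zero] at h3; linarith⟩]; rfl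
    have hqm : Measurable fun d => F (queueSweep (z :: rest) fixed p d).particles :=
      hF.comp (measurable_queueSweep.comp (measurable_const.prodMk (measurable_const.prodMk
        (measurable_const.prodMk measurable_id))))
    simp only [e1]
    -- Restarting the clock after the idle period does not change its law, so `theta` can be
    -- dropped; then both sides are conditioned on the first spacing.
    rw [(measurePreserving_theta (r := r) (b - p)).lintegral_comp hGm, lintegral_expSeq hGm,
      lintegral_expSeq hqm]
    have hin : ∀ x, ¬ (z < y ∧ y - b ≤ x) → ∫⁻ d, G (scons x d) ∂expSeq r =
        ∫⁻ d, F (queueSweep (z :: rest) fixed p (scons x d)).particles ∂expSeq r := fun x hx => by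
      rw [lintegral_congr fun d => e3 x d hx, lintegral_congr fun d => hG2 (scons x d) hx]
      exact ih fixed (b + x) (hΨm x)
    by_cases hzy : z < y
    -- Split according to whether the jump reaches the fixed particle. If it does, the clock keeps
    -- only its residual time, while the queue discards the jump length and takes a fresh one; these
    -- have the same law by lack of memory.
    · rw [← lintegral_add_compl (fun x => ∫⁻ d, G (scons x d) ∂expSeq r)
          (measurableSet_Ici (a := y - b)),
        ← lintegral_add_compl (fun x => ∫⁻ d, F (queueSweep (z :: rest) fixed p (scons x d)).particles
          ∂expSeq r) (measurableSet_Ici (a := y - b)), compl_Ici]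
      congr 1
      · rw [setLIntegral_congr_fun measurableSet_Ici fun x hx =>
            lintegral_congr fun d => hG1 (scons x d) hzy hx, setLIntegral_Ici_theta hΦm]
        refine setLIntegral_congr_fun measurableSet_Ici fun x hx => ?_
        rw [lintegral_congr fun d => e2 x d hzy hx]
        exact ih _ _ hF
      · exact setLIntegral_congr_fun measurableSet_Iio fun x hx =>
          hin x fun h => not_lt.2 h.2 hx
    · exact lintegral_congr fun x => hin x fun h => hzy h.1

end

section

/-! ### Counting the entries of a list -/

/-- The number of entries which are at most `x`. -/
def countLE (l : List ℝ) (x : ℝ) : ℕ := l.countP fun y => y ≤ x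

/-- The number of entries which are less than `x`. -/
def countLT (l : List ℝ) (x : ℝ) : ℕ := l.countP fun y => y < x

@[simp] lemma countLE_nil (x : ℝ) : countLE [] x = 0 := rfl

lemma countLE_cons (y : ℝ) (l : List ℝ) (x : ℝ) :
    countLE (y :: l) x = countLE l x + if y ≤ x then 1 else 0 := by
  simp [countLE, List.countP_cons]

lemma countLT_cons (y : ℝ) (l : List ℝ) (x : ℝ) :
    countLT (y :: l) x = countLT l x + if y < x then 1 else 0 := by
  simp [countLT, List.countP_cons]

lemma countLE_append (l m : List ℝ) (x : ℝ) : countLE (l ++ m) x = countLE l x + countLE m x :=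
  List.countP_append

lemma countLT_append (l m : List ℝ) (x : ℝ) : countLT (l ++ m) x = countLT l x + countLT m x :=
  List.countP_append

lemma List.Perm.countLE_eq {l m : List ℝ} (h : l.Perm m) (x : ℝ) : countLE l x = countLE m x :=
  h.countP_eq _

lemma List.Perm.countLT_eq {l m : List ℝ} (h : l.Perm m) (x : ℝ) : countLT l x = countLT m x :=
  h.countP_eq _

lemma countLE_eq_add (l : List ℝ) (x : ℝ) : countLE l x = countLT l x + l.count x := by
  induction l with
  | nil => rfl
  | cons y l ih =>
    rw [countLE_cons, countLT_cons, List.count_cons, ih]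
    rcases lt_trichotomy y x with h | h | h
    · simp [h, h.le, h.ne]; ring
    · simp [h]; ring
    · simp [h.not_ge, h.not_gt, h.ne']

/-- Between consecutive events the counts do not change: the count at `v` is the left limit at the
next event `w`. All step-by-step comparisons with the walk rest on this and on `countLE_eq_countLE`.
-/
lemma countLE_eq_countLT {l : List ℝ} {v w : ℝ} (hvw : v < w) (h : ∀ e ∈ l, v < e → w ≤ e) :
    countLE l v = countLT l w := by
  refine List.countP_congr fun e he => ?_
  simp only [decide_eq_true_eq]
  exact ⟨fun h1 => h1.trans_lt hvw, fun h1 => not_lt.1 fun h2 => absurd (h e he h2) (not_le.2 h1)⟩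

lemma countLE_eq_countLE {l : List ℝ} {v w : ℝ} (hvw : v ≤ w) (h : ∀ e ∈ l, v < e → w < e) :
    countLE l v = countLE l w := by
  refine List.countP_congr fun e he => ?_
  simp only [decide_eq_true_eq]
  exact ⟨fun h1 => h1.trans hvw, fun h1 => not_lt.1 fun h2 => absurd (h e he h2) (not_lt.2 h1)⟩

lemma countLE_eq_zero {l : List ℝ} {x : ℝ} (h : ∀ e ∈ l, x < e) : countLE l x = 0 := by
  refine List.countP_eq_zero.2 fun e he => ?_
  simpa using h e he

lemma countLT_eq_zero {l : List ℝ} {x : ℝ} (h : ∀ e ∈ l, x ≤ e) : countLT l x = 0 := by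
  refine List.countP_eq_zero.2 fun e he => ?_
  simpa using h e he

/-- The height function of a configuration of up-steps and down-steps. -/
def stepHeight (s : List ℝ × List ℝ) (x : ℝ) : ℕ := countLE s.1 x - countLE s.2 x

/-- The left limits of the height function. -/
def stepHeightLeft (s : List ℝ × List ℝ) (x : ℝ) : ℕ := countLT s.1 x - countLT s.2 x

lemma eventually_countLE_eq_countLT (l : List ℝ) (w : ℝ) :
    ∀ᶠ v in 𝓝[<] w, countLE l v = countLT l w := by
  have h : ∀ᶠ v in 𝓝[<] w, ∀ e ∈ l, v < e → w ≤ e := by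
    induction l with
    | nil => simp
    | cons y l ih =>
      have : ∀ᶠ v in 𝓝[<] w, v < y → w ≤ y := by
        rcases lt_or_ge y w with h | h
        · filter_upwards [Ioo_mem_nhdsLT h] with v hv h2
          exact absurd h2 (not_lt.2 hv.1.le)
        · exact Eventually.of_forall fun _ _ => h
      filter_upwards [ih, this] with v h1 h2
      simpa using ⟨h2, h1⟩
  filter_upwards [h, self_mem_nhdsWithin] with v hv hvw
  exact countLE_eq_countLT hvw hv

lemma eventually_countLE_eq_countLE (l : List ℝ) (v : ℝ) :
    ∀ᶠ w in 𝓝[>] v, countLE l w = countLE l v := by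
  have h : ∀ᶠ w in 𝓝[>] v, ∀ e ∈ l, v < e → w < e := by
    induction l with
    | nil => simp
    | cons y l ih =>
      have : ∀ᶠ w in 𝓝[>] v, v < y → w < y := by
        rcases lt_or_ge v y with h | h
        · filter_upwards [Ioo_mem_nhdsGT h] with w hw _
          exact hw.2
        · exact Eventually.of_forall fun _ h2 => absurd h2 (not_lt.2 h)
      filter_upwards [ih, this] with v h1 h2
      simpa using ⟨h2, h1⟩
  filter_upwards [h, self_mem_nhdsWithin] with w hw hvw
  exact (countLE_eq_countLE (le_of_lt hvw) hw).symm

lemma eventually_stepHeight_left (s : List ℝ × List ℝ) (w : ℝ) :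
    ∀ᶠ v in 𝓝[<] w, stepHeight s v = stepHeightLeft s w := by
  filter_upwards [eventually_countLE_eq_countLT s.1 w, eventually_countLE_eq_countLT s.2 w]
    with v h1 h2
  rw [stepHeight, h1, h2, stepHeightLeft]

lemma eventually_stepHeight_right (s : List ℝ × List ℝ) (v : ℝ) :
    ∀ᶠ w in 𝓝[>] v, stepHeight s w = stepHeight s v := by
  filter_upwards [eventually_countLE_eq_countLE s.1 v, eventually_countLE_eq_countLE s.2 v]
    with v h1 h2
  rw [stepHeight, h1, h2, stepHeight]

lemma leftLim_eq_of_eventually {f : ℝ → ℕ} {x : ℝ} {k : ℕ} (h : ∀ᶠ v in 𝓝[<] x, f v = k) :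
    leftLim f x = k :=
  leftLim_eq_of_tendsto
    (tendsto_const_nhds.congr' (h.mono fun _ hv => hv.symm))

lemma rightLim_eq_of_eventually {f : ℝ → ℕ} {x : ℝ} {k : ℕ} (h : ∀ᶠ v in 𝓝[>] x, f v = k) :
    rightLim f x = k :=
  rightLim_eq_of_tendsto
    (tendsto_const_nhds.congr' (h.mono fun _ hv => hv.symm))

lemma leftLim_stepHeight (s : List ℝ × List ℝ) : leftLim (stepHeight s) = stepHeightLeft s :=
  funext fun x => leftLim_eq_of_eventually (eventually_stepHeight_left s x)

/-! ### The combinatorics of a round of jumps -/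

lemma gsweep_segments_fst (A K : ℝ → (ℕ → ℝ) → ℕ → ℝ) (cust fixed : List ℝ) (p : ℝ) (d : ℕ → ℝ) :
    (gsweep A K cust fixed p d).segments.map Prod.fst = cust := by
  induction cust generalizing fixed p d with
  | nil => rfl
  | cons z rest ih =>
    simp only [gsweep]
    split_ifs <;> simp [ih]

lemma firstLarger_mem {l : List ℝ} {z : ℝ} (h : z < firstLarger l z) : firstLarger l z ∈ l := by
  unfold firstLarger at h ⊢
  cases hf : l.find? fun y => z < y with
  | none => simp [hf] at h
  | some y => simpa using List.mem_of_find?_eq_some hf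

lemma firstLarger_le {l : List ℝ} {z e : ℝ} (hl : l.Pairwise (· < ·)) (he : e ∈ l) (h : z < e) :
    z < firstLarger l z ∧ firstLarger l z ≤ e := by
  induction l with
  | nil => simp at he
  | cons a l ih =>
    rw [List.pairwise_cons] at hl
    by_cases ha : z < a
    · have : firstLarger (a :: l) z = a := by simp [firstLarger, ha]
      rw [this]
      refine ⟨ha, ?_⟩
      rcases List.mem_cons.1 he with rfl | he
      · exact le_rfl
      · exact (hl.1 e he).le
    · have : firstLarger (a :: l) z = firstLarger l z := by simp [firstLarger, ha]
      rw [this]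
      rcases List.mem_cons.1 he with rfl | he
      · exact absurd h ha
      · exact ih hl.2 he

/-- Conservation of particles: every end of a segment is a surviving moving particle or an
annihilated fixed one. This alone determines the change of the height function. -/
lemma gsweep_perm (A K : ℝ → (ℕ → ℝ) → ℕ → ℝ) (cust fixed : List ℝ) (p : ℝ) (d : ℕ → ℝ) :
    ((gsweep A K cust fixed p d).segments.map Prod.snd ++ (gsweep A K cust fixed p d).fixed).Perm
      ((gsweep A K cust fixed p d).moved ++ fixed) := by
  induction cust generalizing fixed p d with
  | nil => exact List.Perm.refl _
  | cons z rest ih =>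
    simp only [gsweep]
    split_ifs with h
    · simp only [List.map_cons, List.cons_append]
      refine ((ih _ _ _).cons _).trans ?_
      refine List.perm_middle.symm.trans ?_
      exact List.Perm.append_left _ (List.perm_cons_erase (firstLarger_mem h.1)).symm
    · simp only [List.map_cons, List.cons_append]
      exact (ih _ _ _).cons _

lemma gsweep_fixed_sublist (A K : ℝ → (ℕ → ℝ) → ℕ → ℝ) (cust fixed : List ℝ) (p : ℝ)
    (d : ℕ → ℝ) : (gsweep A K cust fixed p d).fixed.Sublist fixed := by
  induction cust generalizing fixed p d with
  | nil => exact List.Sublist.refl _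
  | cons z rest ih =>
    simp only [gsweep]
    split_ifs with h
    · exact (ih _ _ _).trans List.erase_sublist
    · exact ih _ _ _

lemma gsweep_moved_sublist (A K : ℝ → (ℕ → ℝ) → ℕ → ℝ) (cust fixed : List ℝ) (p : ℝ)
    (d : ℕ → ℝ) : (gsweep A K cust fixed p d).moved.Sublist
      ((gsweep A K cust fixed p d).segments.map Prod.snd) := by
  induction cust generalizing fixed p d with
  | nil => exact List.Sublist.refl _
  | cons z rest ih =>
    simp only [gsweep]
    split_ifs with h
    · exact (ih _ _ _).cons _
    · exact (ih _ _ _).cons_cons _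

/-- Each customer of `zs` leaves at the first time in `E` after it has arrived and its predecessor
has left; `ws` lists the departure times. -/
def IsServed (E : Set ℝ) : ℝ → List ℝ → List ℝ → Prop
  | _, [], [] => True
  | p, z :: zs, w :: ws =>
    w ∈ E ∧ max z p < w ∧ (∀ e ∈ E, max z p < e → w ≤ e) ∧ IsServed E w zs ws
  | _, _, _ => False

lemma poissonHalfLine_tail {d : ℕ → ℝ} (hd : IsSpacing d) (b : ℝ) :
    poissonHalfLine (b + d 0) (fun i => d (i + 1)) = poissonHalfLine b d ∩ Ioi (b + d 0) := by
  have h : ∀ k, arrival d (k + 1) = d 0 + arrival (fun i => d (i + 1)) k := fun k => by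
    rw [← arrival_scons_succ, scons_head_tail]
  have hd' : IsSpacing fun i => d (i + 1) := (IsSpacing.scons_iff (x := d 0)
    (by rw [scons_head_tail]; exact hd)).2
  ext x
  constructor
  · rintro ⟨k, rfl⟩
    refine ⟨⟨k + 1, by rw [h]; ring⟩, ?_⟩
    have := hd'.arrival_pos k
    simp only [mem_Ioi]; linarith
  · rintro ⟨⟨k, rfl⟩, hk⟩
    cases k with
    | zero => simp [arrival_zero] at hk
    | succ k => exact ⟨k, by rw [h]; ring⟩

/-- The sweep is the first-in-first-out queue with service times at the fixed particles and the
clock rings. Here `p` is the last departure. Hypothesis `hp` says that no fixed particle right of a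
waiting customer has been passed, which reconciles the rule "first fixed particle beyond `z`" with
"first service after `max z p`". Hypothesis `hE` compares `E` only beyond `p`, so it survives the
removal of used particles. The second conclusion places surviving down-steps at rings. -/
lemma clockSweep_isServed {cust fixed : List ℝ} {p : ℝ} {d : ℕ → ℝ} {E : Set ℝ} (hd : IsSpacing d)
    (hc : cust.Pairwise (· ≤ ·)) (hf : fixed.Pairwise (· < ·))
    (hp : ∀ y ∈ fixed, ∀ z ∈ cust, z < y → p < y)
    (hE : ∀ e, p < e → (e ∈ E ↔ e ∈ fixed ∨ e ∈ poissonHalfLine p d)) :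
    IsServed E p cust ((clockSweep cust fixed p d).segments.map Prod.snd) ∧
      ∀ x ∈ (clockSweep cust fixed p d).moved, x ∈ poissonHalfLine p d := by
  induction cust generalizing fixed p d with
  | nil => exact ⟨trivial, by simp [clockSweep, gsweep]⟩
  | cons z rest ih =>
    rw [List.pairwise_cons] at hc
    set b := max z p with hb
    set y := firstLarger fixed z with hy
    have hpb : p ≤ b := le_max_right _ _
    have hzb : z ≤ b := le_max_left _ _
    set d' := theta (b - p) d with hd'
    have hds : IsSpacing d' := hd.theta _
    have hclock : poissonHalfLine b d' = poissonHalfLine p d ∩ Ioi b := by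
      have := poissonHalfLine_theta hd p (sub_nonneg.2 hpb)
      rwa [add_sub_cancel] at this
    have htar : b + d' 0 ∈ poissonHalfLine p d := by
      have : b + d' 0 ∈ poissonHalfLine b d' := ⟨0, by rw [arrival_zero]⟩
      rw [hclock] at this
      exact this.1
    have hb0 : b < b + d' 0 := by linarith [hds.pos 0]
    have hmin : ∀ e ∈ poissonHalfLine p d, b < e → b + d' 0 ≤ e := by
      intro e he hbe
      have : e ∈ poissonHalfLine b d' := by rw [hclock]; exact ⟨he, hbe⟩
      obtain ⟨k, rfl⟩ := this
      have := hds.strictMono.monotone (Nat.zero_le k)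
      rw [arrival_zero] at this
      linarith
    by_cases h : z < y ∧ y ≤ b + d' 0
    · have hyf : y ∈ fixed := firstLarger_mem h.1
      -- The hypothesis `hp` puts the annihilation place beyond the previous departure too, so the
      -- clock is restarted at a later time.
      have hby : b < y := max_lt h.1 (hp y hyf z (by simp) h.1)
      have hclock2 : poissonHalfLine y (theta (y - b) d') = poissonHalfLine p d ∩ Ioi y := by
        have := poissonHalfLine_theta hds b (sub_nonneg.2 hby.le)
        rw [add_sub_cancel, hclock, inter_assoc, Ioi_inter_Ioi, max_eq_right hby.le] at this
        exact this
      have hnd : fixed.Nodup := hf.imp fun h => ne_of_lt h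
      obtain ⟨i1, i2⟩ := ih (fixed := fixed.erase y) (p := y) (d := theta (y - b) d')
        (hds.theta _) hc.2 (hf.sublist List.erase_sublist)
        (fun y' hy' z' hz' hlt => by
          have h1 := (hnd.mem_erase_iff).1 hy'
          exact lt_of_le_of_ne (firstLarger_le hf h1.2 ((hc.1 z' hz').trans_lt hlt)).2 (Ne.symm h1.1))
        (fun e he => by
          rw [hE e (hpb.trans_lt (hby.trans he)), hclock2, hnd.mem_erase_iff]
          simp only [mem_inter_iff, mem_Ioi, he, and_true, ne_eq, he.ne', not_false_eq_true, true_and])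
      rw [clockSweep, gsweep_cons_pos h.1 h.2]
      refine ⟨⟨(hE y (hpb.trans_lt hby)).2 (Or.inl hyf), hby, fun e he hbe => ?_, i1⟩,
        fun x hx => ?_⟩
      · rcases (hE e (hpb.trans_lt hbe)).1 he with h1 | h1
        · exact (firstLarger_le hf h1 (hzb.trans_lt hbe)).2
        · exact h.2.trans (hmin e h1 hbe)
      · have := i2 x hx
        rw [hclock2] at this
        exact this.1
    · have hn : z < y → b + d' 0 < y := fun h1 => not_le.1 fun h2 => h ⟨h1, h2⟩
      have hclock2 : poissonHalfLine (b + d' 0) (fun i => d' (i + 1)) =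
          poissonHalfLine p d ∩ Ioi (b + d' 0) := by
        rw [poissonHalfLine_tail hds, hclock, inter_assoc, Ioi_inter_Ioi, max_eq_right hb0.le]
      obtain ⟨i1, i2⟩ := ih (fixed := fixed) (p := b + d' 0) (d := fun i => d' (i + 1))
        (IsSpacing.scons_iff (x := d' 0) (by rw [scons_head_tail]; exact hds)).2 hc.2 hf
        (fun y' hy' z' hz' hlt => by
          have h1 := firstLarger_le hf hy' ((hc.1 z' hz').trans_lt hlt)
          exact (hn h1.1).trans_le h1.2)
        (fun e he => by
          rw [hE e (hpb.trans_lt (hb0.trans he)), hclock2]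
          simp only [mem_inter_iff, mem_Ioi, he, and_true])
      rw [clockSweep, gsweep_cons_neg hn]
      refine ⟨⟨(hE _ (hpb.trans_lt hb0)).2 (Or.inr htar), hb0, fun e he hbe => ?_, i1⟩,
        fun x hx => ?_⟩
      · rcases (hE e (hpb.trans_lt hbe)).1 he with h1 | h1
        · have h2 := firstLarger_le hf h1 (hzb.trans_lt hbe)
          exact (hn h2.1).le.trans h2.2
        · exact hmin e h1 hbe
      · rcases List.mem_cons.1 hx with rfl | hx
        · exact htar
        · have := i2 x hx
          rw [hclock2] at this
          exact this.1

namespace IsServed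

variable {E : Set ℝ} {p : ℝ} {zs ws : List ℝ}

lemma mem (h : IsServed E p zs ws) : ∀ w ∈ ws, w ∈ E ∧ p < w := by
  induction zs generalizing p ws with
  | nil => cases ws <;> simp_all [IsServed]
  | cons z zs ih =>
    cases ws with
    | nil => simp
    | cons w ws =>
      obtain ⟨h1, h2, -, h4⟩ := h
      have hpw := (le_max_right z p).trans_lt h2
      intro x hx
      rcases List.mem_cons.1 hx with rfl | hx
      · exact ⟨h1, hpw⟩
      · exact ⟨(ih h4 x hx).1, hpw.trans (ih h4 x hx).2⟩

lemma pairwise (h : IsServed E p zs ws) : ws.Pairwise (· < ·) := by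
  induction zs generalizing p ws with
  | nil => cases ws <;> simp_all [IsServed]
  | cons z zs ih =>
    cases ws with
    | nil => simp
    | cons w ws =>
      obtain ⟨-, -, -, h4⟩ := h
      exact List.pairwise_cons.2 ⟨fun x hx => (h4.mem x hx).2, ih h4⟩

lemma length_eq (h : IsServed E p zs ws) : ws.length = zs.length := by
  induction zs generalizing p ws with
  | nil => cases ws <;> simp_all [IsServed]
  | cons z zs ih =>
    cases ws with
    | nil => simp [IsServed] at h
    | cons w ws => simpa using ih h.2.2.2

/-- Each customer departs after its own arrival, so the queue length is never negative. -/
lemma countLE_le (h : IsServed E p zs ws) (x : ℝ) : countLE ws x ≤ countLE zs x := by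
  induction zs generalizing p ws with
  | nil => cases ws <;> simp_all [IsServed]
  | cons z zs ih =>
    cases ws with
    | nil => simp
    | cons w ws =>
      obtain ⟨-, h2, -, h4⟩ := h
      rw [countLE_cons, countLE_cons]
      have := ih h4
      have hzw := (le_max_left z p).trans_lt h2
      split_ifs with h5 h6
      · omega
      · exact absurd (hzw.le.trans h5) h6
      · omega
      · omega

/-- At each time in `E` exactly one customer leaves, unless the queue is empty. -/
lemma count_eq (h : IsServed E p zs ws) (hz : zs.Pairwise (· ≤ ·)) {e : ℝ} (he : e ∈ E)
    (hpe : p < e) : ws.count e = if countLT ws e < countLT zs e then 1 else 0 := by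
  induction zs generalizing p ws with
  | nil => cases ws <;> simp_all [IsServed]
  | cons z zs ih =>
    cases ws with
    | nil => simp [IsServed] at h
    | cons w ws =>
      obtain ⟨h1, h2, h3, h4⟩ := h
      rw [List.pairwise_cons] at hz
      have hzw := (le_max_left z p).trans_lt h2
      have hmem := h4.mem
      rcases lt_trichotomy e w with hew | rfl | hwe
      -- Before the first departure, a service time after `p` can be unused only if the first
      -- customer has not yet arrived; the queue is then empty because arrivals are sorted.
      · have hez : e ≤ z := by
          by_contra hlt
          exact absurd (h3 e he (max_lt (not_le.1 hlt) hpe)) (not_le.2 hew)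
        have c1 : (w :: ws).count e = 0 := by
          refine List.count_eq_zero.2 fun hm => ?_
          rcases List.mem_cons.1 hm with rfl | hm
          · exact lt_irrefl _ hew
          · exact absurd (hmem e hm).2 (not_lt.2 hew.le)
        have c2 : countLT (z :: zs) e = 0 := countLT_eq_zero fun x hx => by
          rcases List.mem_cons.1 hx with rfl | hx
          · exact hez
          · exact hez.trans (hz.1 x hx)
        rw [c1, c2, if_neg (by omega)]
      · have c1 : ws.count e = 0 := List.count_eq_zero.2 fun hm => lt_irrefl _ (hmem e hm).2
        have c2 : countLT (e :: ws) e = 0 := countLT_eq_zero fun x hx => by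
          rcases List.mem_cons.1 hx with rfl | hx
          · exact le_rfl
          · exact (hmem x hx).2.le
        rw [c2, countLT_cons, if_pos hzw, List.count_cons_self, c1, if_pos (by omega)]
      -- After the first departure, the first customer adds one to both counts and drops out of the
      -- comparison.
      · rw [List.count_cons_of_ne hwe.ne, countLT_cons, countLT_cons, if_pos hwe,
          if_pos (hzw.trans hwe), ih h4 hz.2 hwe]
        simp

end IsServed

end

section

/-! ### One step of the growth process in terms of configurations -/

/-- The configuration after a step in which the down-steps move to the right, the nucleations being
`N` and the jump lengths being given by a clock with spacings `d` which starts at `-L`. -/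
def clockStep (L : ℝ) (N : List ℝ) (d : ℕ → ℝ) (s : List ℝ × List ℝ) : List ℝ × List ℝ :=
  let r := clockSweep ((s.2 ++ N).insertionSort (· ≤ ·)) s.1 (-L) d
  ((r.fixed ++ N).insertionSort (· ≤ ·), r.moved)

/-- The configurations of up-steps and down-steps which occur with cutoff `L`. -/
structure IsConfig (L : ℝ) (s : List ℝ × List ℝ) : Prop where
  up_sorted : s.1.Pairwise (· < ·)
  down_sorted : s.2.Pairwise (· < ·)
  length_eq : s.1.length = s.2.length
  disjoint : ∀ x ∈ s.1, x ∉ s.2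
  lt_down : ∀ x ∈ s.2, -L < x
  up_lt : ∀ x ∈ s.1, x < L
  count_le : ∀ x, countLE s.2 x ≤ countLE s.1 x

/-- The nucleations `N` and the clock `D` do not interfere with the configuration `s` and with each
other. -/
structure IsFresh (L : ℝ) (N : List ℝ) (D : Set ℝ) (s : List ℝ × List ℝ) : Prop where
  sorted : N.Pairwise (· < ·)
  mem_Ioo : ∀ x ∈ N, x ∈ Ioo (-L) L
  notMem_up : ∀ x ∈ N, x ∉ s.1
  notMem_down : ∀ x ∈ N, x ∉ s.2
  clock_notMem : ∀ x ∈ D, x ∉ N ∧ x ∉ s.1 ∧ x ∉ s.2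

lemma pairwise_lt_insertionSort {l : List ℝ} (h : l.Nodup) :
    (l.insertionSort (· ≤ ·)).Pairwise (· < ·) := by
  have h1 : (l.insertionSort (· ≤ ·)).Pairwise (· ≤ ·) := List.pairwise_insertionSort _ _
  have h2 : (l.insertionSort (· ≤ ·)).Nodup := (List.perm_insertionSort (· ≤ ·) l).nodup_iff.2 h
  exact (h1.and h2).imp fun h => lt_of_le_of_ne h.1 h.2

lemma List.Pairwise.nodup_of_lt {l : List ℝ} (h : l.Pairwise (· < ·)) : l.Nodup :=
  h.imp fun h => ne_of_lt h

variable {L : ℝ} {N : List ℝ} {d : ℕ → ℝ} {s : List ℝ × List ℝ}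

/-- The arriving customers: the down-steps and the nucleations. -/
def customers (N : List ℝ) (s : List ℝ × List ℝ) : List ℝ := (s.2 ++ N).insertionSort (· ≤ ·)

lemma customers_perm (N : List ℝ) (s : List ℝ × List ℝ) : (customers N s).Perm (s.2 ++ N) :=
  List.perm_insertionSort _ _

lemma mem_customers {x : ℝ} : x ∈ customers N s ↔ x ∈ s.2 ∨ x ∈ N := by
  rw [(customers_perm N s).mem_iff, List.mem_append]

/-- The effect of a step on the configuration, in terms of the departure times `ws`. -/
lemma IsConfig.clockStep (hs : IsConfig L s) (hd : IsSpacing d)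
    (hN : IsFresh L N (poissonHalfLine (-L) d) s) :
    IsConfig L (clockStep L N d s) ∧ ∃ ws,
      IsServed ({x | x ∈ s.1} ∪ poissonHalfLine (-L) d) (-L) (customers N s) ws ∧
      ∀ x, (stepHeight (clockStep L N d s) x : ℤ) =
        stepHeight s x + countLE (customers N s) x - countLE ws x := by
  set r := clockSweep (customers N s) s.1 (-L) d with hr
  have hstep : _root_.clockStep L N d s = ((r.fixed ++ N).insertionSort (· ≤ ·), r.moved) := rfl
  have hcust : (customers N s).Pairwise (· ≤ ·) := List.pairwise_insertionSort _ _
  obtain ⟨h1, h2⟩ := clockSweep_isServed (E := {x | x ∈ s.1} ∪ poissonHalfLine (-L) d) (p := -L)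
    hd hcust hs.up_sorted
    (fun y _ z hz hzy => by
      refine lt_trans ?_ hzy
      rcases mem_customers.1 hz with h | h
      · exact hs.lt_down z h
      · exact (hN.mem_Ioo z h).1) (fun e _ => Iff.rfl)
  rw [← hr] at h1 h2
  set ws := r.segments.map Prod.snd with hws
  have hperm : (ws ++ r.fixed).Perm (r.moved ++ s.1) := gsweep_perm _ _ _ _ _ _
  have hsub : r.fixed.Sublist s.1 := gsweep_fixed_sublist _ _ _ _ _ _
  have hmov : r.moved.Sublist ws := gsweep_moved_sublist _ _ _ _ _ _
  have hup : ((r.fixed ++ N).insertionSort (· ≤ ·)).Perm (r.fixed ++ N) :=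
    List.perm_insertionSort _ _
  have hcount : ∀ x, countLE ws x + countLE r.fixed x = countLE r.moved x + countLE s.1 x := by
    intro x
    rw [← countLE_append, ← countLE_append, hperm.countLE_eq]
  have hcc : ∀ x, countLE (customers N s) x = countLE s.2 x + countLE N x := fun x => by
    rw [(customers_perm N s).countLE_eq, countLE_append]
  -- Nonnegativity of the new height: it equals the old height plus a queue length. This makes the
  -- truncated subtraction in `stepHeight` harmless.
  have hle : ∀ x, countLE r.moved x ≤ countLE ((r.fixed ++ N).insertionSort (· ≤ ·)) x := by
    intro x
    rw [hup.countLE_eq, countLE_append]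
    have a1 := h1.countLE_le x
    have a2 := hcount x
    have a3 := hs.count_le x
    have a4 := hcc x
    omega
  rw [hstep]
  refine ⟨⟨?_, ?_, ?_, ?_, ?_, ?_, ?_⟩, ws, h1, fun x => ?_⟩
  · refine pairwise_lt_insertionSort (List.nodup_append'.2
      ⟨(hs.up_sorted.sublist hsub).nodup_of_lt, hN.sorted.nodup_of_lt, ?_⟩)
    intro x hx hxN
    exact hN.notMem_up x hxN (hsub.subset hx)
  · exact h1.pairwise.sublist hmov
  · have e1 := hperm.length_eq
    have e2 := h1.length_eq
    have e3 := (customers_perm N s).length_eq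
    have e4 := hs.length_eq
    simp only [List.length_append] at e1 e3
    show ((r.fixed ++ N).insertionSort (· ≤ ·)).length = r.moved.length
    rw [hup.length_eq, List.length_append]
    omega
  · intro x hx hxm
    -- Surviving down-steps sit at rings, and in general position these avoid the old up-steps and
    -- the nucleations.
    have hxD := hN.clock_notMem x (h2 x hxm)
    rcases List.mem_append.1 (hup.mem_iff.1 hx) with h | h
    · exact hxD.2.1 (hsub.subset h)
    · exact hxD.1 h
  · intro x hx
    obtain ⟨k, rfl⟩ := h2 x hx
    have := hd.arrival_pos k
    linarith
  · intro x hx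
    rcases List.mem_append.1 (hup.mem_iff.1 hx) with h | h
    · exact hs.up_lt x (hsub.subset h)
    · exact (hN.mem_Ioo x h).2
  · exact hle
  · have a1 := hle x
    have a2 := hcount x
    have a3 := hs.count_le x
    have a4 := hcc x
    have a5 : countLE ((r.fixed ++ N).insertionSort (· ≤ ·)) x =
      countLE r.fixed x + countLE N x := by rw [hup.countLE_eq, countLE_append]
    simp only [stepHeight]
    omega

/-! ### The reflected walk -/

/-- An induction along the real line: a property of position and value which persists between events
and is passed on at each event holds at the end of the fold. The list need only enumerate the events
in `(v, u]` in order. -/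
lemma foldl_induction {A : Set ℝ} {u : ℝ} (f : ℕ → ℝ → ℕ) (P : ℝ → ℕ → Prop) {a : ℝ}
    (hstep : ∀ v w k, a ≤ v → v < w → w ∈ A → (∀ e ∈ A, v < e → w ≤ e) → P v k → P w (f k w))
    (hconst : ∀ v w k, a ≤ v → v ≤ w → (∀ e ∈ A, v < e → w < e) → P v k → P w k)
    (l : List ℝ) (hl : l.Pairwise (· < ·)) {v : ℝ} (hav : a ≤ v) (hvu : v ≤ u)
    (hmem : ∀ e, e ∈ l ↔ e ∈ A ∧ v < e ∧ e ≤ u) {k : ℕ} (hk : P v k) : P u (l.foldl f k) := by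
  induction l generalizing v k with
  | nil =>
    refine hconst v u k hav hvu (fun e he hve => ?_) hk
    by_contra hlt
    simpa using (hmem e).2 ⟨he, hve, not_lt.1 hlt⟩
  | cons w l ih =>
    rw [List.pairwise_cons] at hl
    have hw := (hmem w).1 (by simp)
    have hmin : ∀ e ∈ A, v < e → w ≤ e := by
      intro e he hve
      by_contra hlt
      have := (hmem e).2 ⟨he, hve, (not_le.1 hlt).le.trans hw.2.2⟩
      rcases List.mem_cons.1 this with rfl | h
      · exact hlt le_rfl
      · exact hlt (hl.1 e h).le
    refine ih hl.2 (hav.trans hw.2.1.le) hw.2.2 (fun e => ?_)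
      (hstep v w k hav hw.2.1 hw.1 hmin hk)
    constructor
    · intro he
      have h1 := (hmem e).1 (List.mem_cons_of_mem _ he)
      exact ⟨h1.1, hl.1 e he, h1.2.2⟩
    · rintro ⟨h1, h2, h3⟩
      rcases List.mem_cons.1 ((hmem e).2 ⟨h1, hw.2.1.trans h2, h3⟩) with rfl | h
      · exact absurd h2 (lt_irrefl _)
      · exact h

lemma pairwise_sortedList (S : Set ℝ) : (sortedList S).Pairwise (· < ·) := by
  unfold sortedList
  split_ifs with h
  · exact (Finset.sortedLT_sort _).pairwise
  · exact List.Pairwise.nil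

lemma mem_sortedList {S : Set ℝ} (hS : S.Finite) {x : ℝ} : x ∈ sortedList S ↔ x ∈ S := by
  simp [sortedList, hS]

lemma poissonHalfLine_inter_Iic_finite {d : ℕ → ℝ} (hd : IsSpacing d) (a u : ℝ) :
    (poissonHalfLine a d ∩ Iic u).Finite := by
  obtain ⟨n, hn⟩ := (hd.tendsto.eventually_gt_atTop (u - a)).exists
  refine ((Finset.range n).finite_toSet.image fun k => a + arrival d k).subset ?_
  rintro x ⟨⟨k, rfl⟩, hk⟩
  refine ⟨k, ?_, rfl⟩
  simp only [Finset.coe_range, mem_Iio]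
  by_contra h
  have := hd.strictMono.monotone (not_lt.1 h)
  simp only [mem_Iic] at hk
  linarith

lemma stepHeight_ne_iff (hs : IsConfig L s) {w : ℝ} :
    stepHeight s w ≠ leftLim (stepHeight s) w ↔ w ∈ s.1 ∨ w ∈ s.2 := by
  rw [leftLim_stepHeight]
  -- A point just left of `w` carries `count_le` over to the strict counts, so that the left limit
  -- is a genuine difference as well.
  obtain ⟨v, h1, h2⟩ := ((eventually_countLE_eq_countLT s.1 w).and
    (eventually_countLE_eq_countLT s.2 w)).exists
  have h3 := hs.count_le v
  have h4 := hs.count_le w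
  have h5 := countLE_eq_add s.1 w
  have h6 := countLE_eq_add s.2 w
  simp only [stepHeight, stepHeightLeft]
  by_cases hu : w ∈ s.1
  · have hd := hs.disjoint w hu
    rw [List.count_eq_one_of_mem hs.up_sorted.nodup_of_lt hu] at h5
    rw [List.count_eq_zero.2 hd] at h6
    simp only [hu, true_or, iff_true]
    omega
  · rw [List.count_eq_zero.2 hu] at h5
    by_cases hd : w ∈ s.2
    · rw [List.count_eq_one_of_mem hs.down_sorted.nodup_of_lt hd] at h6
      simp only [hd, or_true, iff_true]
      omega
    · rw [List.count_eq_zero.2 hd] at h6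
      simp only [hu, hd, or_self, iff_false, not_not]
      omega

lemma reflectedWalk_induction {U : Set ℝ} (hs : IsConfig L s) (hd : IsSpacing d)
    (hU : ∀ x, x ∈ U ∩ Icc (-L) L ↔ x ∈ N) (P : ℝ → ℕ → Prop) {u : ℝ} (hu : -L < u)
    (h0 : P (-L) (stepHeight s (-L)))
    (hstep : ∀ v w k, -L ≤ v → v < w →
      (w ∈ N ∨ w ∈ poissonHalfLine (-L) d ∨ w ∈ s.1 ∨ w ∈ s.2) →
      (∀ e, (e ∈ N ∨ e ∈ poissonHalfLine (-L) d ∨ e ∈ s.1 ∨ e ∈ s.2) → v < e → w ≤ e) →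
      P v k → P w (walkStep L U (poissonHalfLine (-L) d) (stepHeight s) k w))
    (hconst : ∀ v w k, -L ≤ v → v ≤ w →
      (∀ e, (e ∈ N ∨ e ∈ poissonHalfLine (-L) d ∨ e ∈ s.1 ∨ e ∈ s.2) → v < e → w < e) →
      P v k → P w k) :
    P u (reflectedWalk L U (poissonHalfLine (-L) d) (stepHeight s) u) := by
  rw [reflectedWalk, if_neg (not_le.2 hu)]
  set A := (U ∩ Icc (-L) L) ∪ poissonHalfLine (-L) d ∪
    {w | stepHeight s w ≠ leftLim (stepHeight s) w} with hA
  have hAmem : ∀ e, e ∈ A ↔ (e ∈ N ∨ e ∈ poissonHalfLine (-L) d ∨ e ∈ s.1 ∨ e ∈ s.2) := by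
    intro e
    rw [hA, mem_union, mem_union, hU, mem_ofPred_eq, stepHeight_ne_iff hs, or_assoc]
  have hfin : (A ∩ Ioc (-L) u).Finite := by
    have : A ∩ Ioc (-L) u ⊆ {x | x ∈ N} ∪ (poissonHalfLine (-L) d ∩ Iic u) ∪ {x | x ∈ s.1} ∪
        {x | x ∈ s.2} := by
      rintro e ⟨h1, h2⟩
      rcases (hAmem e).1 h1 with h | h | h | h
      · exact Or.inl (Or.inl (Or.inl h))
      · exact Or.inl (Or.inl (Or.inr ⟨h, h2.2⟩))
      · exact Or.inl (Or.inr h)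
      · exact Or.inr h
    exact ((((List.finite_toSet N).union (poissonHalfLine_inter_Iic_finite hd _ _)).union
      (List.finite_toSet s.1)).union (List.finite_toSet s.2)).subset this
  refine foldl_induction (A := A) _ P (fun v w k h1 h2 h3 h4 h5 => ?_) (fun v w k h1 h2 h3 h4 => ?_) _
    (pairwise_sortedList _) le_rfl hu.le (fun e => ?_) h0
  · exact hstep v w k h1 h2 ((hAmem w).1 h3) (fun e he => h4 e ((hAmem e).2 he)) h5
  · exact hconst v w k h1 h2 (fun e he => h3 e ((hAmem e).2 he)) h4
  · rw [mem_sortedList hfin]; rfl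

/-- The walk reflected off the height function of a configuration is the height function of the
configuration after the step. -/
lemma reflectedWalk_eq_stepHeight {U : Set ℝ} (hs : IsConfig L s) (hd : IsSpacing d)
    (hN : IsFresh L N (poissonHalfLine (-L) d) s) (hU : ∀ x, x ∈ U ∩ Icc (-L) L ↔ x ∈ N) :
    reflectedWalk L U (poissonHalfLine (-L) d) (stepHeight s) = stepHeight (clockStep L N d s) := by
  obtain ⟨-, ws, hws, hh⟩ := hs.clockStep hd hN
  have hcgt : ∀ x ∈ customers N s, -L < x := fun x hx => by
    rcases mem_customers.1 hx with h | h
    · exact hs.lt_down x h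
    · exact (hN.mem_Ioo x h).1
  funext u
  have hlow : ∀ u, u ≤ -L → stepHeight s u = stepHeight (clockStep L N d s) u := fun u hu => by
    have h1 := hh u
    rw [countLE_eq_zero fun x hx => hu.trans_lt (hcgt x hx),
      countLE_eq_zero fun x hx => hu.trans_lt (hws.mem x hx).2] at h1
    omega
  rcases le_or_gt u (-L) with hu | hu
  · rw [reflectedWalk, if_pos hu]
    exact hlow u hu
  -- By `hh`, the new height exceeds the barrier by the queue length. So it suffices that each kind
  -- of event changes the walk as it changes barrier plus queue length.
  refine reflectedWalk_induction hs hd hU (fun v k => k = stepHeight (clockStep L N d s) v) hu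
    (hlow _ le_rfl) (fun v w k hv hvw hw hmin hk => ?_) (fun v w k hv hvw hmin hk => ?_)
  · have e1 : countLE s.1 v = countLT s.1 w :=
      countLE_eq_countLT hvw fun e he => hmin e (Or.inr (Or.inr (Or.inl he)))
    have e2 : countLE s.2 v = countLT s.2 w :=
      countLE_eq_countLT hvw fun e he => hmin e (Or.inr (Or.inr (Or.inr he)))
    have e3 : countLE (customers N s) v = countLT (customers N s) w := by
      refine countLE_eq_countLT hvw fun e he => hmin e ?_
      rcases mem_customers.1 he with h | h
      · exact Or.inr (Or.inr (Or.inr h))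
      · exact Or.inl h
    have hE : ∀ e ∈ ws, e ∈ s.1 ∨ e ∈ poissonHalfLine (-L) d := fun e he => (hws.mem e he).1
    have e4 : countLE ws v = countLT ws w := by
      refine countLE_eq_countLT hvw fun e he => hmin e ?_
      rcases hE e he with h | h
      · exact Or.inr (Or.inr (Or.inl h))
      · exact Or.inr (Or.inl h)
    have f1 := countLE_eq_add s.1 w
    have f2 := countLE_eq_add s.2 w
    have f3 := countLE_eq_add (customers N s) w
    have f4 := countLE_eq_add ws w
    have g1 := hh v
    have g2 := hh w
    have i1 := hs.count_le v
    have i2 := hs.count_le w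
    have i3 := hws.countLE_le v
    have hcc : (customers N s).count w = s.2.count w + N.count w := by
      rw [(customers_perm N s).count_eq, List.count_append]
    have hserve := fun h => hws.count_eq (List.pairwise_insertionSort _ _) (e := w) h
      (hv.trans_lt hvw)
    have hleft : leftLim (stepHeight s) w = countLT s.1 w - countLT s.2 w := by
      rw [leftLim_stepHeight]; rfl
    have hgw : stepHeight s w = countLE s.1 w - countLE s.2 w := rfl
    have hgv : stepHeight s v = countLE s.1 v - countLE s.2 v := rfl
    show walkStep L U (poissonHalfLine (-L) d) (stepHeight s) k w = _
    rw [walkStep]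
    by_cases hwN : w ∈ N
    · rw [if_pos ((hU w).2 hwN)]
      have j1 := List.count_eq_zero.2 (hN.notMem_up w hwN)
      have j2 := List.count_eq_zero.2 (hN.notMem_down w hwN)
      have j3 := List.count_eq_one_of_mem hN.sorted.nodup_of_lt hwN
      have j4 : ws.count w = 0 := List.count_eq_zero.2 fun h => by
        rcases hE w h with h | h
        · exact hN.notMem_up w hwN h
        · exact (hN.clock_notMem w h).1 hwN
      omega
    rw [if_neg fun h => hwN ((hU w).1 h)]
    have j3 := List.count_eq_zero.2 hwN
    by_cases hwD : w ∈ poissonHalfLine (-L) d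
    -- The walk is above the barrier exactly when the queue is non-empty, and then the ring serves a
    -- customer.
    · have j := hN.clock_notMem w hwD
      have j1 := List.count_eq_zero.2 j.2.1
      have j2 := List.count_eq_zero.2 j.2.2
      have j4 := hserve (Or.inr hwD)
      rw [if_pos hwD]
      split_ifs at j4 ⊢ <;> omega
    rw [if_neg hwD]
    rcases hw with h | h | h | h
    · exact absurd h hwN
    · exact absurd h hwD
    -- At an up-step of the barrier, either a customer is served and the walk keeps its value, or
    -- the queue is empty and the walk is pushed.
    · have j1 := List.count_eq_one_of_mem hs.up_sorted.nodup_of_lt h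
      have j2 := List.count_eq_zero.2 (hs.disjoint w h)
      have j4 := hserve (Or.inl h)
      rw [hleft, hgw]
      split_ifs at j4 ⊢ <;> omega
    -- At a down-step of the barrier, the walk stays and the distance to the barrier grows by one:
    -- an arrival.
    · have hup : w ∉ s.1 := fun h' => hs.disjoint w h' h
      have j1 := List.count_eq_zero.2 hup
      have j2 := List.count_eq_one_of_mem hs.down_sorted.nodup_of_lt h
      have j4 : ws.count w = 0 := List.count_eq_zero.2 fun h => by
        rcases hE w h with h | h
        · exact hup h
        · exact hwD h
      rw [if_neg (by rw [hleft, hgw]; omega)]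
      omega
  · have e1 : countLE s.1 v = countLE s.1 w :=
      countLE_eq_countLE hvw fun e he => hmin e (Or.inr (Or.inr (Or.inl he)))
    have e2 : countLE s.2 v = countLE s.2 w :=
      countLE_eq_countLE hvw fun e he => hmin e (Or.inr (Or.inr (Or.inr he)))
    have e3 : countLE (customers N s) v = countLE (customers N s) w := by
      refine countLE_eq_countLE hvw fun e he => hmin e ?_
      rcases mem_customers.1 he with h | h
      · exact Or.inr (Or.inr (Or.inr h))
      · exact Or.inl h
    have e4 : countLE ws v = countLE ws w := by
      refine countLE_eq_countLE hvw fun e he => hmin e ?_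
      rcases (hws.mem e he).1 with h | h
      · exact Or.inr (Or.inr (Or.inl h))
      · exact Or.inr (Or.inl h)
    have g1 := hh v
    have g2 := hh w
    simp only [stepHeight] at g1 g2 hk ⊢
    omega

end

section

/-! ### Reflection in the origin -/

/-- The reflection of a configuration in the origin, which exchanges up-steps and down-steps. -/
def mirror (s : List ℝ × List ℝ) : List ℝ × List ℝ :=
  (s.2.reverse.map fun x => -x, s.1.reverse.map fun x => -x)

lemma reverse_map_neg_reverse_map_neg (l : List ℝ) :
    ((l.reverse.map fun x => -x).reverse.map fun x => -x) = l := by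
  rw [← List.map_reverse, List.reverse_reverse, List.map_map]
  simp [Function.comp_def]

@[simp] lemma mirror_mirror (s : List ℝ × List ℝ) : mirror (mirror s) = s := by
  simp only [mirror, reverse_map_neg_reverse_map_neg]

lemma mem_reverse_map_neg {l : List ℝ} {x : ℝ} : x ∈ (l.reverse.map fun x => -x) ↔ -x ∈ l := by
  simp only [List.mem_map, List.mem_reverse]
  constructor
  · rintro ⟨y, hy, rfl⟩; simpa using hy
  · exact fun h => ⟨-x, h, by simp⟩

lemma pairwise_reverse_map_neg {l : List ℝ} (h : l.Pairwise (· < ·)) :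
    (l.reverse.map fun x => -x).Pairwise (· < ·) := by
  rw [List.pairwise_map, List.pairwise_reverse]
  exact h.imp fun h => neg_lt_neg h

lemma countLE_reverse_map_neg (l : List ℝ) (x : ℝ) :
    countLE (l.reverse.map fun x => -x) x + countLT l (-x) = l.length := by
  induction l with
  | nil => rfl
  | cons y l ih =>
    rw [List.reverse_cons, List.map_append, countLE_append, List.map_singleton, countLE_cons,
      countLT_cons, countLE_nil, List.length_cons]
    by_cases h : -y ≤ x
    · rw [if_pos h, if_neg (by linarith)]; omega
    · rw [if_neg h, if_pos (by linarith)]; omega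

lemma countLT_reverse_map_neg (l : List ℝ) (x : ℝ) :
    countLT (l.reverse.map fun x => -x) x + countLE l (-x) = l.length := by
  have := countLE_reverse_map_neg (l.reverse.map fun x => -x) (-x)
  rw [reverse_map_neg_reverse_map_neg, neg_neg, List.length_map, List.length_reverse] at this
  omega

/-- Equally many up-steps and down-steps give height zero on the far right, so counting from the
right gives the same height. Right continuity becomes left continuity, hence `stepHeightLeft`. -/
lemma stepHeight_mirror {s : List ℝ × List ℝ} (hs : s.1.length = s.2.length) (x : ℝ) :
    stepHeight (mirror s) x = stepHeightLeft s (-x) := by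
  have h1 := countLE_reverse_map_neg s.1 x
  have h2 := countLE_reverse_map_neg s.2 x
  simp only [stepHeight, stepHeightLeft, mirror]
  omega

lemma stepHeightLeft_mirror {s : List ℝ × List ℝ} (hs : s.1.length = s.2.length) (x : ℝ) :
    stepHeightLeft (mirror s) x = stepHeight s (-x) := by
  have h1 := countLT_reverse_map_neg s.1 x
  have h2 := countLT_reverse_map_neg s.2 x
  simp only [stepHeight, stepHeightLeft, mirror]
  omega

lemma countLT_le_countLT {l m : List ℝ} (h : ∀ x, countLE l x ≤ countLE m x) (x : ℝ) :
    countLT l x ≤ countLT m x := by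
  obtain ⟨v, h1, h2⟩ := ((eventually_countLE_eq_countLT l x).and
    (eventually_countLE_eq_countLT m x)).exists
  rw [← h1, ← h2]
  exact h v

lemma IsConfig.mirror {L : ℝ} {s : List ℝ × List ℝ} (hs : IsConfig L s) :
    IsConfig L (mirror s) where
  up_sorted := pairwise_reverse_map_neg hs.down_sorted
  down_sorted := pairwise_reverse_map_neg hs.up_sorted
  length_eq := by simpa [_root_.mirror] using hs.length_eq.symm
  disjoint x hx hx' := hs.disjoint _ (mem_reverse_map_neg.1 hx') (mem_reverse_map_neg.1 hx)
  lt_down x hx := by linarith [hs.up_lt _ (mem_reverse_map_neg.1 hx)]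
  up_lt x hx := by linarith [hs.lt_down _ (mem_reverse_map_neg.1 hx)]
  count_le x := by
    have h1 := countLE_reverse_map_neg s.1 x
    have h2 := countLE_reverse_map_neg s.2 x
    have h3 := hs.length_eq
    have h4 := countLT_le_countLT hs.count_le (-x)
    simp only [_root_.mirror]
    omega

/-! ### Upper semicontinuous modifications -/

lemma uscMod_eq_of_eventually {f : ℝ → ℕ} {x : ℝ} {j k : ℕ} (hj : ∀ᶠ v in 𝓝[<] x, f v = j)
    (hk : ∀ᶠ v in 𝓝[>] x, f v = k) : uscMod f x = max j k := by
  rw [uscMod, leftLim_eq_of_eventually hj, rightLim_eq_of_eventually hk]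

lemma eventually_uscMod_right {f : ℝ → ℕ} {x : ℝ} {k : ℕ} (hk : ∀ᶠ v in 𝓝[>] x, f v = k) :
    ∀ᶠ v in 𝓝[>] x, uscMod f v = k := by
  have h := eventually_eventually_nhdsWithin.2 hk
  filter_upwards [h, self_mem_nhdsWithin] with v hv hxv
  rw [isOpen_Ioi.nhdsWithin_eq hxv] at hv
  rw [uscMod_eq_of_eventually (hv.filter_mono nhdsWithin_le_nhds)
    (hv.filter_mono nhdsWithin_le_nhds), max_self]

lemma eventually_uscMod_left {f : ℝ → ℕ} {x : ℝ} {k : ℕ} (hk : ∀ᶠ v in 𝓝[<] x, f v = k) :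
    ∀ᶠ v in 𝓝[<] x, uscMod f v = k := by
  have h := eventually_eventually_nhdsWithin.2 hk
  filter_upwards [h, self_mem_nhdsWithin] with v hv hxv
  rw [isOpen_Iio.nhdsWithin_eq hxv] at hv
  rw [uscMod_eq_of_eventually (hv.filter_mono nhdsWithin_le_nhds)
    (hv.filter_mono nhdsWithin_le_nhds), max_self]

lemma uscMod_stepHeight (s : List ℝ × List ℝ) (x : ℝ) :
    uscMod (stepHeight s) x = max (stepHeightLeft s x) (stepHeight s x) :=
  uscMod_eq_of_eventually (eventually_stepHeight_left s x) (eventually_stepHeight_right s x)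

lemma uscMod_uscMod_stepHeight (s : List ℝ × List ℝ) :
    uscMod (uscMod (stepHeight s)) = uscMod (stepHeight s) := by
  funext x
  rw [uscMod_stepHeight]
  exact uscMod_eq_of_eventually (eventually_uscMod_left (eventually_stepHeight_left s x))
    (eventually_uscMod_right (eventually_stepHeight_right s x))

lemma rightLim_uscMod_stepHeight (s : List ℝ × List ℝ) :
    rightLim (uscMod (stepHeight s)) = stepHeight s :=
  funext fun x => rightLim_eq_of_eventually
    (eventually_uscMod_right (eventually_stepHeight_right s x))

/-- The upper semicontinuous modification retains both one-sided limits, so the càdlàg barrier for a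
leftward step can be recovered and is the height of the mirrored configuration. -/
lemma rightLim_uscMod_stepHeight_neg {s : List ℝ × List ℝ} (hs : s.1.length = s.2.length) :
    rightLim (fun u => uscMod (stepHeight s) (-u)) = stepHeight (mirror s) := by
  funext x
  rw [stepHeight_mirror hs]
  exact rightLim_eq_of_eventually (tendsto_neg_nhdsGT.eventually
    (eventually_uscMod_left (eventually_stepHeight_left s (-x))))

lemma uscMod_stepHeight_neg {s : List ℝ × List ℝ} (hs : s.1.length = s.2.length) :
    uscMod (fun u => stepHeight s (-u)) = uscMod (stepHeight (mirror s)) := by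
  funext x
  rw [uscMod_stepHeight, stepHeight_mirror hs, stepHeightLeft_mirror hs]
  exact uscMod_eq_of_eventually
    (tendsto_neg_nhdsLT.eventually (eventually_stepHeight_right s (-x)))
    (tendsto_neg_nhdsGT.eventually (eventually_stepHeight_left s (-x)))

/-! ### The nucleations -/

/-- The points of a Poisson process with the given spacings in `[-L, L]`, in increasing order. -/
def nucleations (L : ℝ) (a : Bool × ℕ → ℝ) : List ℝ :=
  (takeSeq (firstIndex L fun i => a (false, i))
    fun k => arrival (fun i => a (false, i)) k).reverse.map (fun x => -x) ++
  takeSeq (firstIndex L fun i => a (true, i)) fun k => arrival (fun i => a (true, i)) k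

lemma mem_takeSeq {n : ℕ} {u : ℕ → ℝ} {x : ℝ} : x ∈ takeSeq n u ↔ ∃ k < n, x = u k := by
  rw [takeSeq_eq_map]
  simp [eq_comm]

lemma pairwise_takeSeq {n : ℕ} {u : ℕ → ℝ} (hu : StrictMono u) :
    (takeSeq n u).Pairwise (· < ·) := by
  rw [takeSeq_eq_map, List.pairwise_map]
  exact List.pairwise_lt_range.imp fun h => hu h

/-- Both halves of the spacings of a Poisson process on the line are regular. -/
def IsLineSpacing (a : Bool × ℕ → ℝ) : Prop :=
  IsSpacing (fun i => a (true, i)) ∧ IsSpacing fun i => a (false, i)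

lemma IsSpacing.lt_firstIndex_iff {d : ℕ → ℝ} (hd : IsSpacing d) {s : ℝ} {k : ℕ} :
    k < firstIndex s d ↔ arrival d k ≤ s := by
  refine ⟨arrival_le_of_lt_firstIndex, fun h => ?_⟩
  by_contra hk
  have := hd.strictMono.monotone (not_lt.1 hk)
  linarith [hd.lt_arrival_firstIndex s]

lemma mem_nucleations {L : ℝ} {a : Bool × ℕ → ℝ} (ha : IsLineSpacing a) {x : ℝ} :
    x ∈ nucleations L a ↔ x ∈ poissonLine a ∩ Icc (-L) L := by
  simp only [nucleations, List.mem_append, mem_reverse_map_neg, mem_takeSeq,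
    ha.1.lt_firstIndex_iff, ha.2.lt_firstIndex_iff, poissonLine, mem_inter_iff, mem_ofPred_eq, mem_Icc]
  constructor
  · rintro (⟨k, h1, h2⟩ | ⟨k, h1, rfl⟩)
    · have := ha.2.arrival_pos k
      exact ⟨⟨k, Or.inr (by linarith)⟩, by linarith, by linarith⟩
    · have := ha.1.arrival_pos k
      exact ⟨⟨k, Or.inl rfl⟩, by linarith, by linarith⟩
  · rintro ⟨⟨k, rfl | rfl⟩, h1, h2⟩
    · exact Or.inr ⟨k, h2, rfl⟩
    · exact Or.inl ⟨k, by linarith, by ring⟩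

lemma pairwise_nucleations {L : ℝ} {a : Bool × ℕ → ℝ} (ha : IsLineSpacing a) :
    (nucleations L a).Pairwise (· < ·) := by
  rw [nucleations, List.pairwise_append]
  refine ⟨pairwise_reverse_map_neg (pairwise_takeSeq ha.2.strictMono),
    pairwise_takeSeq ha.1.strictMono, fun x hx y hy => ?_⟩
  obtain ⟨k, -, hk⟩ := mem_takeSeq.1 (mem_reverse_map_neg.1 hx)
  obtain ⟨j, -, rfl⟩ := mem_takeSeq.1 hy
  linarith [ha.2.arrival_pos k, ha.1.arrival_pos j]

/-- Reflecting the nucleations amounts to exchanging the two half-line spacings, which preserves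
their law. -/
lemma nucleations_swap (L : ℝ) (a : Bool × ℕ → ℝ) :
    nucleations L (fun i => a (!i.1, i.2)) = (nucleations L a).reverse.map fun x => -x := by
  simp only [nucleations, List.reverse_append, List.map_append, reverse_map_neg_reverse_map_neg,
    Bool.not_true, Bool.not_false]

lemma eq_of_pairwise_lt {l m : List ℝ} (hl : l.Pairwise (· < ·)) (hm : m.Pairwise (· < ·))
    (h : ∀ x, x ∈ l ↔ x ∈ m) : l = m :=
  List.Perm.eq_of_pairwise (fun _ _ _ _ h1 h2 => absurd h1 (lt_asymm h2)) hl hm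
    ((List.perm_ext_iff_of_nodup hl.nodup_of_lt hm.nodup_of_lt).2 h)

lemma sortedList_poissonLine {L : ℝ} {a : Bool × ℕ → ℝ} (ha : IsLineSpacing a) :
    sortedList (poissonLine a ∩ Icc (-L) L) = nucleations L a := by
  have hfin : (poissonLine a ∩ Icc (-L) L).Finite :=
    (List.finite_toSet (nucleations L a)).subset fun x hx => (mem_nucleations ha).2 hx
  refine eq_of_pairwise_lt (pairwise_sortedList _) (pairwise_nucleations ha) fun x => ?_
  rw [mem_sortedList hfin, mem_nucleations ha]

lemma measurable_nucleations (L : ℝ) : Measurable (nucleations L) := by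
  have h : ∀ b : Bool, Measurable fun a : Bool × ℕ → ℝ =>
      takeSeq (firstIndex L fun i => a (b, i)) fun k => arrival (fun i => a (b, i)) k := by
    intro b
    have h1 : Measurable fun a : Bool × ℕ → ℝ => fun i : ℕ => a (b, i) := by fun_prop
    exact Measurable.apply_nat (f := fun n (a : Bool × ℕ → ℝ) =>
      takeSeq n fun k => arrival (fun i => a (b, i)) k)
      (fun n => (measurable_takeSeq n).comp
        (measurable_pi_lambda _ fun k => (measurable_arrival k).comp h1))
      (measurable_firstIndex.comp (measurable_const.prodMk h1))
  exact (h false).listReverse.listMapNeg.listAppend (h true)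

/-! ### The growth process in terms of configurations -/

/-- The configurations of the growth process. -/
def clockChain (L : ℝ) (a : ℕ × Bool × ℕ → ℝ) (d : ℕ × ℕ → ℝ) : ℕ → List ℝ × List ℝ
  | 0 => ([], [])
  | t + 1 =>
    let N := nucleations L fun i => a (t + 1, i)
    if Odd (t + 1) then clockStep L N (fun i => d (t + 1, i)) (clockChain L a d t)
    else mirror (clockStep L N (fun i => d (t + 1, i)) (mirror (clockChain L a d t)))

/-- The noise of step `t` is in general position with respect to the configuration `s`. -/
structure IsGeneric (L : ℝ) (t : ℕ) (s : List ℝ × List ℝ) (a : Bool × ℕ → ℝ) (d : ℕ → ℝ) :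
    Prop where
  line : IsLineSpacing a
  clock : IsSpacing d
  fresh : IsFresh L (nucleations L a) (poissonHalfLine (-L) d) (if Odd t then s else mirror s)

/-- The noise is in general position at all times. -/
def IsGenericNoise (L : ℝ) (a : ℕ × Bool × ℕ → ℝ) (d : ℕ × ℕ → ℝ) : Prop :=
  ∀ t, IsGeneric L (t + 1) (clockChain L a d t) (fun i => a (t + 1, i)) fun i => d (t + 1, i)

lemma isConfig_nil (L : ℝ) : IsConfig L ([], []) := by
  constructor <;> simp

lemma IsGenericNoise.isConfig {L : ℝ} {a : ℕ × Bool × ℕ → ℝ} {d : ℕ × ℕ → ℝ}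
    (h : IsGenericNoise L a d) (t : ℕ) : IsConfig L (clockChain L a d t) := by
  induction t with
  | zero => exact isConfig_nil L
  | succ t ih =>
    have hg := h t
    have hf := hg.fresh
    rw [clockChain]
    split_ifs at hf ⊢ with ho
    · exact (ih.clockStep hg.clock hf).1
    · exact (ih.mirror.clockStep hg.clock hf).1.mirror

lemma IsGenericNoise.reflectedWalk_odd {L : ℝ} {a : ℕ × Bool × ℕ → ℝ} {d : ℕ × ℕ → ℝ}
    (h : IsGenericNoise L a d) {t : ℕ} (ho : Odd (t + 1)) :
    reflectedWalk L (poissonLine fun i => a (t + 1, i)) (poissonHalfLine (-L) fun i => d (t + 1, i))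
      (stepHeight (clockChain L a d t)) = stepHeight (clockChain L a d (t + 1)) := by
  have hg := h t
  have hf := hg.fresh
  rw [if_pos ho] at hf
  rw [reflectedWalk_eq_stepHeight (h.isConfig t) hg.clock hf
    fun x => (mem_nucleations hg.line).symm, clockChain, if_pos ho]

lemma IsGenericNoise.reflectedWalk_even {L : ℝ} {a : ℕ × Bool × ℕ → ℝ} {d : ℕ × ℕ → ℝ}
    (h : IsGenericNoise L a d) {t : ℕ} (ho : ¬ Odd (t + 1)) :
    reflectedWalk L (poissonLine fun i => a (t + 1, i)) (poissonHalfLine (-L) fun i => d (t + 1, i))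
      (stepHeight (mirror (clockChain L a d t))) =
        stepHeight (mirror (clockChain L a d (t + 1))) := by
  have hg := h t
  have hf := hg.fresh
  rw [if_neg ho] at hf
  rw [reflectedWalk_eq_stepHeight (h.isConfig t).mirror hg.clock hf
    fun x => (mem_nucleations hg.line).symm, clockChain, if_neg ho, mirror_mirror]

lemma IsGenericNoise.growth_eq {L : ℝ} {a : ℕ × Bool × ℕ → ℝ} {d : ℕ × ℕ → ℝ}
    (h : IsGenericNoise L a d) (t : ℕ) :
    growth L a d t = uscMod (stepHeight (clockChain L a d t)) := by
  induction t with
  | zero =>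
    funext x
    rw [uscMod_stepHeight]
    rfl
  | succ t ih =>
    rw [growth]
    split_ifs with ho
    · rw [ih, rightLim_uscMod_stepHeight, h.reflectedWalk_odd ho]
    · rw [ih, rightLim_uscMod_stepHeight_neg (h.isConfig t).length_eq, h.reflectedWalk_even ho,
        uscMod_stepHeight_neg (h.isConfig (t + 1)).mirror.length_eq, mirror_mirror]

lemma toUC_congr {f g : ℝ → ℕ} (h : uscMod f = uscMod g) : toUC f = toUC g := by
  unfold toUC
  generalize uscMod f = F at h
  subst h
  rfl

lemma toUC_uscMod_stepHeight (s : List ℝ × List ℝ) :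
    toUC (uscMod (stepHeight s)) = toUC (stepHeight s) :=
  toUC_congr (uscMod_uscMod_stepHeight s)

lemma IsGenericNoise.growthProcess_eq {L : ℝ} {a : ℕ × Bool × ℕ → ℝ} {d : ℕ × ℕ → ℝ}
    (h : IsGenericNoise L a d) (t : ℝ) :
    growthProcess L a d t = toUC (stepHeight (clockChain L a d ⌊t⌋₊)) := by
  rw [growthProcess, h.growth_eq, toUC_uscMod_stepHeight]

end

section

/-! ### The particle system in terms of configurations -/

/-- Attach the terms of a sequence to the entries of a list. -/
def attachSeq (l : List ℝ) (ζ : ℕ → ℝ) : List (ℝ × ℝ) := l.zipIdx.map fun q => (q.1, ζ q.2)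

lemma attachSeq_cons (z : ℝ) (l : List ℝ) (ζ : ℕ → ℝ) :
    attachSeq (z :: l) ζ = (z, ζ 0) :: attachSeq l fun i => ζ (i + 1) := by
  simp [attachSeq, List.zipIdx_cons, List.zipIdx_succ, Function.comp_def]

lemma withJumps_eq (l : List ℝ) (ζ : ℕ → ℝ) : withJumps l ζ = attachSeq l fun i => ζ (i + 1) := rfl

/-- The order in which the jump lengths are used when `m` particles move from the right. -/
def reverseIndex (m i : ℕ) : ℕ := if i < m then m - i else i + 1

/-- Indices `i ≥ m` are never used, but sending them to `i + 1` keeps the map injective, so that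
relabelling preserves the law of the whole sequence. The value `0` is omitted because jump lengths
are numbered from one. -/
lemma injective_reverseIndex (m : ℕ) : Injective (reverseIndex m) := by
  intro i j h
  simp only [reverseIndex] at h
  split_ifs at h <;> omega

/-- Particles are numbered from the left but move from the right, so the `i`-th mover (from zero)
among `m` uses jump length number `m - i`. -/
lemma withJumps_reverse (l : List ℝ) (ζ : ℕ → ℝ) :
    ((withJumps l ζ).reverse.map fun q => (-q.1, q.2)) =
      attachSeq (l.reverse.map fun x => -x) fun i => ζ (reverseIndex l.length i) := by
  refine List.ext_getElem (by simp [withJumps, attachSeq]) fun i h1 h2 => ?_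
  have hi : i < l.length := by simpa [withJumps] using h1
  simp only [withJumps, attachSeq, List.getElem_map, List.getElem_reverse, List.getElem_zipIdx,
    List.length_map, List.length_zipIdx, reverseIndex, Nat.zero_add, hi, if_true]
  congr 2
  omega

lemma sweep_attachSeq (cust fixed : List ℝ) (p : ℝ) (ζ : ℕ → ℝ) :
    sweep (attachSeq cust ζ) fixed (some p) = queueSweep cust fixed p ζ := by
  induction cust generalizing fixed p ζ with
  | nil => rfl
  | cons z rest ih =>
    rw [attachSeq_cons, sweep]
    cases hf : fixed.find? fun y => z < y with
    | none =>
      have hy : firstLarger fixed z = z := by rw [firstLarger, hf]; rfl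
      rw [queueSweep, gsweep_cons_neg (fun h => by rw [hy] at h; exact absurd h (lt_irrefl _))]
      simp only [Option.elim_some, ih]
    | some y =>
      have hy : firstLarger fixed z = y := by rw [firstLarger, hf]; rfl
      have hzy : z < y := by simpa using List.find?_some hf
      simp only [Option.elim_some, ih]
      by_cases h : y ≤ max z p + ζ 0
      · rw [queueSweep, gsweep_cons_pos (by rw [hy]; exact hzy) (by rw [hy]; exact h), hy]
        exact if_pos h
      · rw [queueSweep, gsweep_cons_neg (fun _ => by rw [hy]; exact not_le.1 h)]
        exact if_neg h

/-- A virtual predecessor which ended to the left of all customers pushes nobody; this turns the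
missing predecessor into the starting point `-L`. -/
lemma sweep_none {cust : List ℝ} {p : ℝ} (hp : ∀ z ∈ cust, p ≤ z) (fixed : List ℝ) (ζ : ℕ → ℝ) :
    sweep (attachSeq cust ζ) fixed none = queueSweep cust fixed p ζ := by
  rw [← sweep_attachSeq]
  cases cust with
  | nil => rfl
  | cons z rest =>
    rw [attachSeq_cons, sweep, sweep]
    simp only [Option.elim_none, Option.elim_some, max_eq_left (hp z (by simp))]
    rfl

/-- The configuration after a step in which the down-steps move to the right, with jump lengths
`ζ`. -/
def queueStep (L : ℝ) (N : List ℝ) (ζ : ℕ → ℝ) (s : List ℝ × List ℝ) : List ℝ × List ℝ :=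
  let r := queueSweep (customers N s) s.1 (-L) ζ
  ((r.fixed ++ N).insertionSort (· ≤ ·), r.moved)

/-- The configurations of the particle system. -/
def queueChain (L : ℝ) (a : ℕ × Bool × ℕ → ℝ) (ζ : ℕ × ℕ → ℝ) : ℕ → List ℝ × List ℝ
  | 0 => ([], [])
  | t + 1 =>
    let s := queueChain L a ζ t
    let N := nucleations L fun i => a (t + 1, i)
    if Odd (t + 1) then queueStep L N (fun i => ζ (t + 1, i + 1)) s
    else mirror (queueStep L (N.reverse.map fun x => -x)
      (fun i => ζ (t + 1, reverseIndex (s.1.length + N.length) i)) (mirror s))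

lemma le_of_mem_moved {cust fixed : List ℝ} {p c : ℝ} {ζ : ℕ → ℝ} (hζ : ∀ i, 0 ≤ ζ i)
    (hc : ∀ z ∈ cust, c ≤ z) : ∀ x ∈ (queueSweep cust fixed p ζ).moved, c ≤ x := by
  induction cust generalizing fixed p ζ with
  | nil => simp [queueSweep, gsweep]
  | cons z rest ih =>
    have hr : ∀ z ∈ rest, c ≤ z := fun z hz => hc z (by simp [hz])
    simp only [queueSweep, gsweep]
    split_ifs with h
    · exact ih (fun i => hζ (i + 1)) hr
    · intro x hx
      rcases List.mem_cons.1 hx with rfl | hx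
      · have h1 := hc z (by simp)
        have h2 := le_max_left z p
        linarith [hζ 0]
      · exact ih (fun i => hζ (i + 1)) hr x hx

lemma le_of_mem_segments {cust fixed : List ℝ} {p : ℝ} {ζ : ℕ → ℝ} (hζ : ∀ i, 0 ≤ ζ i) :
    ∀ q ∈ (queueSweep cust fixed p ζ).segments, q.1 ≤ q.2 := by
  induction cust generalizing fixed p ζ with
  | nil => simp [queueSweep, gsweep]
  | cons z rest ih =>
    simp only [queueSweep, gsweep]
    split_ifs with h
    · intro q hq
      rcases List.mem_cons.1 hq with rfl | hq
      · exact h.1.le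
      · exact ih (fun i => hζ (i + 1)) q hq
    · intro q hq
      rcases List.mem_cons.1 hq with rfl | hq
      · have h2 := le_max_left z p
        simp only
        linarith [hζ 0]
      · exact ih (fun i => hζ (i + 1)) q hq

/-- A segment lies above `x` when it has started but not yet ended, so crossings are starts minus
ends. This is the queue length read as a height increment. -/
lemma countP_segments {l : List (ℝ × ℝ)} (hl : ∀ q ∈ l, q.1 ≤ q.2) (x : ℝ) :
    l.countP (fun q => q.1 ≤ x ∧ x < q.2) + countLE (l.map Prod.snd) x =
      countLE (l.map Prod.fst) x := by
  induction l with
  | nil => rfl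
  | cons q l ih =>
    have h1 := ih fun q hq => hl q (by simp [hq])
    have h2 := hl q (by simp)
    rw [List.countP_cons, List.map_cons, List.map_cons, countLE_cons, countLE_cons]
    simp only [decide_eq_true_eq]
    split_ifs with h3 h4 h5 h5 <;> first | omega | (exfalso; grind)

lemma countP_segments_neg {l : List (ℝ × ℝ)} (hl : ∀ q ∈ l, q.1 ≤ q.2) (x : ℝ) :
    (l.map fun q => (-q.2, -q.1)).countP (fun q => q.1 ≤ x ∧ x < q.2) +
      countLT (l.map Prod.snd) (-x) = countLT (l.map Prod.fst) (-x) := by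
  induction l with
  | nil => rfl
  | cons q l ih =>
    have h1 := ih fun q hq => hl q (by simp [hq])
    have h2 := hl q (by simp)
    rw [List.map_cons, List.countP_cons, List.map_cons, List.map_cons, countLT_cons, countLT_cons]
    simp only [decide_eq_true_eq]
    split_ifs with h3 h4 h5 h5 <;> first | omega | (exfalso; grind)

lemma pairwise_le_reverse_map_neg {l : List ℝ} (h : l.Pairwise (· ≤ ·)) :
    (l.reverse.map fun x => -x).Pairwise (· ≤ ·) := by
  rw [List.pairwise_map, List.pairwise_reverse]
  exact h.imp fun h => neg_le_neg h

lemma insertionSort_eq_reverse_map_neg {l m : List ℝ} (h : m.Perm (l.map fun x => -x)) :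
    m.insertionSort (· ≤ ·) = (l.insertionSort (· ≤ ·)).reverse.map fun x => -x := by
  refine List.Perm.eq_of_pairwise (fun _ _ _ _ h1 h2 => le_antisymm h1 h2)
    (List.pairwise_insertionSort _ _)
    (pairwise_le_reverse_map_neg (List.pairwise_insertionSort _ _)) ?_
  refine (List.perm_insertionSort _ _).trans (h.trans ?_)
  exact (((List.reverse_perm _).trans (List.perm_insertionSort _ _)).map _).symm

/-- The height of a configuration as a signed count. -/
def signedHeight (s : List ℝ × List ℝ) (x : ℝ) : ℤ := countLE s.1 x - countLE s.2 x

lemma stepHeight_eq_of_signedHeight {s : List ℝ × List ℝ} {x : ℝ} {k : ℕ}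
    (h : signedHeight s x = k) : stepHeight s x = k := by
  simp only [signedHeight, stepHeight] at *
  omega

lemma customers_length (N : List ℝ) (s : List ℝ × List ℝ) :
    (customers N s).length = s.2.length + N.length := by
  rw [(customers_perm N s).length_eq, List.length_append]

/-- The nucleations cancel, since they are added to both kinds of steps, and `gsweep_perm` turns
starts minus ends into the change of up-steps minus down-steps. Signed heights avoid any use of
general position: nonnegativity follows afterwards, since heights are sums of crossings. -/
lemma signedHeight_queueStep {L : ℝ} {N : List ℝ} {ζ : ℕ → ℝ} (hζ : ∀ i, 0 ≤ ζ i)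
    (s : List ℝ × List ℝ) (x : ℝ) :
    signedHeight (queueStep L N ζ s) x = signedHeight s x +
      (queueSweep (customers N s) s.1 (-L) ζ).segments.countP fun q => q.1 ≤ x ∧ x < q.2 := by
  have h1 := countP_segments (le_of_mem_segments (cust := customers N s) (fixed := s.1) (p := -L) hζ) x
  have h2 := (gsweep_perm (fun _ d => d) (fun _ d n => d (n + 1)) (customers N s) s.1
    (-L) ζ).countLE_eq x
  have h3 := (List.perm_insertionSort (· ≤ ·)
    ((queueSweep (customers N s) s.1 (-L) ζ).fixed ++ N)).countLE_eq x
  have h4 := (customers_perm N s).countLE_eq x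
  rw [queueSweep, gsweep_segments_fst] at h1
  rw [countLE_append] at h3 h4
  rw [countLE_append, countLE_append] at h2
  simp only [signedHeight, queueStep, queueSweep] at *
  omega

lemma signedHeight_mirror (s : List ℝ × List ℝ) (x : ℝ) : signedHeight (mirror s) x =
    s.2.length - s.1.length + countLT s.1 (-x) - countLT s.2 (-x) := by
  have h1 := countLE_reverse_map_neg s.1 x
  have h2 := countLE_reverse_map_neg s.2 x
  simp only [signedHeight, mirror]
  omega

lemma signedHeight_mirror_queueStep {L : ℝ} {N : List ℝ} {ζ : ℕ → ℝ} (hζ : ∀ i, 0 ≤ ζ i)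
    (s : List ℝ × List ℝ) (x : ℝ) :
    signedHeight (mirror (queueStep L N ζ s)) x = signedHeight (mirror s) x +
      ((queueSweep (customers N s) s.1 (-L) ζ).segments.map fun q => (-q.2, -q.1)).countP
        fun q => q.1 ≤ x ∧ x < q.2 := by
  have h1 := countP_segments_neg
    (le_of_mem_segments (cust := customers N s) (fixed := s.1) (p := -L) hζ) x
  have hp := gsweep_perm (fun _ d => d) (fun _ d n => d (n + 1)) (customers N s) s.1 (-L) ζ
  have h2 := hp.countLT_eq (-x)
  have h2' := hp.length_eq
  have hq := List.perm_insertionSort (· ≤ ·)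
    ((queueSweep (customers N s) s.1 (-L) ζ).fixed ++ N)
  have h3 := hq.countLT_eq (-x)
  have h3' := hq.length_eq
  have h4 := (customers_perm N s).countLT_eq (-x)
  have h4' := customers_length N s
  have h5 : ((queueSweep (customers N s) s.1 (-L) ζ).segments.map Prod.snd).length =
      (customers N s).length := by
    rw [List.length_map, ← List.length_map (f := Prod.fst), queueSweep, gsweep_segments_fst]
  rw [queueSweep, gsweep_segments_fst] at h1
  rw [countLT_append] at h3 h4
  rw [countLT_append, countLT_append] at h2
  rw [List.length_append] at h3'
  rw [List.length_append, List.length_append] at h2'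
  rw [signedHeight_mirror, signedHeight_mirror]
  simp only [queueStep, queueSweep] at *
  omega

variable {L : ℝ} {a : ℕ × Bool × ℕ → ℝ} {ζ : ℕ × ℕ → ℝ}

lemma mem_customers_ge {N : List ℝ} {s : List ℝ × List ℝ} (h1 : ∀ x ∈ s.2, -L ≤ x)
    (h2 : ∀ x ∈ N, -L ≤ x) : ∀ z ∈ customers N s, -L ≤ z := fun z hz => by
  rcases mem_customers.1 hz with h | h
  · exact h1 z h
  · exact h2 z h

lemma queueStep_bounds {N : List ℝ} {ζ : ℕ → ℝ} {s : List ℝ × List ℝ} (hζ : ∀ i, 0 ≤ ζ i)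
    (hN : ∀ x ∈ N, x ∈ Icc (-L) L) (h1 : ∀ x ∈ s.1, x ≤ L) (h2 : ∀ x ∈ s.2, -L ≤ x) :
    (∀ x ∈ (queueStep L N ζ s).1, x ≤ L) ∧ ∀ x ∈ (queueStep L N ζ s).2, -L ≤ x := by
  constructor
  · intro x hx
    have hx' := (List.perm_insertionSort _ _).mem_iff.1 hx
    rcases List.mem_append.1 hx' with h | h
    · exact h1 x ((gsweep_fixed_sublist _ _ _ _ _ _).subset h)
    · exact (hN x h).2
  · exact le_of_mem_moved hζ (mem_customers_ge h2 fun x hx => (hN x hx).1)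

/-- The particle system and its height function, in terms of the chain of configurations. -/
lemma particles_eq (ha : ∀ t, IsLineSpacing fun i => a (t + 1, i))
    (hζ : ∀ t i, 0 ≤ ζ (t + 1, i)) (t : ℕ) :
    ((particles L a ζ t).up, (particles L a ζ t).down) = queueChain L a ζ t ∧
    (∀ x ∈ (queueChain L a ζ t).1, x ≤ L) ∧ (∀ x ∈ (queueChain L a ζ t).2, -L ≤ x) ∧
    ∀ x, signedHeight (queueChain L a ζ t) x = ∑ s ∈ Finset.Icc 1 t,
      ((particles L a ζ s).segments.countP fun q => q.1 ≤ x ∧ x < q.2 : ℕ) := by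
  induction t with
  | zero => simp [particles, queueChain, signedHeight]
  | succ t ih =>
    obtain ⟨i1, i2, i3, i4⟩ := ih
    obtain ⟨i1u, i1d⟩ := Prod.ext_iff.1 i1
    simp only at i1u i1d
    have hN : ∀ x ∈ nucleations L fun i => a (t + 1, i), x ∈ Icc (-L) L := fun x hx =>
      ((mem_nucleations (ha t)).1 hx).2
    have hsum : ∀ x, ((∑ s ∈ Finset.Icc 1 (t + 1),
        (particles L a ζ s).segments.countP fun q => q.1 ≤ x ∧ x < q.2 : ℕ) : ℤ) =
        signedHeight (queueChain L a ζ t) x +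
          ((particles L a ζ (t + 1)).segments.countP fun q => q.1 ≤ x ∧ x < q.2 : ℕ) := fun x => by
      rw [Finset.sum_Icc_succ_top (by omega), i4, Nat.cast_add]
    simp only [hsum]
    by_cases ho : Odd (t + 1)
    · have e1 : queueChain L a ζ (t + 1) = queueStep L (nucleations L fun i => a (t + 1, i))
          (fun i => ζ (t + 1, i + 1)) (queueChain L a ζ t) := by
        rw [queueChain]; exact if_pos ho
      have hb := queueStep_bounds (ζ := fun i => ζ (t + 1, i + 1)) (fun i => hζ t _) hN i2 i3
      have e2 : particles L a ζ (t + 1) = oddStep (nucleations L fun i => a (t + 1, i))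
          (fun j => ζ (t + 1, j)) (particles L a ζ t) := by
        rw [particles, sortedList_poissonLine (ha t)]; exact if_pos ho
      have e3 := sweep_none (p := -L) (mem_customers_ge i3 fun x hx => (hN x hx).1)
        (queueChain L a ζ t).1 (fun i => ζ (t + 1, i + 1))
      rw [customers] at e3
      rw [e1, e2, oddStep, withJumps_eq, i1u, i1d, e3]
      exact ⟨rfl, hb.1, hb.2, fun x => signedHeight_queueStep (fun i => hζ t _) _ x⟩
    · set N := nucleations L fun i => a (t + 1, i)
      set s := queueChain L a ζ t
      set ξ : ℕ → ℝ := fun i => ζ (t + 1, reverseIndex (s.1.length + N.length) i)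
      have e1 : queueChain L a ζ (t + 1) =
          mirror (queueStep L (N.reverse.map fun x => -x) ξ (mirror s)) := by
        rw [queueChain]; exact if_neg ho
      have hN' : ∀ x ∈ N.reverse.map (fun x => -x), x ∈ Icc (-L) L := fun x hx => by
        have := hN _ (mem_reverse_map_neg.1 hx)
        exact ⟨by linarith [this.2], by linarith [this.1]⟩
      have hm1 : ∀ x ∈ (mirror s).1, x ≤ L := fun x hx => by
        linarith [i3 _ (mem_reverse_map_neg.1 hx)]
      have hm2 : ∀ x ∈ (mirror s).2, -L ≤ x := fun x hx => by
        linarith [i2 _ (mem_reverse_map_neg.1 hx)]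
      have hb := queueStep_bounds (ζ := ξ) (fun i => hζ t _) hN' hm1 hm2
      have e2 : particles L a ζ (t + 1) = evenStep N (fun j => ζ (t + 1, j)) (particles L a ζ t) := by
        rw [particles, sortedList_poissonLine (ha t)]; exact if_neg ho
      have e3 := sweep_none (p := -L) (mem_customers_ge hm2 fun x hx => (hN' x hx).1)
        (mirror s).1 ξ
      -- An even step is an odd step seen in the mirror: the up-steps and the nucleations,
      -- reflected, are the customers.
      have e4 : customers (N.reverse.map fun x => -x) (mirror s) =
          ((s.1 ++ N).insertionSort (· ≤ ·)).reverse.map fun x => -x := by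
        rw [customers]
        refine insertionSort_eq_reverse_map_neg ?_
        rw [List.map_append]
        exact ((List.reverse_perm _).map _).append ((List.reverse_perm _).map _)
      have e5 : ((s.1 ++ N).insertionSort (· ≤ ·)).length = s.1.length + N.length := by
        rw [List.length_insertionSort, List.length_append]
      have e6 : ((withJumps ((s.1 ++ N).insertionSort (· ≤ ·)) fun j => ζ (t + 1, j)).reverse.map
          fun q => (-q.1, q.2)) = attachSeq (customers (N.reverse.map fun x => -x) (mirror s)) ξ := by
        rw [withJumps_reverse, e4, e5]
      have e7 : (s.2.reverse.map fun z => -z) = (mirror s).1 := rfl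
      rw [e1, e2, evenStep, i1u, i1d]
      simp only [e6, e7, e3]
      refine ⟨Prod.ext rfl ?_, fun x hx => ?_, fun x hx => ?_, fun x => ?_⟩
      · refine insertionSort_eq_reverse_map_neg ?_
        rw [List.map_append]
        refine List.Perm.append_left _ ?_
        rw [List.map_map]
        simp only [Function.comp_def, neg_neg, List.map_id']
        exact (List.reverse_perm N).symm
      · linarith [hb.2 _ (mem_reverse_map_neg.1 hx)]
      · linarith [hb.1 _ (mem_reverse_map_neg.1 hx)]
      · have := signedHeight_mirror_queueStep (L := L) (N := N.reverse.map fun x => -x) (ζ := ξ)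
          (fun i => hζ t _) (mirror s) x
        rw [mirror_mirror] at this
        exact this

lemma heightProcess_eq (ha : ∀ t, IsLineSpacing fun i => a (t + 1, i))
    (hζ : ∀ t i, 0 ≤ ζ (t + 1, i)) (t : ℝ) :
    heightProcess L a ζ t = toUC (stepHeight (queueChain L a ζ ⌊t⌋₊)) := by
  rw [heightProcess]
  congr 1
  funext x
  refine (stepHeight_eq_of_signedHeight ?_).symm
  rw [(particles_eq ha hζ _).2.2.2 x, crossings]

end

section

/-! ### The noise, step by step -/

/-- The noise of one step: the spacings of the nucleations, and the spacings of the down-clock or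
the jump lengths. -/
abbrev StepNoise := (Bool × ℕ → ℝ) × (ℕ → ℝ)

/-- The law of the noise of one step. -/
def stepLaw (r r' : ℝ) [Fact (0 < r)] [Fact (0 < r')] : Measure StepNoise :=
  (Measure.infinitePi fun _ => expMeasure r).prod (expSeq r')

/-- The law of the noise of all steps. -/
def noiseLaw (r r' : ℝ) [Fact (0 < r)] [Fact (0 < r')] : Measure (ℕ → StepNoise) :=
  Measure.infinitePi fun _ => stepLaw r r'

variable {r r' : ℝ} [Fact (0 < r)] [Fact (0 < r')]

instance : IsProbabilityMeasure (stepLaw r r') := by unfold stepLaw; infer_instance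

/-- The noise of the steps `1, 2, …` in terms of its families of coordinates. -/
def stepNoise (a : ℕ × Bool × ℕ → ℝ) (d : ℕ × ℕ → ℝ) (t : ℕ) : StepNoise :=
  (fun i => a (t + 1, i), fun i => d (t + 1, i))

lemma map_sumElim_symm {ι κ : Type*} (μ : ι → Measure ℝ) (ν : κ → Measure ℝ)
    [∀ i, IsProbabilityMeasure (μ i)] [∀ i, IsProbabilityMeasure (ν i)] :
    (Measure.infinitePi (Sum.elim μ ν)).map
      (fun x => ((fun i => x (Sum.inl i), fun j => x (Sum.inr j)) : (ι → ℝ) × (κ → ℝ))) =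
      (Measure.infinitePi μ).prod (Measure.infinitePi ν) := by
  rw [← map_sumElim_prod_infinitePi, Measure.map_map (by fun_prop)
    (measurePreserving_sumElim μ ν).measurable]
  exact Measure.map_id

/-- The coordinates are i.i.d. within each family, so regrouping them by time gives independent
noises for successive steps. -/
lemma IsExponentialNoise.hasLaw_stepNoise {Ω : Type*} [MeasurableSpace Ω] {P : Measure Ω}
    [IsProbabilityMeasure P] {a : ℕ × Bool × ℕ → Ω → ℝ} {d : ℕ × ℕ → Ω → ℝ}
    (h : IsExponentialNoise P r r' a d) :
    HasLaw (fun ω => stepNoise (fun i => a i ω) fun i => d i ω) (noiseLaw r r') P := by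
  -- The reindexing starts at time one; the coordinates with time index zero are never used.
  let σ : ℕ × ((Bool × ℕ) ⊕ ℕ) → (ℕ × Bool × ℕ) ⊕ (ℕ × ℕ) := fun q =>
    Sum.elim (fun i => Sum.inl (q.1 + 1, i)) (fun j => Sum.inr (q.1 + 1, j)) q.2
  have hσ : Injective σ := by
    rintro ⟨t, i | i⟩ ⟨t', j | j⟩ h <;> simp_all [σ]
  let μ : (ℕ × Bool × ℕ) ⊕ (ℕ × ℕ) → Measure ℝ :=
    Sum.elim (fun _ => expMeasure r) fun _ => expMeasure r'
  have hμ : ∀ i, IsProbabilityMeasure (μ i) := isProbabilityMeasure_sumElim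
  have hl : ∀ i, HasLaw (Sum.elim a d i) (μ i) P := by
    rintro (i | i)
    · exact h.law_left i
    · exact h.law_right i
  have h1 : HasLaw (fun ω i => Sum.elim a d i ω) (Measure.infinitePi μ) P :=
    h.indep.hasLaw_infinitePi hl (aemeasurable_pi_iff.2 fun i => (hl i).aemeasurable)
  let ρ : (Bool × ℕ) ⊕ ℕ → Measure ℝ := Sum.elim (fun _ => expMeasure r) fun _ => expMeasure r'
  have hρ : ∀ i, IsProbabilityMeasure (ρ i) := isProbabilityMeasure_sumElim
  have h2 : (Measure.infinitePi μ).map (fun x i => x (σ i)) =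
      Measure.infinitePi fun q : ℕ × ((Bool × ℕ) ⊕ ℕ) => ρ q.2 := by
    rw [Measure.map_infinitePi_infinitePi_of_inj hσ]
    congr 1
    funext ⟨t, i⟩
    cases i <;> rfl
  have h3 := Measure.infinitePi_map_curry (ι := ℕ) fun _ i => ρ i
  let split : ((Bool × ℕ) ⊕ ℕ → ℝ) → StepNoise := fun x =>
    (fun i => x (Sum.inl i), fun j => x (Sum.inr j))
  have hs : Measurable split := by fun_prop
  have h4 : (Measure.infinitePi ρ).map split = stepLaw r r' := map_sumElim_symm _ _
  have h5 := Measure.infinitePi_map_pi (fun _ : ℕ => Measure.infinitePi ρ) (f := fun _ => split)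
    fun _ => hs
  have hm1 : Measurable fun (x : (ℕ × Bool × ℕ) ⊕ (ℕ × ℕ) → ℝ) i => x (σ i) := by fun_prop
  have hm2 : Measurable (MeasurableEquiv.curry ℕ ((Bool × ℕ) ⊕ ℕ) ℝ) := MeasurableEquiv.measurable _
  have hm3 : Measurable fun (x : ℕ → (Bool × ℕ) ⊕ ℕ → ℝ) t => split (x t) := by fun_prop
  refine ⟨(hm3.comp (hm2.comp hm1)).comp_aemeasurable h1.aemeasurable, ?_⟩
  have e : (fun ω => stepNoise (fun i => a i ω) fun i => d i ω) =
      ((fun (x : ℕ → (Bool × ℕ) ⊕ ℕ → ℝ) t => split (x t)) ∘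
        (MeasurableEquiv.curry ℕ ((Bool × ℕ) ⊕ ℕ) ℝ) ∘ fun x i => x (σ i)) ∘
        fun ω i => Sum.elim a d i ω := rfl
  rw [e, ← AEMeasurable.map_map_of_aemeasurable (hm3.comp (hm2.comp hm1)).aemeasurable
    h1.aemeasurable, h1.map_eq, ← Measure.map_map hm3 (hm2.comp hm1), ← Measure.map_map hm2 hm1,
    h2, h3, h5, h4]
  rfl

/-! ### Markov chains driven by independent noise -/

/-- The Markov chain with transitions `f`, started from `s`. -/
def noiseChain {S E : Type*} (f : ℕ → S → E → S) (s : S) (y : ℕ → E) : ℕ → S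
  | 0 => s
  | t + 1 => f t (noiseChain f s y t) (y t)

section

variable {S E : Type*} [MeasurableSpace S] [MeasurableSpace E]

lemma noiseChain_succ (f : ℕ → S → E → S) (s : S) (y : ℕ → E) (t : ℕ) :
    noiseChain f s y (t + 1) =
      noiseChain (fun t => f (t + 1)) (f 0 s (y 0)) (fun n => y (n + 1)) t := by
  induction t with
  | zero => rfl
  | succ t ih => rw [noiseChain, ih]; rfl

lemma measurable_noiseChain {f : ℕ → S → E → S} (hf : ∀ t, Measurable fun p : S × E => f t p.1 p.2)
    (t : ℕ) : Measurable fun p : S × (ℕ → E) => noiseChain f p.1 p.2 t := by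
  induction t with
  | zero => exact measurable_fst
  | succ t ih => exact (hf t).comp (ih.prodMk (by fun_prop))

/-- Condition on the first step and apply the induction hypothesis to the shifted transitions.
Freezing the chain at time `T` makes induction on the horizon possible while testing with
functionals of whole trajectories. -/
lemma lintegral_noiseChain_eq (ν : Measure E) [IsProbabilityMeasure ν] {f g : ℕ → S → E → S}
    (hf : ∀ t, Measurable fun p : S × E => f t p.1 p.2)
    (hg : ∀ t, Measurable fun p : S × E => g t p.1 p.2)
    (h : ∀ t s, ν.map (f t s) = ν.map (g t s)) (T : ℕ) (s : S) {F : (ℕ → S) → ENNReal}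
    (hF : Measurable F) :
    ∫⁻ y, F (fun t => noiseChain f s y (min t T)) ∂Measure.infinitePi (fun _ => ν) =
      ∫⁻ y, F (fun t => noiseChain g s y (min t T)) ∂Measure.infinitePi (fun _ => ν) := by
  induction T generalizing f g s F with
  | zero => simp [noiseChain]
  | succ T ih =>
    have key : ∀ {f : ℕ → S → E → S}, (∀ t, Measurable fun p : S × E => f t p.1 p.2) →
        Measurable (fun x => ∫⁻ y, F (scons s fun t => noiseChain (fun t => f (t + 1)) x y (min t T))
          ∂Measure.infinitePi (fun _ => ν)) ∧
        ∫⁻ y, F (fun t => noiseChain f s y (min t (T + 1))) ∂Measure.infinitePi (fun _ => ν) =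
        ∫⁻ e, ∫⁻ y, F (scons s fun t => noiseChain (fun t => f (t + 1)) (f 0 s e) y (min t T))
          ∂Measure.infinitePi (fun _ => ν) ∂ν := by
      intro f hf
      have hm : Measurable fun p : S × (ℕ → E) =>
          F (scons s fun t => noiseChain (fun t => f (t + 1)) p.1 p.2 (min t T)) :=
        hF.comp (measurable_const.scons (measurable_pi_lambda _ fun t =>
          measurable_noiseChain (fun t => hf (t + 1)) _))
      have hm' : Measurable fun y : ℕ → E => F fun t => noiseChain f s y (min t (T + 1)) :=
        hF.comp (measurable_pi_lambda _ fun t =>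
          (measurable_noiseChain hf _).comp (measurable_const.prodMk measurable_id))
      refine ⟨hm.lintegral_prod_right', ?_⟩
      rw [← (measurePreserving_scons_infinitePi ν).lintegral_comp hm']
      refine (lintegral_prod _ (hm'.comp measurable_scons).aemeasurable).trans ?_
      refine lintegral_congr fun e => lintegral_congr fun y => ?_
      refine congrArg F (funext fun t => ?_)
      cases t with
      | zero => rfl
      | succ t =>
        rw [Nat.add_min_add_right, noiseChain_succ]
        rfl
    obtain ⟨k1, k2⟩ := key hf
    obtain ⟨-, k4⟩ := key hg
    have hf0 : Measurable (f 0 s) := (hf 0).comp (measurable_const.prodMk measurable_id)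
    have hg0 : Measurable (g 0 s) := (hg 0).comp (measurable_const.prodMk measurable_id)
    rw [k2, k4, ← lintegral_map k1 hf0, h 0 s, lintegral_map k1 hg0]
    exact lintegral_congr fun e => ih (fun t => hf _) (fun t => hg _) (fun t s => h _ s) _
      (hF.comp (measurable_const.scons measurable_id))

/-- Chains with the same transition laws have the same law. -/
lemma map_noiseChain_eq (ν : Measure E) [IsProbabilityMeasure ν] {f g : ℕ → S → E → S}
    (hf : ∀ t, Measurable fun p : S × E => f t p.1 p.2)
    (hg : ∀ t, Measurable fun p : S × E => g t p.1 p.2)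
    (h : ∀ t s, ν.map (f t s) = ν.map (g t s)) (T : ℕ) (s : S) :
    (Measure.infinitePi fun _ => ν).map (fun y t => noiseChain f s y (min t T)) =
      (Measure.infinitePi fun _ => ν).map (fun y t => noiseChain g s y (min t T)) := by
  have hm : ∀ {f : ℕ → S → E → S}, (∀ t, Measurable fun p : S × E => f t p.1 p.2) →
      Measurable fun (y : ℕ → E) t => noiseChain f s y (min t T) := fun hf =>
    measurable_pi_lambda _ fun t =>
      (measurable_noiseChain hf _).comp (measurable_const.prodMk measurable_id)
  refine Measure.ext_of_lintegral _ fun F hF => ?_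
  rw [lintegral_map hF (hm hf), lintegral_map hF (hm hg)]
  exact lintegral_noiseChain_eq ν hf hg h T s hF

end

/-! ### The two chains of configurations -/

/-- The transitions of the growth process. -/
def clockTransition (L : ℝ) (t : ℕ) (s : List ℝ × List ℝ) (e : StepNoise) : List ℝ × List ℝ :=
  if Odd (t + 1) then clockStep L (nucleations L e.1) e.2 s
  else mirror (clockStep L (nucleations L e.1) e.2 (mirror s))

/-- The transitions of the particle system. -/
def queueTransition (L : ℝ) (t : ℕ) (s : List ℝ × List ℝ) (e : StepNoise) : List ℝ × List ℝ :=
  let N := nucleations L e.1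
  if Odd (t + 1) then queueStep L N (fun i => e.2 (i + 1)) s
  else mirror (queueStep L (N.reverse.map fun x => -x)
    (fun i => e.2 (reverseIndex (s.1.length + N.length) i)) (mirror s))

lemma clockChain_eq_noiseChain (L : ℝ) (a : ℕ × Bool × ℕ → ℝ) (d : ℕ × ℕ → ℝ) (t : ℕ) :
    clockChain L a d t = noiseChain (clockTransition L) ([], []) (stepNoise a d) t := by
  induction t with
  | zero => rfl
  | succ t ih => rw [clockChain, noiseChain, ih]; rfl

lemma queueChain_eq_noiseChain (L : ℝ) (a : ℕ × Bool × ℕ → ℝ) (ζ : ℕ × ℕ → ℝ) (t : ℕ) :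
    queueChain L a ζ t = noiseChain (queueTransition L) ([], []) (stepNoise a ζ) t := by
  induction t with
  | zero => rfl
  | succ t ih => rw [queueChain, noiseChain, ih]; rfl

lemma Measurable.mirror {α : Type*} [MeasurableSpace α] {f : α → List ℝ × List ℝ}
    (hf : Measurable f) : Measurable fun x => _root_.mirror (f x) :=
  (hf.snd.listReverse.listMapNeg).prodMk (hf.fst.listReverse.listMapNeg)

section

variable {α : Type*} [MeasurableSpace α] {N : α → List ℝ} {d : α → ℕ → ℝ}
  {s : α → List ℝ × List ℝ}

lemma measurable_step_aux {w : α → List ℝ × List ℝ} (hw : Measurable w) (hN : Measurable N) :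
    Measurable fun x => (((w x).2 ++ N x).insertionSort (· ≤ ·), (w x).1) :=
  (hw.snd.listAppend hN).insertionSort.prodMk hw.fst

lemma Measurable.clockStep (L : ℝ) (hN : Measurable N) (hd : Measurable d) (hs : Measurable s) :
    Measurable fun x => _root_.clockStep L (N x) (d x) (s x) :=
  measurable_step_aux (w := fun x => (clockSweep (customers (N x) (s x)) (s x).1 (-L)
    (d x)).particles) (measurable_clockSweep.comp ((hs.snd.listAppend hN).insertionSort.prodMk
      (hs.fst.prodMk (measurable_const.prodMk hd)))) hN

lemma Measurable.queueStep (L : ℝ) (hN : Measurable N) (hd : Measurable d) (hs : Measurable s) :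
    Measurable fun x => _root_.queueStep L (N x) (d x) (s x) :=
  measurable_step_aux (w := fun x => (queueSweep (customers (N x) (s x)) (s x).1 (-L)
    (d x)).particles) (measurable_queueSweep.comp ((hs.snd.listAppend hN).insertionSort.prodMk
      (hs.fst.prodMk (measurable_const.prodMk hd)))) hN

end

lemma measurable_clockTransition (L : ℝ) (t : ℕ) :
    Measurable fun p : (List ℝ × List ℝ) × StepNoise => clockTransition L t p.1 p.2 := by
  have hN : Measurable fun p : (List ℝ × List ℝ) × StepNoise => nucleations L p.2.1 :=
    (measurable_nucleations L).comp (by fun_prop)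
  simp only [clockTransition]
  split_ifs
  · exact Measurable.clockStep L hN (by fun_prop) measurable_fst
  · exact (Measurable.clockStep L hN (by fun_prop) measurable_fst.mirror).mirror

lemma measurable_queueTransition (L : ℝ) (t : ℕ) :
    Measurable fun p : (List ℝ × List ℝ) × StepNoise => queueTransition L t p.1 p.2 := by
  have hN : Measurable fun p : (List ℝ × List ℝ) × StepNoise => nucleations L p.2.1 :=
    (measurable_nucleations L).comp (by fun_prop)
  simp only [queueTransition]
  split_ifs
  · exact Measurable.queueStep L hN (by fun_prop) measurable_fst
  · refine (Measurable.queueStep L hN.listReverse.listMapNeg ?_ measurable_fst.mirror).mirror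
    refine measurable_pi_lambda _ fun i => Measurable.apply_nat
      (f := fun n (p : (List ℝ × List ℝ) × StepNoise) => p.2.2 n) (fun n => by fun_prop) ?_
    have h : Measurable fun p : (List ℝ × List ℝ) × StepNoise =>
        p.1.1.length + (nucleations L p.2.1).length :=
      (measurable_listLength.comp (by fun_prop)).add (measurable_listLength.comp hN)
    exact (measurable_from_nat (f := fun m => reverseIndex m i)).comp h

/-- Jump lengths are i.i.d., so they may be read off along any injection `σ`; this covers both the
shift by one and the reversed order. -/
lemma lintegral_clockStep_eq (L : ℝ) (N : List ℝ) (s : List ℝ × List ℝ)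
    {F : List ℝ × List ℝ → ENNReal} (hF : Measurable F) {σ : ℕ → ℕ} (hσ : Injective σ) :
    ∫⁻ d, F (clockStep L N d s) ∂expSeq r = ∫⁻ d, F (queueStep L N (fun i => d (σ i)) s)
      ∂expSeq r := by
  have h := lintegral_clockSweep_eq (r := r) (customers N s) s.1 (-L)
    (F := fun w => F ((w.2 ++ N).insertionSort (· ≤ ·), w.1))
    (hF.comp (measurable_step_aux measurable_id measurable_const))
  have hmp : MeasurePreserving (fun (d : ℕ → ℝ) i => d (σ i)) (expSeq r) (expSeq r) :=
    ⟨by fun_prop, Measure.map_infinitePi_infinitePi_of_inj hσ⟩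
  have hm : Measurable fun d => F (queueStep L N d s) :=
    hF.comp (Measurable.queueStep L measurable_const measurable_id measurable_const)
  rw [hmp.lintegral_comp hm]
  exact h

lemma map_clockTransition_eq (L : ℝ) (t : ℕ) (s : List ℝ × List ℝ) :
    (stepLaw r r').map (clockTransition L t s) = (stepLaw r r').map (queueTransition L t s) := by
  have hm1 : Measurable (clockTransition L t s) :=
    Measurable.of_uncurry_left (f := clockTransition L t) (measurable_clockTransition L t)
  have hm2 : Measurable (queueTransition L t s) :=
    Measurable.of_uncurry_left (f := queueTransition L t) (measurable_queueTransition L t)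
  refine Measure.ext_of_lintegral _ fun F hF => ?_
  rw [lintegral_map hF hm1, lintegral_map hF hm2, stepLaw]
  refine (lintegral_prod _ (hF.comp hm1).aemeasurable).trans
    (Eq.trans ?_ (lintegral_prod _ (hF.comp hm2).aemeasurable).symm)
  simp only [Function.comp_apply]
  by_cases ho : Odd (t + 1)
  · refine lintegral_congr fun a => ?_
    simp only [clockTransition, queueTransition, if_pos ho]
    exact lintegral_clockStep_eq L _ s hF (add_left_injective 1)
  -- At even times the clock chain uses the nucleations as seen in the mirror, the particle system
  -- their reflection; the reflection invariance of the Poisson process identifies the two.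
  · have hsw : MeasurePreserving (fun (a : Bool × ℕ → ℝ) (i : Bool × ℕ) => a (!i.1, i.2))
        (Measure.infinitePi fun _ => expMeasure r) (Measure.infinitePi fun _ => expMeasure r) := by
      refine ⟨by fun_prop, Measure.map_infinitePi_infinitePi_of_inj
        (f := fun i : Bool × ℕ => (!i.1, i.2)) ?_⟩
      rintro ⟨b, i⟩ ⟨b', j⟩ h
      simpa using h
    have hG : Measurable fun a => ∫⁻ d, F (clockTransition L t s (a, d)) ∂expSeq r' :=
      (hF.comp hm1).lintegral_prod_right'
    rw [← hsw.lintegral_comp hG]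
    refine lintegral_congr fun a => ?_
    simp only [clockTransition, queueTransition, if_neg ho, nucleations_swap]
    exact lintegral_clockStep_eq L _ (mirror s) (hF.comp measurable_id.mirror)
      (injective_reverseIndex _)

end

section

/-! ### The noise is almost surely in general position -/

/-- The state at time `t` depends only on earlier noise. Conditioning step by step therefore reduces
an almost sure property of state and current noise to a deterministic state. -/
lemma ae_noiseChain {S E : Type*} [MeasurableSpace S] [MeasurableSpace E] (ν : Measure E)
    [IsProbabilityMeasure ν] {f : ℕ → S → E → S} (hf : ∀ t, Measurable fun p : S × E => f t p.1 p.2)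
    {B : S → E → Prop} (hB : MeasurableSet {p : S × E | B p.1 p.2}) (h : ∀ s, ∀ᵐ e ∂ν, B s e)
    (t : ℕ) (s : S) :
    ∀ᵐ y ∂Measure.infinitePi fun _ : ℕ => ν, B (noiseChain f s y t) (y t) := by
  have hm : ∀ {f : ℕ → S → E → S}, (∀ t, Measurable fun p : S × E => f t p.1 p.2) → ∀ t,
      MeasurableSet {p : S × (ℕ → E) | B (noiseChain f p.1 p.2 t) (p.2 t)} := fun hf t =>
    ((measurable_noiseChain hf t).prodMk
      ((measurable_pi_apply t).comp measurable_snd)) hB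
  induction t generalizing f s with
  | zero =>
    exact (measurePreserving_eval_infinitePi (fun _ : ℕ => ν) 0).quasiMeasurePreserving.ae (h s)
  | succ t ih =>
    have hmp := measurePreserving_scons_infinitePi ν
    have hs : MeasurableSet {y : ℕ → E | B (noiseChain f s y (t + 1)) (y (t + 1))} :=
      measurable_prodMk_left (hm hf (t + 1))
    rw [← hmp.map_eq, ae_map_iff hmp.measurable.aemeasurable hs]
    refine (Measure.ae_prod_iff_ae_ae (hmp.measurable hs)).2 (Eventually.of_forall fun e => ?_)
    filter_upwards [ih (fun t => hf (t + 1)) (f 0 s e)] with y hy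
    show B (noiseChain f s (scons e y) (t + 1)) _
    rw [noiseChain_succ]
    exact hy

variable {r r' : ℝ} [Fact (0 < r)] [Fact (0 < r')]

/-- Given all later spacings, an arrival is a translate of the first spacing, whose law has no
atoms. -/
lemma ae_arrival_ne (k : ℕ) (c : ℝ) : ∀ᵐ d ∂expSeq r, arrival d k ≠ c := by
  have hs : MeasurableSet {d : ℕ → ℝ | arrival d k ≠ c} :=
    (measurable_arrival k) (measurableSet_singleton c).compl
  refine ae_expSeq_of_scons ((Measure.ae_prod_iff_ae_ae (measurable_scons hs)).2 ?_)
  refine (Measure.ae_ae_comm (p := fun x d => arrival (scons x d) k ≠ c) (measurable_scons hs)).2 (Eventually.of_forall fun d => ?_)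
  cases k with
  | zero =>
    filter_upwards [measure_eq_zero_iff_ae_notMem.1 (measure_singleton (μ := expMeasure r) c)] with x hx
    show arrival (scons x d) 0 ≠ c
    rwa [arrival_zero, scons_zero]
  | succ k =>
    filter_upwards [measure_eq_zero_iff_ae_notMem.1
      (measure_singleton (μ := expMeasure r) (c - arrival d k))] with x hx
    show arrival (scons x d) (k + 1) ≠ c
    rw [arrival_scons_succ]
    exact fun h => hx (mem_singleton_iff.2 (by linarith))

/-- The two halves of the spacings of a Poisson process on the line. -/
lemma measurePreserving_half (b : Bool) : MeasurePreserving (fun (a : Bool × ℕ → ℝ) i => a (b, i))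
    (Measure.infinitePi fun _ => expMeasure r) (expSeq r) :=
  ⟨by fun_prop, Measure.map_infinitePi_infinitePi_of_inj (f := fun i : ℕ => (b, i))
    fun i j h => (Prod.ext_iff.1 h).2⟩

lemma ae_isLineSpacing :
    ∀ᵐ a ∂Measure.infinitePi (fun _ : Bool × ℕ => expMeasure r), IsLineSpacing a := by
  filter_upwards [(measurePreserving_half true).quasiMeasurePreserving.ae ae_isSpacing,
    (measurePreserving_half false).quasiMeasurePreserving.ae ae_isSpacing] with a h1 h2
  exact ⟨h1, h2⟩

lemma ae_abs_arrival_sub_ne (L : ℝ) (k : ℕ) (c : ℝ) :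
    ∀ᵐ d ∂expSeq r, |arrival d k - L| ≠ |c| := by
  filter_upwards [ae_arrival_ne k (L + c), ae_arrival_ne k (L - c)] with d h1 h2 h
  rcases abs_eq_abs.1 h with h | h
  · exact h1 (by linarith)
  · exact h2 (by linarith)

/-- The noise `e` of one step avoids the positions in the list `l`. -/
def Avoids (L : ℝ) (l : List ℝ) (e : StepNoise) : Prop :=
  ∀ k i, (∀ b, arrival (fun i => e.1 (b, i)) k ≠ |l.getD i 0|) ∧
    |arrival e.2 k - L| ≠ |l.getD i 0|

lemma measurableSet_avoids (L : ℝ) :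
    MeasurableSet {p : List ℝ × StepNoise | Avoids L p.1 p.2} := by
  have : {p : List ℝ × StepNoise | Avoids L p.1 p.2} = ⋂ k : ℕ, ⋂ i : ℕ,
      (⋂ b : Bool, {p | arrival (fun i => p.2.1 (b, i)) k = |p.1.getD i 0|}ᶜ) ∩
        {p | |arrival p.2.2 k - L| = |p.1.getD i 0|}ᶜ := by
    ext p
    simp [Avoids]
  rw [this]
  have hl : ∀ i, Measurable fun p : List ℝ × StepNoise => |p.1.getD i 0| := fun i =>
    ((measurable_listGetD i).comp measurable_fst).abs
  refine .iInter fun k => .iInter fun i => .inter (.iInter fun b => ?_) ?_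
  · exact (measurableSet_eq_fun ((measurable_arrival k).comp (by fun_prop)) (hl i)).compl
  · exact (measurableSet_eq_fun (((measurable_arrival k).comp (by fun_prop)).sub_const L).abs
      (hl i)).compl

lemma ae_avoids (L : ℝ) (l : List ℝ) : ∀ᵐ e ∂stepLaw r r', Avoids L l e := by
  simp only [Avoids, ae_all_iff, eventually_and]
  refine fun k i => ⟨fun b => ?_, ?_⟩
  · exact Measure.quasiMeasurePreserving_fst.ae
      ((measurePreserving_half b).quasiMeasurePreserving.ae (ae_arrival_ne k _))
  · exact Measure.quasiMeasurePreserving_snd.ae (ae_abs_arrival_sub_ne L k _)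

lemma Avoids.notMem {L : ℝ} {l : List ℝ} {e : StepNoise} (h : Avoids L l e) {x : ℝ} (hx : x ∈ l) :
    (∀ k b, arrival (fun i => e.1 (b, i)) k ≠ |x|) ∧ ∀ k, |arrival e.2 k - L| ≠ |x| := by
  obtain ⟨i, hi, rfl⟩ := List.getElem_of_mem hx
  have h1 : l.getD i 0 = l[i] := by simp [hi]
  exact ⟨fun k b => h1 ▸ (h k i).1 b, fun k => h1 ▸ (h k i).2⟩

/-- The noise `e` of one step is regular. -/
structure IsRegularStep (L : ℝ) (e : StepNoise) : Prop where
  line : IsLineSpacing e.1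
  clock : IsSpacing e.2
  ne_end : ∀ k b, arrival (fun i => e.1 (b, i)) k ≠ L
  clock_ne : ∀ k j b, |arrival e.2 k - L| ≠ |arrival (fun i => e.1 (b, i)) j|

lemma ae_isRegularStep (L : ℝ) : ∀ᵐ e ∂stepLaw r r', IsRegularStep L e := by
  have h1 : ∀ᵐ e ∂stepLaw r r', ∀ k j b,
      |arrival e.2 k - L| ≠ |arrival (fun i => e.1 (b, i)) j| := by
    simp only [ae_all_iff]
    intro k j b
    have hm : MeasurableSet {e : StepNoise |
        |arrival e.2 k - L| ≠ |arrival (fun i => e.1 (b, i)) j|} :=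
      (measurableSet_eq_fun (((measurable_arrival k).comp (by fun_prop)).sub_const L).abs
        ((measurable_arrival j).comp (by fun_prop)).abs).compl
    exact (Measure.ae_prod_iff_ae_ae hm).2
      (Eventually.of_forall fun a =>
        ae_abs_arrival_sub_ne L k (arrival (fun i => a (b, i)) j))
  have h2 : ∀ᵐ e ∂stepLaw r r', ∀ k b, arrival (fun i => e.1 (b, i)) k ≠ L := by
    simp only [ae_all_iff]
    exact fun k b => Measure.quasiMeasurePreserving_fst.ae
      ((measurePreserving_half b).quasiMeasurePreserving.ae (ae_arrival_ne k _))
  filter_upwards [h1, h2, Measure.quasiMeasurePreserving_fst.ae ae_isLineSpacing,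
    Measure.quasiMeasurePreserving_snd.ae ae_isSpacing] with e h1 h2 h3 h4
  exact ⟨h3, h4, h2, h1⟩

lemma IsRegularStep.isFresh {L : ℝ} {e : StepNoise} (he : IsRegularStep L e)
    {s : List ℝ × List ℝ} (h1 : Avoids L s.1 e) (h2 : Avoids L s.2 e) :
    IsFresh L (nucleations L e.1) (poissonHalfLine (-L) e.2) s := by
  have hN : ∀ x ∈ nucleations L e.1, ∃ k b, arrival (fun i => e.1 (b, i)) k = |x| := by
    intro x hx
    obtain ⟨k, rfl | rfl⟩ := ((mem_nucleations he.line).1 hx).1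
    · exact ⟨k, true, (abs_of_pos (he.line.1.arrival_pos k)).symm⟩
    · exact ⟨k, false, by rw [abs_neg, abs_of_pos (he.line.2.arrival_pos k)]⟩
  have hN' : ∀ x, ∀ l : List ℝ, Avoids L l e → x ∈ nucleations L e.1 → x ∉ l := by
    intro x l hl hx hxl
    obtain ⟨k, b, h⟩ := hN x hx
    exact (hl.notMem hxl).1 k b h
  refine ⟨pairwise_nucleations he.line, fun x hx => ?_, fun x hx => hN' x _ h1 hx,
    fun x hx => hN' x _ h2 hx, ?_⟩
  · obtain ⟨k, b, h⟩ := hN x hx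
    have h3 := ((mem_nucleations he.line).1 hx).2
    have h4 := he.ne_end k b
    rw [h] at h4
    refine ⟨lt_of_le_of_ne h3.1 fun hc => h4 ?_, lt_of_le_of_ne h3.2 fun hc => h4 ?_⟩
    · have : x ≤ 0 := by linarith [h3.2]
      rw [abs_of_nonpos this]; linarith
    · have : 0 ≤ x := by linarith [h3.1]
      rw [abs_of_nonneg this]; linarith
  · rintro x ⟨k, rfl⟩
    have e1 : -L + arrival e.2 k = arrival e.2 k - L := by ring
    refine ⟨fun hx => ?_, fun hx => (h1.notMem hx).2 k (by rw [e1]),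
      fun hx => (h2.notMem hx).2 k (by rw [e1])⟩
    obtain ⟨j, b, h⟩ := hN _ hx
    exact he.clock_ne k j b (by rw [h, e1, abs_abs])

/-- The noise is regular, and it avoids all configurations which it meets. -/
def IsGoodNoise (L : ℝ) (y : ℕ → StepNoise) : Prop :=
  ∀ t, IsRegularStep L (y t) ∧ Avoids L (noiseChain (clockTransition L) ([], []) y t).1 (y t) ∧
    Avoids L (noiseChain (clockTransition L) ([], []) y t).2 (y t)

lemma ae_isGoodNoise (L : ℝ) : ∀ᵐ y ∂noiseLaw r r', IsGoodNoise L y := by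
  have hB : ∀ f : List ℝ × List ℝ → List ℝ, Measurable f →
      MeasurableSet {p : (List ℝ × List ℝ) × StepNoise | Avoids L (f p.1) p.2} := fun f hf =>
    (((hf.comp measurable_fst).prodMk measurable_snd) : Measurable
      fun p : (List ℝ × List ℝ) × StepNoise => (f p.1, p.2)) (measurableSet_avoids L)
  refine ae_all_iff.2 fun t => ?_
  filter_upwards [(measurePreserving_eval_infinitePi (fun _ : ℕ => stepLaw r r')
      t).quasiMeasurePreserving.ae (ae_isRegularStep L),
    ae_noiseChain (stepLaw r r') (measurable_clockTransition L) (hB Prod.fst measurable_fst)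
      (fun s => ae_avoids L s.1) t ([], []),
    ae_noiseChain (stepLaw r r') (measurable_clockTransition L) (hB Prod.snd measurable_snd)
      (fun s => ae_avoids L s.2) t ([], [])] with y h1 h2 h3
  exact ⟨h1, h2, h3⟩

/-- `Avoids` compares absolute values precisely so that one condition serves a configuration and its
mirror image. -/
lemma Avoids.reverse_map_neg {L : ℝ} {l : List ℝ} {e : StepNoise} (h : Avoids L l e) :
    Avoids L (l.reverse.map fun x => -x) e := by
  intro k i
  by_cases hi : i < l.length
  · have h1 := h k (l.length - 1 - i)
    have h2 : (l.reverse.map fun x => -x).getD i 0 = -l.getD (l.length - 1 - i) 0 := by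
      have : l.length - 1 - i < l.length := by omega
      simp [hi, this, List.getD_eq_getElem?_getD]
    rwa [h2, abs_neg]
  · have h1 := h k i
    have h2 : (l.reverse.map fun x => -x).getD i 0 = l.getD i 0 := by
      rw [List.getD_eq_default _ _ (by simpa using hi), List.getD_eq_default _ _ (not_lt.1 hi)]
    rwa [h2]

lemma IsGoodNoise.isGenericNoise {L : ℝ} {a : ℕ × Bool × ℕ → ℝ} {d : ℕ × ℕ → ℝ}
    (h : IsGoodNoise L (stepNoise a d)) : IsGenericNoise L a d := by
  intro t
  obtain ⟨h1, h2, h3⟩ := h t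
  rw [← clockChain_eq_noiseChain] at h2 h3
  refine ⟨h1.line, h1.clock, ?_⟩
  split_ifs
  · exact h1.isFresh h2 h3
  · exact h1.isFresh h3.reverse_map_neg h2.reverse_map_neg

lemma ae_nonneg_isLineSpacing_noiseLaw :
    ∀ᵐ y ∂noiseLaw r r', ∀ t, IsLineSpacing (y t).1 ∧ ∀ i, 0 ≤ (y t).2 i := by
  refine ae_all_iff.2 fun t => ?_
  filter_upwards [(measurePreserving_eval_infinitePi (fun _ : ℕ => stepLaw r r')
      t).quasiMeasurePreserving.ae (ae_isRegularStep 0)] with y h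
  exact ⟨h.line, fun i => (h.clock.pos i).le⟩

end

section

/-! ### The space of upper semicontinuous functions -/

lemma UC.isInducing_distHypo : Topology.IsInducing UC.distHypo := ⟨rfl⟩

instance : TopologicalSpace.PseudoMetrizableSpace UC := UC.isInducing_distHypo.pseudoMetrizableSpace

/-- A continuous function maps a compact set into an open set exactly when its distance to the
complement is bounded below by some `1 / n` on a countable dense subset. -/
lemma measurableSet_mapsTo {α : Type*} [MeasurableSpace α] {φ : α → C(ℝ × ℝ, ℝ)}
    (h : ∀ p, Measurable fun a => φ a p) {K : Set (ℝ × ℝ)} (hK : IsCompact K) {U : Set ℝ}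
    (hU : IsOpen U) : MeasurableSet {a | MapsTo (φ a) K U} := by
  obtain ⟨Q, hQK, hQ, hKQ⟩ :=
    (TopologicalSpace.IsSeparable.of_separableSpace K).exists_countable_dense_subset
  have key : {a | MapsTo (φ a) K U} = ⋃ n : ℕ, ⋂ q ∈ Q,
      {a | (n : ENNReal)⁻¹ ≤ Metric.infEDist (φ a q) Uᶜ} ∩ {_a | (n : ENNReal)⁻¹ ≠ ⊤} := by
    ext a
    simp only [mem_ofPred_eq, mem_iUnion, mem_iInter, mem_inter_iff]
    have hc : Continuous fun p => Metric.infEDist (φ a p) Uᶜ :=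
      Metric.continuous_infEDist.comp (φ a).continuous
    constructor
    · intro hm
      rcases K.eq_empty_or_nonempty with rfl | hne
      · exact ⟨1, fun q hq => absurd (hQK hq) (notMem_empty q)⟩
      · obtain ⟨p, hp, hmin⟩ := hK.exists_isMinOn hne hc.continuousOn
        have hpos : Metric.infEDist (φ a p) Uᶜ ≠ 0 := by
          rw [Ne, ← Metric.mem_iff_infEDist_zero_of_closed hU.isClosed_compl]
          exact fun h => h (hm hp)
        obtain ⟨n, hn⟩ := ENNReal.exists_inv_nat_lt hpos
        refine ⟨n, fun q hq => ⟨hn.le.trans (hmin (hQK hq)), (hn.trans_le le_top).ne⟩⟩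
    · rintro ⟨n, hn⟩ p hp
      have hne : (Q.Nonempty) := by
        by_contra hcon
        rw [not_nonempty_iff_eq_empty] at hcon
        rw [hcon, closure_empty] at hKQ
        exact hKQ hp
      obtain ⟨q₀, hq₀⟩ := hne
      have hcl : closure Q ⊆ {p | (n : ENNReal)⁻¹ ≤ Metric.infEDist (φ a p) Uᶜ} :=
        closure_minimal (fun q hq => (hn q hq).1) (isClosed_le continuous_const hc)
      have h1 := hcl (hKQ hp)
      by_contra hpU
      have h2 : Metric.infEDist (φ a p) Uᶜ = 0 := Metric.infEDist_zero_of_mem hpU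
      rw [mem_ofPred_eq, h2] at h1
      exact absurd (le_antisymm h1 bot_le) (ENNReal.inv_ne_zero.2 (ENNReal.natCast_ne_top n))
  rw [key]
  refine .iUnion fun n => .biInter hQ fun q _ => .inter ?_ (.const _)
  exact measurableSet_le measurable_const
    (Metric.continuous_infEDist.measurable.comp (h q))

/-- The Borel structure of `UC` is generated by the distances to the hypographs. -/
lemma UC.measurable_of_infDist {α : Type*} [MeasurableSpace α] {φ : α → UC}
    (h : ∀ p, Measurable fun a => Metric.infDist p (φ a).hypo) : Measurable φ := by
  have hb : borel UC = MeasurableSpace.comap UC.distHypo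
      (borel C(ℝ × ℝ, ℝ)) :=
    borel_comap
  have h1 : @Measurable α C(ℝ × ℝ, ℝ) _ (borel C(ℝ × ℝ, ℝ)) fun a => (φ a).distHypo := by
    rw [borel_eq_generateFrom_of_subbasis ContinuousMap.compactOpen_eq]
    refine measurable_generateFrom ?_
    rintro _ ⟨K, hK, U, hU, rfl⟩
    exact measurableSet_mapsTo (φ := fun a => (φ a).distHypo) h hK hU
  intro s hs
  change MeasurableSet[borel UC] s at hs
  rw [hb] at hs
  obtain ⟨t, ht, rfl⟩ := hs
  exact h1 ht

lemma upperSemicontinuous_uscMod_stepHeight (s : List ℝ × List ℝ) :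
    UpperSemicontinuous (uscMod (stepHeight s)) := by
  intro x k hk
  rw [uscMod_stepHeight, max_lt_iff] at hk
  have h1 := eventually_uscMod_left (eventually_stepHeight_left s x)
  have h2 := eventually_uscMod_right (eventually_stepHeight_right s x)
  rw [← nhdsNE_sup_pure x, ← nhdsLT_sup_nhdsGT, eventually_sup, eventually_sup]
  refine ⟨⟨h1.mono fun v hv => ?_, h2.mono fun v hv => ?_⟩, ?_⟩
  · simp only [hv]; exact hk.1
  · simp only [hv]; exact hk.2
  · rw [eventually_pure]
    simp only [uscMod_stepHeight]
    exact max_lt hk.1 hk.2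

lemma toUC_stepHeight (s : List ℝ × List ℝ) : (toUC (stepHeight s)).1 = uscMod (stepHeight s) := by
  have h : toUC (stepHeight s) = ⟨uscMod (stepHeight s), upperSemicontinuous_uscMod_stepHeight s⟩ :=
    dif_pos (upperSemicontinuous_uscMod_stepHeight s)
  rw [h]

lemma UC.hypo_nonempty (f : UC) : f.hypo.Nonempty := ⟨(0, 0), by simp [UC.hypo]⟩

/-- The value of a step function's upper semicontinuous modification is taken on a one-sided
interval, so a nearby hypograph point can be moved to a rational abscissa. The distance is thereby
expressed through countably many heights. -/
lemma infDist_hypo_stepHeight_lt_iff (s : List ℝ × List ℝ) (p : ℝ × ℝ) (δ : ℝ) :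
    Metric.infDist p (toUC (stepHeight s)).hypo < δ ↔
      0 < δ ∧ ∃ q : ℚ, |p.1 - q| < δ ∧ p.2 - δ < stepHeight s q := by
  rw [Metric.infDist_lt_iff (UC.hypo_nonempty _)]
  constructor
  · rintro ⟨⟨x, y⟩, hy, hd⟩
    simp only [UC.hypo, mem_ofPred_eq, toUC_stepHeight, uscMod_stepHeight] at hy
    rw [Prod.dist_eq, max_lt_iff, Real.dist_eq, Real.dist_eq] at hd
    obtain ⟨hd1, hd2⟩ := hd
    simp only at hd1 hd2
    refine ⟨(abs_nonneg _).trans_lt hd1, ?_⟩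
    have hopen : ∀ᶠ v in 𝓝 x, |p.1 - v| < δ :=
      (isOpen_lt (by fun_prop) continuous_const).mem_nhds hd1
    have hy2 := (abs_lt.1 hd2).2
    have hmain : ∃ a b : ℝ, a < b ∧ ∀ v ∈ Ioo a b,
        |p.1 - v| < δ ∧ y ≤ stepHeight s v := by
      rw [Nat.cast_max, le_max_iff] at hy
      rcases hy with hy | hy
      · have h := (hopen.filter_mono nhdsWithin_le_nhds).and (eventually_stepHeight_left s x)
        obtain ⟨a, ha, hs⟩ := (mem_nhdsLT_iff_exists_Ioo_subset).1 h
        exact ⟨a, x, ha, fun v hv => ⟨(hs hv).1, by rw [(hs hv).2]; exact hy⟩⟩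
      · have h := (hopen.filter_mono nhdsWithin_le_nhds).and (eventually_stepHeight_right s x)
        obtain ⟨a, ha, hs⟩ := (mem_nhdsGT_iff_exists_Ioo_subset).1 h
        exact ⟨x, a, ha, fun v hv => ⟨(hs hv).1, by rw [(hs hv).2]; exact hy⟩⟩
    obtain ⟨a, b, hab, h⟩ := hmain
    obtain ⟨q, hq⟩ := exists_rat_btwn hab
    exact ⟨q, (h q hq).1, by linarith [(h q hq).2]⟩
  · rintro ⟨h0, q, hq1, hq2⟩
    refine ⟨(q, min p.2 (stepHeight s q)), ?_, ?_⟩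
    · simp only [UC.hypo, mem_ofPred_eq, toUC_stepHeight, uscMod_stepHeight, Nat.cast_max]
      exact (min_le_right _ _).trans (le_max_right _ _)
    · rw [Prod.dist_eq, max_lt_iff, Real.dist_eq, Real.dist_eq]
      refine ⟨hq1, ?_⟩
      rcases min_cases p.2 (stepHeight s q : ℝ) with ⟨h, _⟩ | ⟨h, h'⟩ <;> rw [h, abs_lt] <;>
        constructor <;> linarith

lemma measurable_countLE (x : ℝ) : Measurable fun l : List ℝ => countLE l x := by
  refine measurable_listRec_comp (β := Unit) (b := fun _ => ()) (f := fun l _ => countLE l x)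
    measurable_id measurable_const measurable_const fun n ih => ?_
  simp only [countLE_cons]
  have h1 : Measurable fun p : ℝ × (ℕ → ℝ) × Unit => countLE (takeSeq n p.2.1) x :=
    ih.comp measurable_snd
  exact h1.add (Measurable.ite (measurableSet_le measurable_fst measurable_const)
    measurable_const measurable_const)

lemma measurable_toUC_stepHeight :
    Measurable fun s : List ℝ × List ℝ => toUC (stepHeight s) := by
  refine UC.measurable_of_infDist fun p => measurable_of_Iio fun δ => ?_
  have : (fun s : List ℝ × List ℝ => Metric.infDist p (toUC (stepHeight s)).hypo) ⁻¹' Iio δ =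
      {_s | 0 < δ} ∩ ⋃ q : ℚ, {_s | |p.1 - q| < δ} ∩ {s | p.2 - δ < stepHeight s q} := by
    ext s
    simp only [mem_preimage, mem_Iio, infDist_hypo_stepHeight_lt_iff, mem_inter_iff, mem_iUnion,
      mem_ofPred_eq]
  rw [this]
  refine .inter (.const _) (.iUnion fun q => .inter (.const _) (measurableSet_lt measurable_const ?_))
  have : Measurable fun s : List ℝ × List ℝ => stepHeight s q :=
    ((measurable_countLE q).comp measurable_fst).sub ((measurable_countLE q).comp measurable_snd)
  exact measurable_from_nat.comp this

/-- Since heights are nonnegative, the hypograph contains a point within `|p.2|` of `p`. Hypograph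
points farther out than `M` cannot be closer, so values outside `[-M, M]` do not matter. -/
lemma UC.infDist_hypo_le {f g : UC} {M : ℝ} (h : ∀ x, |x| ≤ M → f.1 x = g.1 x) {p : ℝ × ℝ}
    (hp : |p.1| + |p.2| ≤ M) : Metric.infDist p f.hypo ≤ Metric.infDist p g.hypo := by
  refine (Metric.le_infDist g.hypo_nonempty).2 fun z hz => ?_
  by_cases hzM : |z.1| ≤ M
  · refine Metric.infDist_le_dist_of_mem ?_
    rw [UC.hypo, mem_ofPred_eq] at hz ⊢
    rwa [h z.1 hzM]
  · have h1 : Metric.infDist p f.hypo ≤ dist p (p.1, min p.2 0) := by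
      refine Metric.infDist_le_dist_of_mem ?_
      rw [UC.hypo, mem_ofPred_eq]
      exact (min_le_right _ _).trans (Nat.cast_nonneg _)
    have h2 : dist p (p.1, min p.2 0) ≤ |p.2| := by
      rw [Prod.dist_eq, dist_self, Real.dist_eq]
      refine max_le (abs_nonneg _) ?_
      rcases min_cases p.2 0 with ⟨h, _⟩ | ⟨h, _⟩ <;> rw [h] <;> simp
    have h3 : |p.1 - z.1| ≤ dist p z := by
      rw [Prod.dist_eq, Real.dist_eq]; exact le_max_left _ _
    have h4 := abs_sub_abs_le_abs_sub z.1 p.1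
    rw [abs_sub_comm] at h4
    linarith

/-- Functions which finally agree on every bounded interval converge. -/
lemma UC.tendsto_of_eventually_eq {ι : Type*} {l : Filter ι} {F : ι → UC} {f : UC}
    (h : ∀ M : ℕ, ∀ᶠ k in l, ∀ x : ℝ, |x| ≤ M → (F k).1 x = f.1 x) : Tendsto F l (𝓝 f) := by
  rw [UC.isInducing_distHypo.tendsto_nhds_iff,
    ContinuousMap.tendsto_iff_forall_isCompact_tendstoUniformlyOn]
  intro K hK
  obtain ⟨R, hR⟩ := hK.isBounded.exists_norm_le
  obtain ⟨M, hM⟩ := exists_nat_ge (R + R)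
  rw [Metric.tendstoUniformlyOn_iff]
  intro ε hε
  filter_upwards [h M] with k hk p hp
  have hp' : |p.1| + |p.2| ≤ M := by
    have h1 := hR p hp
    have h2 := (norm_fst_le p).trans h1
    have h3 := (norm_snd_le p).trans h1
    rw [Real.norm_eq_abs] at h2 h3
    linarith
  have : f.distHypo p = (F k).distHypo p :=
    le_antisymm (UC.infDist_hypo_le (fun x hx => (hk x hx).symm) hp')
      (UC.infDist_hypo_le (fun x hx => hk x hx) hp')
  show dist (f.distHypo p) ((F k).distHypo p) < ε
  rw [this, dist_self]
  exact hε

end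

section

/-! ### The variational formula for the reflected walk -/

/-- The number of points of a set in the interval `(y, u]`. -/
def countIoc (S : Set ℝ) (y u : ℝ) : ℕ := (S ∩ Ioc y u).ncard

/-- The set has finitely many points in every bounded interval. -/
def IsLocFinite (S : Set ℝ) : Prop := ∀ y u, (S ∩ Ioc y u).Finite

lemma countIoc_self (S : Set ℝ) (u : ℝ) : countIoc S u u = 0 := by simp [countIoc]

lemma IsLocFinite.countIoc_add {S : Set ℝ} (hS : IsLocFinite S) {y v w : ℝ} (h1 : y ≤ v)
    (h2 : v ≤ w) : countIoc S y v + countIoc S v w = countIoc S y w := by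
  rw [countIoc, countIoc, countIoc, ← ncard_union_eq _ (hS _ _) (hS _ _), ← inter_union_distrib_left,
    Ioc_union_Ioc_eq_Ioc h1 h2]
  exact ((Ioc_disjoint_Ioc_of_le le_rfl).mono inter_subset_right inter_subset_right)

lemma countIoc_congr {S T : Set ℝ} {y u : ℝ} (h : ∀ x, y < x → x ≤ u → (x ∈ S ↔ x ∈ T)) :
    countIoc S y u = countIoc T y u := by
  have : S ∩ Ioc y u = T ∩ Ioc y u := by
    ext x
    exact ⟨fun hx => ⟨(h x hx.2.1 hx.2.2).1 hx.1, hx.2⟩, fun hx => ⟨(h x hx.2.1 hx.2.2).2 hx.1, hx.2⟩⟩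
  rw [countIoc, countIoc, this]

lemma IsLocFinite.countIoc_mono {S T : Set ℝ} (hT : IsLocFinite T) (h : S ⊆ T) (y u : ℝ) :
    countIoc S y u ≤ countIoc T y u :=
  ncard_le_ncard (inter_subset_inter_left _ h) (hT y u)

lemma countIoc_eq_ite {S : Set ℝ} {v w : ℝ} (hvw : v < w) (h : ∀ e ∈ S, v < e → w ≤ e) :
    countIoc S v w = if w ∈ S then 1 else 0 := by
  split_ifs with hw
  · have : S ∩ Ioc v w = {w} := by
      ext x
      simp only [mem_inter_iff, mem_Ioc, mem_singleton_iff]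
      exact ⟨fun hx => le_antisymm hx.2.2 (h x hx.1 hx.2.1), fun hx => by rw [hx]; exact ⟨hw, hvw, le_rfl⟩⟩
    rw [countIoc, this, ncard_singleton]
  · have : S ∩ Ioc v w = ∅ := by
      ext x
      simp only [mem_inter_iff, mem_Ioc, mem_empty_iff_false, iff_false]
      rintro ⟨h1, h2, h3⟩
      exact hw (le_antisymm h3 (h x h1 h2) ▸ h1)
    rw [countIoc, this, ncard_empty]

lemma countIoc_eq_zero {S : Set ℝ} {v w : ℝ} (h : ∀ e ∈ S, v < e → w < e) : countIoc S v w = 0 := by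
  have : S ∩ Ioc v w = ∅ := by
    ext x
    simp only [mem_inter_iff, mem_Ioc, mem_empty_iff_false, iff_false]
    rintro ⟨h1, h2, h3⟩
    exact absurd (h x h1 h2) (not_lt.2 h3)
  rw [countIoc, this, ncard_empty]

lemma isLocFinite_list (l : List ℝ) : IsLocFinite {x | x ∈ l} := fun _ _ =>
  (List.finite_toSet l).subset inter_subset_left

lemma isLocFinite_poissonHalfLine {d : ℕ → ℝ} (hd : IsSpacing d) (a : ℝ) :
    IsLocFinite (poissonHalfLine a d) := fun _ u =>
  (poissonHalfLine_inter_Iic_finite hd a u).subset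
    (inter_subset_inter_right _ fun _ hx => hx.2)

variable {L : ℝ} {N : List ℝ} {d : ℕ → ℝ} {s : List ℝ × List ℝ}

/-- The value at `u` of the walk which starts from the barrier at `y` and is not pushed any more. -/
def walkFrom (L : ℝ) (N : List ℝ) (d : ℕ → ℝ) (s : List ℝ × List ℝ) (y u : ℝ) : ℤ :=
  stepHeight s y + countIoc {x | x ∈ N} y u - countIoc (poissonHalfLine (-L) d) y u

/-- The reflected walk is a running maximum. -/
lemma IsConfig.clockStep_isGreatest (hs : IsConfig L s) (hd : IsSpacing d)
    (hN : IsFresh L N (poissonHalfLine (-L) d) s) {u : ℝ} (hu : -L < u) :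
    (∀ y ∈ Icc (-L) u, walkFrom L N d s y u ≤ stepHeight (_root_.clockStep L N d s) u) ∧
      ∃ y ∈ Icc (-L) u, walkFrom L N d s y u = stepHeight (_root_.clockStep L N d s) u := by
  have hU : ∀ x, x ∈ {x | x ∈ N} ∩ Icc (-L) L ↔ x ∈ N := fun x =>
    ⟨fun h => h.1, fun h => ⟨h, (hN.mem_Ioo x h).1.le, (hN.mem_Ioo x h).2.le⟩⟩
  have hNf := isLocFinite_list N
  have hDf := isLocFinite_poissonHalfLine hd (-L)
  rw [← reflectedWalk_eq_stepHeight hs hd hN hU]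
  -- The invariant says that `k` is the maximum of the free walks started from the barrier. At an
  -- event all of them move by `n - m`, and the only new competitor is the walk started at `w`
  -- itself.
  refine reflectedWalk_induction hs hd hU (fun v k =>
    (∀ y ∈ Icc (-L) v, walkFrom L N d s y v ≤ k) ∧ ∃ y ∈ Icc (-L) v, walkFrom L N d s y v = k) hu
    ?_ (fun v w k hv hvw hw hmin hk => ?_) (fun v w k hv hvw hmin hk => ?_)
  · have h : walkFrom L N d s (-L) (-L) = stepHeight s (-L) := by simp [walkFrom, countIoc_self]
    refine ⟨fun y hy => ?_, -L, left_mem_Icc.2 le_rfl, h⟩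
    rw [le_antisymm hy.2 hy.1, h]
  · have e1 : countLE s.1 v = countLT s.1 w :=
      countLE_eq_countLT hvw fun e he => hmin e (Or.inr (Or.inr (Or.inl he)))
    have e2 : countLE s.2 v = countLT s.2 w :=
      countLE_eq_countLT hvw fun e he => hmin e (Or.inr (Or.inr (Or.inr he)))
    have hg : ∀ y, v ≤ y → y < w → stepHeight s y = stepHeight s v := fun y h1 h2 => by
      rw [stepHeight, stepHeight,
        ← countLE_eq_countLE h1 fun e he h => h2.trans_le (hmin e (Or.inr (Or.inr (Or.inl he))) h),
        ← countLE_eq_countLE h1 fun e he h => h2.trans_le (hmin e (Or.inr (Or.inr (Or.inr he))) h)]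
    set n : ℕ := if w ∈ N then 1 else 0 with hn
    set m : ℕ := if w ∈ poissonHalfLine (-L) d then 1 else 0 with hm
    have cN : ∀ y, v ≤ y → y < w → countIoc {x | x ∈ N} y w = n := fun y h1 h2 => by
      rw [countIoc_eq_ite (S := {x | x ∈ N}) h2 fun e he h => hmin e (Or.inl he) (h1.trans_lt h), hn]
      by_cases h : w ∈ N
      · rw [if_pos h]; exact if_pos h
      · rw [if_neg h]; exact if_neg h
    have cD : ∀ y, v ≤ y → y < w → countIoc (poissonHalfLine (-L) d) y w = m := fun y h1 h2 =>
      countIoc_eq_ite h2 fun e he h => hmin e (Or.inr (Or.inl he)) (h1.trans_lt h)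
    have w1 : ∀ y, y ≤ v → walkFrom L N d s y w = walkFrom L N d s y v + n - m := fun y hy => by
      simp only [walkFrom]
      rw [← hNf.countIoc_add hy hvw.le, ← hDf.countIoc_add hy hvw.le, cN v le_rfl hvw,
        cD v le_rfl hvw]
      push_cast; ring
    have w2 : ∀ y, v ≤ y → y < w → walkFrom L N d s y w = stepHeight s v + n - m := fun y h1 h2 => by
      rw [walkFrom, cN y h1 h2, cD y h1 h2, hg y h1 h2]
    have w3 : walkFrom L N d s w w = stepHeight s w := by simp [walkFrom, countIoc_self]
    have w4 : (stepHeight s v : ℤ) ≤ k := by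
      have := hk.1 v ⟨hv, le_rfl⟩
      simpa [walkFrom, countIoc_self] using this
    obtain ⟨hk1, y₀, hy₀, hk2⟩ := hk
    -- the new maximum
    suffices hsuff : (walkStep L {x | x ∈ N} (poissonHalfLine (-L) d) (stepHeight s) k w : ℤ) =
        max (k + n - m : ℤ) (stepHeight s w) by
      rw [hsuff]
      refine ⟨fun y hy => ?_, ?_⟩
      · rcases lt_or_ge y w with h | h
        · refine le_max_of_le_left ?_
          rcases le_or_gt y v with h' | h'
          · rw [w1 y h']; linarith [hk1 y ⟨hy.1, h'⟩]
          · rw [w2 y h'.le h]; linarith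
        · rw [le_antisymm hy.2 h, w3]; exact le_max_right _ _
      · rcases max_cases (k + n - m : ℤ) (stepHeight s w) with ⟨h, -⟩ | ⟨h, -⟩
        · exact ⟨y₀, ⟨hy₀.1, hy₀.2.trans hvw.le⟩, by rw [h, w1 y₀ hy₀.2, hk2]⟩
        · exact ⟨w, ⟨hv.trans hvw.le, le_rfl⟩, by rw [h, w3]⟩
    have f1 := countLE_eq_add s.1 w
    have f2 := countLE_eq_add s.2 w
    have i1 := hs.count_le v
    have i2 := hs.count_le w
    have hleft : leftLim (stepHeight s) w = countLT s.1 w - countLT s.2 w := by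
      rw [leftLim_stepHeight]; rfl
    have hgw : stepHeight s w = countLE s.1 w - countLE s.2 w := rfl
    have hgv : stepHeight s v = countLE s.1 v - countLE s.2 v := rfl
    rw [walkStep]
    by_cases hwN : w ∈ N
    · rw [if_pos ((hU w).2 hwN)]
      have j1 := List.count_eq_zero.2 (hN.notMem_up w hwN)
      have j2 := List.count_eq_zero.2 (hN.notMem_down w hwN)
      rw [if_pos hwN] at hn
      rw [if_neg fun h => (hN.clock_notMem w h).1 hwN] at hm
      omega
    rw [if_neg fun h => hwN ((hU w).1 h)]
    rw [if_neg hwN] at hn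
    by_cases hwD : w ∈ poissonHalfLine (-L) d
    · have j := hN.clock_notMem w hwD
      have j1 := List.count_eq_zero.2 j.2.1
      have j2 := List.count_eq_zero.2 j.2.2
      rw [if_pos hwD] at hm ⊢
      split_ifs <;> omega
    rw [if_neg hwD] at hm ⊢
    rcases hw with h | h | h | h
    · exact absurd h hwN
    · exact absurd h hwD
    · have j1 := List.count_eq_one_of_mem hs.up_sorted.nodup_of_lt h
      have j2 := List.count_eq_zero.2 (hs.disjoint w h)
      rw [hleft, hgw]
      split_ifs <;> omega
    · have j1 := List.count_eq_zero.2 fun h' => hs.disjoint w h' h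
      have j2 := List.count_eq_one_of_mem hs.down_sorted.nodup_of_lt h
      rw [hleft, hgw]
      split_ifs <;> omega
  · have hg : ∀ y, v ≤ y → y ≤ w → stepHeight s y = stepHeight s v := fun y h1 h2 => by
      rw [stepHeight, stepHeight,
        ← countLE_eq_countLE h1 fun e he h => h2.trans_lt (hmin e (Or.inr (Or.inr (Or.inl he))) h),
        ← countLE_eq_countLE h1 fun e he h => h2.trans_lt (hmin e (Or.inr (Or.inr (Or.inr he))) h)]
    have cN : ∀ y, v ≤ y → countIoc {x | x ∈ N} y w = 0 := fun y h1 =>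
      countIoc_eq_zero fun e he h => hmin e (Or.inl he) (h1.trans_lt h)
    have cD : ∀ y, v ≤ y → countIoc (poissonHalfLine (-L) d) y w = 0 := fun y h1 =>
      countIoc_eq_zero fun e he h => hmin e (Or.inr (Or.inl he)) (h1.trans_lt h)
    have w1 : ∀ y, y ≤ v → walkFrom L N d s y w = walkFrom L N d s y v := fun y hy => by
      simp only [walkFrom]
      rw [← hNf.countIoc_add hy hvw, ← hDf.countIoc_add hy hvw, cN v le_rfl, cD v le_rfl]
      push_cast; ring
    obtain ⟨hk1, y₀, hy₀, hk2⟩ := hk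
    refine ⟨fun y hy => ?_, y₀, ⟨hy₀.1, hy₀.2.trans hvw⟩, by rw [w1 y₀ hy₀.2, hk2]⟩
    rcases le_or_gt y v with h' | h'
    · rw [w1 y h']; exact hk1 y ⟨hy.1, h'⟩
    · have h3 : walkFrom L N d s y w = stepHeight s v := by
        simp [walkFrom, cN y h'.le, cD y h'.le, hg y h'.le hy.2]
      have h4 := hk1 v ⟨hv, le_rfl⟩
      rw [h3]
      simpa [walkFrom, countIoc_self] using h4

lemma IsConfig.clockStep_of_le (hs : IsConfig L s) (hd : IsSpacing d)
    (hN : IsFresh L N (poissonHalfLine (-L) d) s) {u : ℝ} (hu : u ≤ -L) :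
    stepHeight (_root_.clockStep L N d s) u = stepHeight s u := by
  have hU : ∀ x, x ∈ {x | x ∈ N} ∩ Icc (-L) L ↔ x ∈ N := fun x =>
    ⟨fun h => h.1, fun h => ⟨h, (hN.mem_Ioo x h).1.le, (hN.mem_Ioo x h).2.le⟩⟩
  rw [← reflectedWalk_eq_stepHeight hs hd hN hU, reflectedWalk, if_pos hu]

/-! ### Uniform control of the heights as the cutoff grows -/

/-- The heights grow sublinearly, uniformly in the cutoff `L ∈ S`, and they are locally constant
in `L` for large `L`. -/
structure IsTame (S : Set ℝ) (h : ℝ → ℝ → ℕ) : Prop where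
  bound : ∀ ε > 0, ∃ C, ∀ L ∈ S, ∀ x, (h L x : ℝ) ≤ C + ε * |x|
  stable : ∀ M, ∃ L₀, ∀ L ∈ S, ∀ L' ∈ S, L₀ ≤ L → L₀ ≤ L' → ∀ x, |x| ≤ M → h L x = h L' x

/-- The mirrored height at `x` is a left limit at `-x`, hence a value at a nearby point `v` with
`|v| ≤ |x| + 1`; both properties survive a widening of the window by one. -/
lemma IsTame.mirror {S : Set ℝ} {s : ℝ → List ℝ × List ℝ} (h : IsTame S fun L => stepHeight (s L))
    (hs : ∀ L ∈ S, (s L).1.length = (s L).2.length) :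
    IsTame S fun L => stepHeight (_root_.mirror (s L)) := by
  have key : ∀ L ∈ S, ∀ x, ∀ᶠ v in 𝓝[<] (-x), |v| ≤ |x| + 1 ∧
      stepHeight (_root_.mirror (s L)) x = stepHeight (s L) v := by
    intro L hL x
    have h1 : ∀ᶠ v in 𝓝[<] (-x), -x - 1 < v :=
      (lt_mem_nhds (by linarith)).filter_mono nhdsWithin_le_nhds
    filter_upwards [eventually_stepHeight_left (s L) (-x), h1, self_mem_nhdsWithin] with v h2 h3 h4
    rw [stepHeight_mirror (hs L hL), h2]
    refine ⟨?_, rfl⟩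
    rw [mem_Iio] at h4
    rw [abs_le]
    constructor <;> cases abs_cases x <;> linarith
  constructor
  · intro ε hε
    obtain ⟨C, hC⟩ := h.bound ε hε
    refine ⟨C + ε, fun L hL x => ?_⟩
    obtain ⟨v, hv1, hv2⟩ := (key L hL x).exists
    simp only [hv2]
    have := hC L hL v
    nlinarith
  · intro M
    obtain ⟨L₀, hL₀⟩ := h.stable (M + 1)
    refine ⟨L₀, fun L hL L' hL' h1 h2 x hx => ?_⟩
    obtain ⟨v, ⟨hv1, hv2⟩, -, hv3⟩ := ((key L hL x).and (key L' hL' x)).exists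
    simp only [hv2, hv3]
    exact hL₀ L hL L' hL' h1 h2 v (by linarith)

/-- A set with at most `r` points per unit length, up to sublinear fluctuations. -/
def HasDensityLE (S : Set ℝ) (r : ℝ) : Prop :=
  ∀ ε > 0, ∃ C, ∀ y u, y ≤ u → (countIoc S y u : ℝ) ≤ C + r * (u - y) + ε * (|y| + |u|)

/-- A set with at least `r` points per unit length, up to sublinear fluctuations. -/
def HasDensityGE (S : Set ℝ) (r : ℝ) : Prop :=
  ∀ ε > 0, ∃ C, ∀ y u, y ≤ u → r * (u - y) ≤ countIoc S y u + C + ε * (|y| + |u|)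

/-- The free walks have drift `r - r' < 0` and start from sublinear heights, while their maximum is
nonnegative. So the maximiser lies within a distance of `x` that does not depend on `L`, and only
the barrier, nucleations and rings in a bounded window matter. -/
lemma IsTame.clockStep {S : Set ℝ} {s : ℝ → List ℝ × List ℝ} {N : ℝ → List ℝ} {d : ℝ → ℕ → ℝ}
    {A D : Set ℝ} {r r' : ℝ} (hr : r < r') (h : IsTame S fun L => stepHeight (s L))
    (hs : ∀ L ∈ S, IsConfig L (s L)) (hd : ∀ L ∈ S, IsSpacing (d L))
    (hN : ∀ L ∈ S, IsFresh L (N L) (poissonHalfLine (-L) (d L)) (s L))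
    (hAN : ∀ L ∈ S, ∀ x, x ∈ N L ↔ x ∈ A ∩ Icc (-L) L)
    (hD : ∀ L ∈ S, poissonHalfLine (-L) (d L) = D ∩ Ioi (-L))
    (hA : IsLocFinite A) (hAr : HasDensityLE A r) (hDr : HasDensityGE D r') :
    IsTame S fun L => stepHeight (_root_.clockStep L (N L) (d L) (s L)) := by
  set ξ : ℝ → ℝ → ℕ := fun L => stepHeight (_root_.clockStep L (N L) (d L) (s L)) with hξ
  have hDc : ∀ L ∈ S, ∀ y u, -L ≤ y →
      countIoc (poissonHalfLine (-L) (d L)) y u = countIoc D y u := fun L hL y u hy => by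
    rw [hD L hL]
    exact countIoc_congr fun x h1 _ => ⟨fun hx => hx.1, fun hx => ⟨hx, hy.trans_lt h1⟩⟩
  -- control of the optimal starting point
  have key : ∀ ε > 0, ∃ C, ∀ L ∈ S, ∀ x, -L < x → ∃ y ∈ Icc (-L) x,
      walkFrom L (N L) (d L) (s L) y x = ξ L x ∧
      (ξ L x : ℝ) ≤ C + 5 * ε * |x| + (3 * ε - (r' - r)) * (x - y) := by
    intro ε hε
    obtain ⟨C1, h1⟩ := h.bound ε hε
    obtain ⟨C2, h2⟩ := hAr ε hε
    obtain ⟨C3, h3⟩ := hDr ε hε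
    refine ⟨C1 + C2 + C3, fun L hL x hx => ?_⟩
    obtain ⟨-, y, hy, hyx⟩ := (hs L hL).clockStep_isGreatest (hd L hL) (hN L hL) hx
    refine ⟨y, hy, hyx, ?_⟩
    have e1 : (ξ L x : ℝ) = stepHeight (s L) y + countIoc {x | x ∈ N L} y x - countIoc D y x := by
      rw [← hDc L hL y x hy.1]
      have := congrArg (Int.cast (R := ℝ)) hyx
      simp only [walkFrom] at this
      push_cast at this
      exact this.symm
    have e2 : (countIoc {x | x ∈ N L} y x : ℝ) ≤ countIoc A y x := by
      exact_mod_cast hA.countIoc_mono (fun z hz => ((hAN L hL z).1 hz).1) y x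
    have e3 := h1 L hL y
    have e4 := h2 y x hy.2
    have e5 := h3 y x hy.2
    -- The barrier and the two densities contribute `3 ε |y| + 2 ε |x|`. Bounding `|y|` turns this
    -- into `5 ε |x| + 3 ε (x - y)`, and the drift absorbs the last term.
    have e6 : |y| ≤ |x| + (x - y) := by
      have := abs_sub_abs_le_abs_sub y x
      rw [abs_sub_comm, abs_of_nonneg (by linarith [hy.2] : 0 ≤ x - y)] at this
      linarith
    have e7 : ε * |y| ≤ ε * (|x| + (x - y)) := mul_le_mul_of_nonneg_left e6 hε.le
    nlinarith
  have hδ : 0 < r' - r := sub_pos.2 hr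
  constructor
  · intro ε hε
    -- Chosen so that `5 η ≤ ε` and the coefficient `3 η - (r' - r)` of the distance is not
    -- positive.
    set η := min (ε / 5) ((r' - r) / 3) with hη
    have hη0 : 0 < η := lt_min (by linarith) (by linarith)
    have hη1 : 5 * η ≤ ε := by linarith [min_le_left (ε / 5) ((r' - r) / 3)]
    have hη2 : 3 * η ≤ r' - r := by linarith [min_le_right (ε / 5) ((r' - r) / 3)]
    obtain ⟨C, hC⟩ := key η hη0
    obtain ⟨C', hC'⟩ := h.bound ε hε
    refine ⟨max C C', fun L hL x => ?_⟩
    rcases lt_or_ge (-L) x with hx | hx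
    · obtain ⟨y, hy, -, hle⟩ := hC L hL x hx
      have h1 : 5 * η * |x| ≤ ε * |x| := mul_le_mul_of_nonneg_right hη1 (abs_nonneg x)
      have h2 : (3 * η - (r' - r)) * (x - y) ≤ 0 :=
        mul_nonpos_of_nonpos_of_nonneg (by linarith) (by linarith [hy.2])
      linarith [le_max_left C C']
    · have h1 : ξ L x = stepHeight (s L) x := (hs L hL).clockStep_of_le (hd L hL) (hN L hL) hx
      show (ξ L x : ℝ) ≤ _
      rw [h1]
      linarith [le_max_right C C', hC' L hL x]
  · intro M
    -- Now the coefficient of `x - y` is `-(r' - r) / 2`; since the left side is nonnegative, `x - y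
    -- ≤ R`.
    obtain ⟨C, hC⟩ := key ((r' - r) / 6) (by linarith)
    set R := 2 * (C + 5 * ((r' - r) / 6) * M) / (r' - r) with hR
    have hstart : ∀ L ∈ S, ∀ x, |x| ≤ M → -L < x → ∃ y ∈ Icc (-L) x,
        walkFrom L (N L) (d L) (s L) y x = ξ L x ∧ -(M + R) ≤ y := by
      intro L hL x hxM hx
      obtain ⟨y, hy, e, hle⟩ := hC L hL x hx
      refine ⟨y, hy, e, ?_⟩
      have h1 : 5 * ((r' - r) / 6) * |x| ≤ 5 * ((r' - r) / 6) * M :=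
        mul_le_mul_of_nonneg_left hxM (by positivity)
      have h2 : (0 : ℝ) ≤ ξ L x := Nat.cast_nonneg _
      have h3 : (x - y) ≤ R := by
        rw [hR, le_div_iff₀ hδ]
        linarith
      linarith [(abs_le.1 hxM).1]
    set M' := max M (M + R) with hM'
    have hM1 : M ≤ M' := le_max_left _ _
    have hM2 : M + R ≤ M' := le_max_right _ _
    obtain ⟨L₀, hL₀⟩ := h.stable M'
    -- The optimal starting point for `L` is admissible for `L'` and gives the same free walk, hence
    -- one inequality; symmetry gives the other.
    have half : ∀ L ∈ S, ∀ L' ∈ S, max L₀ (M' + 1) ≤ L → max L₀ (M' + 1) ≤ L' →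
        ∀ x, |x| ≤ M → ξ L x ≤ ξ L' x := by
      intro L hL L' hL' h1 h2 x hx
      rw [max_le_iff] at h1 h2
      obtain ⟨hx1, hx2⟩ := abs_le.1 hx
      obtain ⟨y, hy, e, hyM⟩ := hstart L hL x hx (by linarith)
      have h4 := ((hs L' hL').clockStep_isGreatest (hd L' hL') (hN L' hL') (u := x)
        (by linarith)).1 y ⟨by linarith, hy.2⟩
      have h5 : walkFrom L (N L) (d L) (s L) y x = walkFrom L' (N L') (d L') (s L') y x := by
        have e1 : stepHeight (s L) y = stepHeight (s L') y := hL₀ L hL L' hL' h1.1 h2.1 y (abs_le.2 ⟨by linarith, by linarith [hy.2]⟩)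
        rw [walkFrom, walkFrom, hDc L hL y x hy.1, hDc L' hL' y x (by linarith), e1]
        congr 3
        refine countIoc_congr fun z h1 h2 => ?_
        rw [mem_ofPred_eq, mem_ofPred_eq, hAN L hL, hAN L' hL']
        exact ⟨fun hz => ⟨hz.1, by linarith, by linarith⟩, fun hz => ⟨hz.1, by linarith, by linarith⟩⟩
      rw [h5] at e
      rw [e] at h4
      exact_mod_cast h4
    exact ⟨max L₀ (M' + 1), fun L hL L' hL' h1 h2 x hx =>
      le_antisymm (half L hL L' hL' h1 h2 x hx) (half L' hL' L hL h2 h1 x hx)⟩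

end

section

/-! ### Densities of point sets -/

lemma exists_linear_bound {f : ℕ → ℝ} {ρ : ℝ} (h : Tendsto (fun n : ℕ => f n / n) atTop (𝓝 ρ))
    {ε : ℝ} (hε : 0 < ε) : ∃ C, 0 ≤ C ∧ ∀ n : ℕ, |f n - ρ * n| ≤ C + ε * n := by
  obtain ⟨n₀, hn₀⟩ := eventually_atTop.1 (Metric.tendsto_nhds.1 h ε hε)
  refine ⟨∑ n ∈ Finset.range (n₀ + 1), |f n - ρ * n|, Finset.sum_nonneg fun _ _ => abs_nonneg _,
    fun n => ?_⟩
  have hsum : 0 ≤ ∑ n ∈ Finset.range (n₀ + 1), |f n - ρ * n| :=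
    Finset.sum_nonneg fun _ _ => abs_nonneg _
  rcases lt_or_ge n (n₀ + 1) with hn | hn
  · have h1 := Finset.single_le_sum (f := fun n : ℕ => |f n - ρ * n|) (fun _ _ => abs_nonneg _)
      (Finset.mem_range.2 hn)
    have h2 : 0 ≤ ε * n := by positivity
    linarith
  · have hpos : (0 : ℝ) < n := by exact_mod_cast (by omega : 0 < n)
    have h1 := hn₀ n (by omega)
    rw [Real.dist_eq] at h1
    have h2 : f n - ρ * n = (f n / n - ρ) * n := by field_simp
    rw [h2, abs_mul, abs_of_pos hpos]
    nlinarith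

/-- The counting function `f` on `[0, ∞)` has slope `r`, up to sublinear fluctuations. -/
def HasSlope (f : ℝ → ℕ) (r : ℝ) : Prop :=
  ∀ ε > 0, ∃ C, ∀ x, 0 ≤ x → |(f x : ℝ) - r * x| ≤ C + ε * x

/-- A monotone function is squeezed between its values at neighbouring integers. -/
lemma HasSlope.of_nat {f : ℝ → ℕ} {r : ℝ} (hr : 0 ≤ r) (hf : ∀ x y, 0 ≤ x → x ≤ y → f x ≤ f y)
    (h : Tendsto (fun n : ℕ => (f n : ℝ) / n) atTop (𝓝 r)) : HasSlope f r := by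
  intro ε hε
  obtain ⟨C, -, hC⟩ := exists_linear_bound h hε
  refine ⟨C + r + ε, fun x hx => ?_⟩
  have h1 := abs_le.1 (hC ⌊x⌋₊)
  have h2 := abs_le.1 (hC (⌊x⌋₊ + 1))
  have h3 := Nat.floor_le hx
  have h4 := Nat.lt_floor_add_one x
  have h5 : (f ⌊x⌋₊ : ℝ) ≤ f x := by exact_mod_cast hf _ _ (Nat.cast_nonneg _) h3
  have h6 : (f x : ℝ) ≤ f (⌊x⌋₊ + 1 : ℕ) := by
    exact_mod_cast hf _ _ hx (by push_cast; exact h4.le)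
  push_cast at h2 h6
  rw [abs_le]
  constructor <;> nlinarith

lemma HasSlope.congr_le {f g : ℝ → ℕ} {r : ℝ} (h : HasSlope f r)
    (hfg : ∀ x, 0 ≤ x → g x ≤ f x ∧ f x ≤ g x + 1) : HasSlope g r := by
  intro ε hε
  obtain ⟨C, hC⟩ := h ε hε
  refine ⟨C + 1, fun x hx => ?_⟩
  have h1 := abs_le.1 (hC x hx)
  have h2 : (g x : ℝ) ≤ f x := by exact_mod_cast (hfg x hx).1
  have h3 : (f x : ℝ) ≤ g x + 1 := by exact_mod_cast (hfg x hx).2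
  rw [abs_le]
  constructor <;> linarith

lemma hasDensity_aux {S : Set ℝ} {r : ℝ} (hS : IsLocFinite S)
    (h1 : HasSlope (fun x => countIoc S 0 x) r) (h2 : HasSlope (fun x => countIoc S (-x) 0) r)
    {ε : ℝ} (hε : 0 < ε) : ∃ C, ∀ y u, y ≤ u →
      |(countIoc S y u : ℝ) - r * (u - y)| ≤ C + ε * (|y| + |u|) := by
  obtain ⟨C1, hC1⟩ := h1 ε hε
  obtain ⟨C2, hC2⟩ := h2 ε hε
  simp only at hC1 hC2
  have p1 : 0 ≤ C1 := by simpa using (abs_nonneg _).trans (hC1 0 le_rfl)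
  have p2 : 0 ≤ C2 := by simpa using (abs_nonneg _).trans (hC2 0 le_rfl)
  refine ⟨2 * C1 + 2 * C2, fun y u hyu => ?_⟩
  rcases le_or_gt 0 y with hy | hy
  · have e := hS.countIoc_add hy hyu
    have e' : (countIoc S 0 y : ℝ) + countIoc S y u = countIoc S 0 u := by exact_mod_cast e
    have a1 := abs_le.1 (hC1 y hy)
    have a2 := abs_le.1 (hC1 u (hy.trans hyu))
    rw [abs_of_nonneg hy, abs_of_nonneg (hy.trans hyu), abs_le]
    constructor <;> linarith [a1.1, a1.2, a2.1, a2.2]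
  rcases le_or_gt u 0 with hu | hu
  · have e := hS.countIoc_add hyu hu
    have e' : (countIoc S y u : ℝ) + countIoc S u 0 = countIoc S y 0 := by exact_mod_cast e
    have a1 := abs_le.1 (hC2 (-y) (by linarith))
    have a2 := abs_le.1 (hC2 (-u) (by linarith))
    rw [neg_neg] at a1 a2
    rw [abs_of_neg hy, abs_of_nonpos hu, abs_le]
    constructor <;> linarith [a1.1, a1.2, a2.1, a2.2]
  · have e := hS.countIoc_add hy.le hu.le
    have e' : (countIoc S y 0 : ℝ) + countIoc S 0 u = countIoc S y u := by exact_mod_cast e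
    have a1 := abs_le.1 (hC2 (-y) (by linarith))
    have a2 := abs_le.1 (hC1 u hu.le)
    rw [neg_neg] at a1
    rw [abs_of_neg hy, abs_of_pos hu, abs_le]
    constructor <;> linarith [a1.1, a1.2, a2.1, a2.2]

lemma hasDensityLE_of_hasSlope {S : Set ℝ} {r : ℝ} (hS : IsLocFinite S)
    (h1 : HasSlope (fun x => countIoc S 0 x) r) (h2 : HasSlope (fun x => countIoc S (-x) 0) r) :
    HasDensityLE S r := fun _ hε => by
  obtain ⟨C, hC⟩ := hasDensity_aux hS h1 h2 hε
  exact ⟨C, fun y u h => by linarith [(abs_le.1 (hC y u h)).2]⟩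

lemma hasDensityGE_of_hasSlope {S : Set ℝ} {r : ℝ} (hS : IsLocFinite S)
    (h1 : HasSlope (fun x => countIoc S 0 x) r) (h2 : HasSlope (fun x => countIoc S (-x) 0) r) :
    HasDensityGE S r := fun _ hε => by
  obtain ⟨C, hC⟩ := hasDensity_aux hS h1 h2 hε
  exact ⟨C, fun y u h => by linarith [(abs_le.1 (hC y u h)).1]⟩

/-! ### Counting the points of renewal processes -/

lemma hasSlope_firstIndex {d : ℕ → ℝ} {r : ℝ} (hr : 0 < r) (hd : IsSpacing d)
    (h : Tendsto (fun n : ℕ => (∑ i ∈ Finset.range n, d i) / (n : ℝ)) atTop (𝓝 r⁻¹)) :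
    HasSlope (fun x => firstIndex x d) r := by
  intro ε hε
  -- The first bound gives `r η ≤ 1 / 2`, so that the error term in `n` can be absorbed and `n ≤ 2 r
  -- (x + C)`; the second then makes the error at most `ε x`.
  set η := min (r⁻¹ / 2) (ε / (2 * r ^ 2)) with hη
  have hη0 : 0 < η := lt_min (by positivity) (by positivity)
  have hη1 : r * η ≤ 1 / 2 := by
    have := mul_le_mul_of_nonneg_left (min_le_left (r⁻¹ / 2) (ε / (2 * r ^ 2))) hr.le
    rw [← hη] at this
    have e : r * (r⁻¹ / 2) = 1 / 2 := by field_simp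
    linarith
  have hη2 : r * η * (2 * r) ≤ ε := by
    have := mul_le_mul_of_nonneg_left (min_le_right (r⁻¹ / 2) (ε / (2 * r ^ 2)))
      (by positivity : 0 ≤ r * (2 * r))
    rw [← hη] at this
    have e : r * (2 * r) * (ε / (2 * r ^ 2)) = ε := by field_simp
    linarith
  obtain ⟨C, hC0, hC⟩ := exists_linear_bound h hη0
  refine ⟨1 + 2 * (r * C) + r * η * (2 * r) * C + r * η, fun x hx => ?_⟩
  set n := firstIndex x d with hn
  have h1 : ∑ i ∈ Finset.range n, d i ≤ x := by
    cases hm : n with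
    | zero => simpa using hx
    | succ m => exact arrival_le_of_lt_firstIndex (k := m) (by omega)
  have h2 : x < ∑ i ∈ Finset.range (n + 1), d i := hd.lt_arrival_firstIndex x
  have h3 := abs_le.1 (hC n)
  have h4 := abs_le.1 (hC (n + 1))
  push_cast at h4
  have e1 : r * (r⁻¹ * n) = n := by field_simp
  have e2 : r * (r⁻¹ * (n + 1)) = n + 1 := by field_simp
  have h5 : (n : ℝ) ≤ r * x + r * C + r * η * n := by
    have : r * (r⁻¹ * n) ≤ r * (x + C + η * n) := mul_le_mul_of_nonneg_left (by linarith [h3.1]) hr.le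
    linarith
  have h6 : r * x ≤ n + 1 + r * C + r * η * (n + 1) := by
    have : r * x ≤ r * (r⁻¹ * (n + 1) + C + η * (n + 1)) :=
      mul_le_mul_of_nonneg_left (by linarith [h4.2]) hr.le
    linarith
  have hn0 : (0 : ℝ) ≤ n := Nat.cast_nonneg n
  have h7 : (n : ℝ) ≤ 2 * r * (x + C) := by nlinarith
  have h8 : r * η * n ≤ r * η * (2 * r * (x + C)) := mul_le_mul_of_nonneg_left h7 (by positivity)
  have h9 : r * η * (2 * r) * x ≤ ε * x := mul_le_mul_of_nonneg_right hη2 hx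
  have h10 : 0 ≤ r * C := by positivity
  have h11 : 0 ≤ r * η := by positivity
  rw [abs_le]
  constructor <;> nlinarith

lemma countIoc_poissonHalfLine {d : ℕ → ℝ} (hd : IsSpacing d) (a : ℝ) {x : ℝ} :
    countIoc (poissonHalfLine a d) a (a + x) = firstIndex x d := by
  have : poissonHalfLine a d ∩ Ioc a (a + x) =
      (fun k => a + arrival d k) '' (Finset.range (firstIndex x d) : Set ℕ) := by
    ext z
    simp only [poissonHalfLine, mem_inter_iff, mem_ofPred_eq, mem_Ioc, mem_image, Finset.coe_range,
      mem_Iio, hd.lt_firstIndex_iff]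
    constructor
    · rintro ⟨⟨k, rfl⟩, -, h⟩
      exact ⟨k, by linarith, rfl⟩
    · rintro ⟨k, h, rfl⟩
      exact ⟨⟨k, rfl⟩, by linarith [hd.arrival_pos k], by linarith⟩
  rw [countIoc, this, ncard_image_of_injective _ fun i j h =>
    hd.strictMono.injective (add_left_cancel h), ncard_coe_finset, Finset.card_range]

lemma isLocFinite_poissonLine {a : Bool × ℕ → ℝ} (ha : IsLineSpacing a) :
    IsLocFinite (poissonLine a) := by
  intro y u
  refine (List.finite_toSet (nucleations (max |y| |u|) a)).subset fun x hx => ?_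
  refine (mem_nucleations ha).2 ⟨hx.1, ?_, ?_⟩
  · linarith [hx.2.1, le_max_left |y| |u|, neg_abs_le y]
  · linarith [hx.2.2, le_max_right |y| |u|, le_abs_self u]

lemma countIoc_poissonLine_right {a : Bool × ℕ → ℝ} (ha : IsLineSpacing a) (x : ℝ) :
    countIoc (poissonLine a) 0 x = firstIndex x fun i => a (true, i) := by
  rw [← countIoc_poissonHalfLine ha.1 0, zero_add]
  refine countIoc_congr fun z hz _ => ?_
  constructor
  · rintro ⟨k, rfl | rfl⟩
    · exact ⟨k, (zero_add _).symm⟩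
    · linarith [ha.2.arrival_pos k]
  · rintro ⟨k, rfl⟩
    exact ⟨k, Or.inl (zero_add _)⟩

/-- The possible discrepancy of one comes from a point exactly at `-x`, which the half-open interval
omits. -/
lemma countIoc_poissonLine_left {a : Bool × ℕ → ℝ} (ha : IsLineSpacing a) (x : ℝ) :
    countIoc (poissonLine a) (-x) 0 ≤ firstIndex x (fun i => a (false, i)) ∧
      firstIndex x (fun i => a (false, i)) ≤ countIoc (poissonLine a) (-x) 0 + 1 := by
  set d := fun i => a (false, i) with hd
  have hinj : Injective fun k => -arrival d k := fun i j h =>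
    ha.2.strictMono.injective (neg_injective h)
  constructor
  · have : poissonLine a ∩ Ioc (-x) 0 ⊆
        (fun k => -arrival d k) '' (Finset.range (firstIndex x d) : Set ℕ) := by
      rintro z ⟨⟨k, rfl | rfl⟩, h1, h2⟩
      · linarith [ha.1.arrival_pos k]
      · refine ⟨k, ?_, rfl⟩
        rw [Finset.mem_coe, Finset.mem_range, ha.2.lt_firstIndex_iff]
        linarith
    refine (ncard_le_ncard this ((Finset.finite_toSet _).image _)).trans ?_
    rw [ncard_image_of_injective _ hinj, ncard_coe_finset, Finset.card_range]
  · have : (fun k => -arrival d k) '' (Finset.range (firstIndex x d - 1) : Set ℕ) ⊆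
        poissonLine a ∩ Ioc (-x) 0 := by
      rintro _ ⟨k, hk, rfl⟩
      rw [Finset.mem_coe, Finset.mem_range] at hk
      have h1 : arrival d (k + 1) ≤ x := ha.2.lt_firstIndex_iff.1
        (show k + 1 < firstIndex x d by omega)
      have h2 : arrival d k < arrival d (k + 1) := ha.2.strictMono (Nat.lt_succ_self k)
      have h3 : 0 < arrival d k := ha.2.arrival_pos k
      exact ⟨⟨k, Or.inr rfl⟩, by linarith, by linarith⟩
    have h := ncard_le_ncard this (isLocFinite_poissonLine ha _ _)
    rw [ncard_image_of_injective _ hinj, ncard_coe_finset, Finset.card_range] at h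
    rw [countIoc]
    omega

variable {r : ℝ} [Fact (0 < r)]

lemma ae_hasSlope_firstIndex : ∀ᵐ d ∂expSeq r, HasSlope (fun x => firstIndex x d) r := by
  filter_upwards [ae_isSpacing (r := r), ae_expSeq_tendsto_arrival_div (r := r)] with d h1 h2
  exact hasSlope_firstIndex Fact.out h1 h2

lemma ae_hasDensityLE_poissonLine :
    ∀ᵐ a ∂Measure.infinitePi (fun _ : Bool × ℕ => expMeasure r), HasDensityLE (poissonLine a) r := by
  filter_upwards [ae_isLineSpacing (r := r),
    (measurePreserving_half true).quasiMeasurePreserving.ae (ae_hasSlope_firstIndex (r := r)),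
    (measurePreserving_half false).quasiMeasurePreserving.ae (ae_hasSlope_firstIndex (r := r))]
    with a ha h1 h2
  refine hasDensityLE_of_hasSlope (isLocFinite_poissonLine ha) ?_ ?_
  · simpa only [countIoc_poissonLine_right ha] using h1
  · exact h2.congr_le fun x _ => countIoc_poissonLine_left ha x

end

section

/-! ### Coupling of the clocks for different cutoffs -/

/-- If the transitions preserve the law `π`, the chain started from `π` is stationary. -/
lemma measurePreserving_noiseChain {S E : Type*} [MeasurableSpace S] [MeasurableSpace E]
    (π : Measure S) [IsProbabilityMeasure π] (ν : Measure E) [IsProbabilityMeasure ν]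
    {f : ℕ → S → E → S}
    (hf : ∀ t, MeasurePreserving (fun p : S × E => f t p.1 p.2) (π.prod ν) π) (t : ℕ) :
    MeasurePreserving (fun p : S × (ℕ → E) => noiseChain f p.1 p.2 t)
      (π.prod (Measure.infinitePi fun _ => ν)) π := by
  induction t generalizing f with
  | zero => exact measurePreserving_fst
  | succ t ih =>
    have hm := measurable_noiseChain (fun t => (hf t).measurable) (t + 1)
    refine ⟨hm, Measure.ext_of_lintegral _ fun G hG => ?_⟩
    have ih' := ih fun t => hf (t + 1)
    have hG' : Measurable fun p : S × (ℕ → E) =>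
        G (noiseChain (fun t => f (t + 1)) p.1 p.2 t) := hG.comp ih'.measurable
    rw [lintegral_map hG hm]
    refine (lintegral_prod _ (hG.comp hm).aemeasurable).trans ?_
    have e1 : ∀ s, ∫⁻ y, G (noiseChain f s y (t + 1)) ∂Measure.infinitePi (fun _ => ν) =
        ∫⁻ e, ∫⁻ y, G (noiseChain (fun t => f (t + 1)) (f 0 s e) y t)
          ∂Measure.infinitePi (fun _ => ν) ∂ν := fun s => by
      have hs : Measurable fun y : ℕ → E => G (noiseChain f s y (t + 1)) :=
        (hG.comp hm).comp measurable_prodMk_left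
      rw [← (measurePreserving_scons_infinitePi ν).lintegral_comp hs]
      refine (lintegral_prod _ (hs.comp measurable_scons).aemeasurable).trans ?_
      refine lintegral_congr fun e => lintegral_congr fun y => ?_
      refine congrArg G ?_
      rw [noiseChain_succ]
      rfl
    have hH : Measurable fun x => ∫⁻ y, G (noiseChain (fun t => f (t + 1)) x y t)
        ∂Measure.infinitePi (fun _ => ν) := hG'.lintegral_prod_right'
    simp only [Function.comp_apply, e1]
    refine (lintegral_prod (fun p : S × E => ∫⁻ y, G (noiseChain (fun t => f (t + 1)) (f 0 p.1 p.2) y t)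
      ∂Measure.infinitePi (fun _ => ν)) (hH.comp (hf 0).measurable).aemeasurable).symm.trans ?_
    refine ((hf 0).lintegral_comp hH).trans ?_
    exact (lintegral_prod _ hG'.aemeasurable).symm.trans (ih'.lintegral_comp hG)

variable {r : ℝ} [Fact (0 < r)]

/-- A clock on `(0, ∞)` and, for all `j`, a clock on `(-(j + 1), ∞)`. -/
abbrev ClockNoise := (ℕ → ℝ) × (ℕ → ℕ → ℝ)

/-- The law of independent Poisson clocks. -/
def clockLaw (r : ℝ) [Fact (0 < r)] : Measure ClockNoise :=
  (expSeq r).prod (Measure.infinitePi fun _ => expSeq r)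

instance : IsProbabilityMeasure (clockLaw r) := by unfold clockLaw; infer_instance

/-- The spacings of the clock on `(-k, ∞)` which on `(-(j + 1), -j]` rings like the `j`-th clock. -/
def clockBlocks (k : ℕ) (p : ClockNoise) : ℕ → ℝ := noiseChain (fun _ s e => kappa 1 e s) p.1 p.2 k

/-- The spacings of the clock on `(-L, ∞)`. -/
def clockFrom (L : ℝ) (p : ClockNoise) : ℕ → ℝ := theta (⌈L⌉₊ - L) (clockBlocks ⌈L⌉₊ p)

/-- The clock on the line which on `(-(j + 1), -j]` rings like the `j`-th clock. -/
def clockSet (p : ClockNoise) : Set ℝ :=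
  poissonHalfLine 0 p.1 ∪ ⋃ j : ℕ, poissonHalfLine (-(j + 1)) (p.2 j) ∩ Iic (-j)

/-- Each block prepends one unit of time of an independent Poisson process, which preserves the law
by `measurePreserving_kappa`; the chain of clocks is stationary. -/
lemma measurePreserving_clockBlocks (k : ℕ) :
    MeasurePreserving (clockBlocks k) (clockLaw r) (expSeq r) := by
  refine measurePreserving_noiseChain (expSeq r) (expSeq r) (f := fun _ s e => kappa 1 e s)
    (fun _ => ?_) k
  exact (measurePreserving_kappa zero_le_one).comp Measure.measurePreserving_swap

lemma measurePreserving_clockFrom (L : ℝ) :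
    MeasurePreserving (clockFrom L) (clockLaw r) (expSeq r) :=
  (measurePreserving_theta _).comp (measurePreserving_clockBlocks _)

/-- All clocks have regular spacings. -/
def IsClockSpacing (p : ClockNoise) : Prop := IsSpacing p.1 ∧ ∀ j, IsSpacing (p.2 j)

lemma ae_isClockSpacing : ∀ᵐ p ∂clockLaw r, IsClockSpacing p := by
  refine eventually_and.2 ⟨Measure.quasiMeasurePreserving_fst.ae ae_isSpacing, ae_all_iff.2 fun j => ?_⟩
  exact Measure.quasiMeasurePreserving_snd.ae ((measurePreserving_eval_infinitePi
    (fun _ : ℕ => expSeq r) j).quasiMeasurePreserving.ae ae_isSpacing)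

variable {p : ClockNoise}

lemma IsClockSpacing.clockBlocks (h : IsClockSpacing p) (k : ℕ) : IsSpacing (clockBlocks k p) := by
  induction k with
  | zero => exact h.1
  | succ k ih => exact (h.2 k).kappa ih zero_le_one

lemma IsClockSpacing.clockFrom (h : IsClockSpacing p) (L : ℝ) : IsSpacing (clockFrom L p) :=
  (h.clockBlocks _).theta _

lemma IsSpacing.lt_of_mem {d : ℕ → ℝ} (hd : IsSpacing d) {a x : ℝ} (h : x ∈ poissonHalfLine a d) :
    a < x := by
  obtain ⟨k, rfl⟩ := h
  linarith [hd.arrival_pos k]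

lemma IsClockSpacing.poissonHalfLine_clockBlocks (h : IsClockSpacing p) (k : ℕ) :
    poissonHalfLine (-k) (_root_.clockBlocks k p) = clockSet p ∩ Ioi (-k : ℝ) := by
  induction k with
  | zero =>
    ext x
    simp only [CharP.cast_eq_zero, neg_zero, clockSet, mem_inter_iff, mem_union, mem_iUnion, mem_Ioi,
      mem_Iic]
    constructor
    · intro hx
      exact ⟨Or.inl hx, h.1.lt_of_mem hx⟩
    · rintro ⟨hx | ⟨j, -, hj⟩, h0⟩
      · exact hx
      · have : (0 : ℝ) ≤ j := Nat.cast_nonneg j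
        linarith
  | succ k ih =>
    have e1 : poissonHalfLine (-(k + 1 : ℕ)) (_root_.clockBlocks (k + 1) p) =
        (poissonHalfLine (-(k + 1)) (p.2 k) ∩ Iic (-k)) ∪
          poissonHalfLine (-k) (_root_.clockBlocks k p) := by
      have := poissonHalfLine_kappa (d' := _root_.clockBlocks k p) (h.2 k) (-(k + 1)) 1
      rw [show (-(k + 1) + 1 : ℝ) = -k by ring] at this
      push_cast
      exact this
    rw [e1, ih]
    ext x
    simp only [clockSet, mem_inter_iff, mem_union, mem_iUnion, mem_Ioi, mem_Iic]
    push_cast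
    constructor
    · rintro (⟨h1, h2⟩ | ⟨h1, h2⟩)
      · exact ⟨Or.inr ⟨k, h1, h2⟩, (h.2 k).lt_of_mem h1⟩
      · exact ⟨h1, by linarith⟩
    · rintro ⟨h1, h2⟩
      rcases lt_or_ge (-k : ℝ) x with hx | hx
      · exact Or.inr ⟨h1, hx⟩
      · left
        rcases h1 with h1 | ⟨j, h1, h3⟩
        · have := h.1.lt_of_mem h1
          have : (0 : ℝ) ≤ k := Nat.cast_nonneg k
          linarith
        · have h4 := (h.2 j).lt_of_mem h1
          have h5 : (j : ℝ) < k + 1 := by linarith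
          have h6 : (k : ℝ) < j + 1 := by linarith
          norm_cast at h5 h6
          obtain rfl : j = k := by omega
          exact ⟨h1, h3⟩

/-- This is the purpose of the coupling: every cutoff has a Poisson clock with the right law, and
all of them are restrictions of one set that does not depend on `L`. -/
lemma IsClockSpacing.poissonHalfLine_clockFrom (h : IsClockSpacing p) (L : ℝ) :
    poissonHalfLine (-L) (_root_.clockFrom L p) = clockSet p ∩ Ioi (-L) := by
  have hL := Nat.le_ceil L
  have := poissonHalfLine_theta (h.clockBlocks ⌈L⌉₊) (-⌈L⌉₊) (sub_nonneg.2 hL)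
  rw [h.poissonHalfLine_clockBlocks, show (-⌈L⌉₊ + (⌈L⌉₊ - L) : ℝ) = -L by ring] at this
  rw [_root_.clockFrom, this, inter_assoc]
  congr 1
  rw [Ioi_inter_Ioi]
  congr 1
  exact max_eq_right (by linarith)

lemma IsClockSpacing.isLocFinite (h : IsClockSpacing p) : IsLocFinite (clockSet p) := by
  intro y u
  obtain ⟨k, hk⟩ := exists_nat_ge (-y)
  refine (isLocFinite_poissonHalfLine (h.clockBlocks k) (-k) y u).subset fun x hx => ⟨?_, hx.2⟩
  rw [h.poissonHalfLine_clockBlocks]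
  exact ⟨hx.1, by rw [mem_Ioi]; linarith [hx.2.1]⟩

lemma IsClockSpacing.countIoc_right (h : IsClockSpacing p) (x : ℝ) :
    countIoc (clockSet p) 0 x = firstIndex x p.1 := by
  rw [← countIoc_poissonHalfLine h.1 0, zero_add]
  have := h.poissonHalfLine_clockBlocks 0
  simp only [CharP.cast_eq_zero, neg_zero] at this
  refine countIoc_congr fun z hz _ => ?_
  show _ ↔ z ∈ poissonHalfLine 0 (_root_.clockBlocks 0 p)
  rw [this]
  exact ⟨fun h => ⟨h, hz⟩, fun h => h.1⟩

lemma IsClockSpacing.countIoc_left (h : IsClockSpacing p) (k : ℕ) :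
    countIoc (clockSet p) (-k) 0 = firstIndex k (_root_.clockBlocks k p) := by
  rw [← countIoc_poissonHalfLine (h.clockBlocks k) (-k), neg_add_cancel,
    h.poissonHalfLine_clockBlocks]
  exact countIoc_congr fun z hz _ => ⟨fun h => ⟨h, hz⟩, fun h => h.1⟩

/-- The counts in different blocks are i.i.d., so the density on the negative half-line follows from
the law of large numbers, for all lengths simultaneously. -/
lemma IsClockSpacing.countIoc_left_eq_sum (h : IsClockSpacing p) (k : ℕ) :
    countIoc (clockSet p) (-k) 0 = ∑ j ∈ Finset.range k, firstIndex 1 (p.2 j) := by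
  induction k with
  | zero => simp [countIoc_self]
  | succ k ih =>
    have h1 : countIoc (clockSet p) (-(k + 1)) (-k) = firstIndex 1 (p.2 k) := by
      rw [← countIoc_poissonHalfLine (h.2 k) (-(k + 1)), show (-(k + 1) + 1 : ℝ) = -k by ring]
      have h2 := h.poissonHalfLine_clockBlocks (k + 1)
      push_cast at h2
      have h3 : poissonHalfLine (-(k + 1)) (_root_.clockBlocks (k + 1) p) =
        (poissonHalfLine (-(k + 1)) (p.2 k) ∩ Iic (-k)) ∪
          poissonHalfLine (-k) (_root_.clockBlocks k p) := by
        have := poissonHalfLine_kappa (d' := _root_.clockBlocks k p) (h.2 k) (-(k + 1)) 1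
        rw [show (-(k + 1) + 1 : ℝ) = -k by ring] at this
        exact this
      refine countIoc_congr fun z hz hzk => ?_
      have h4 : z ∈ clockSet p ↔ z ∈ clockSet p ∩ Ioi (-(k + 1) : ℝ) :=
        ⟨fun h => ⟨h, hz⟩, fun h => h.1⟩
      rw [h4, ← h2, h3]
      exact ⟨fun hx => hx.elim (fun h => h.1) fun hx =>
        absurd ((h.clockBlocks k).lt_of_mem hx) (not_lt.2 hzk), fun hx => Or.inl ⟨hx, hzk⟩⟩
    have h2 : (0 : ℝ) ≤ k := Nat.cast_nonneg k
    rw [← h.isLocFinite.countIoc_add (v := -k) (by push_cast; linarith) (by linarith),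
      Finset.sum_range_succ, ← ih, add_comm, ← h1]
    push_cast
    rfl

/-! ### The density of the coupled clock -/

lemma measurable_firstIndex_left (x : ℝ) : Measurable fun d : ℕ → ℝ => firstIndex x d :=
  measurable_firstIndex.comp measurable_prodMk_left

/-- More than `k` arrivals up to time one force the first `k + 1` spacings to be at most one, so the
count has geometric tails. -/
lemma lintegral_firstIndex_lt_top : ∫⁻ d, (firstIndex 1 d : ENNReal) ∂expSeq r < ⊤ := by
  set q := expMeasure r (Iic 1) with hq
  have hq1 : q < 1 := expMeasure_Iic_lt_one
  have h1 : ∀ᵐ d ∂expSeq r, (firstIndex 1 d : ENNReal) ≤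
      ∑' k : ℕ, (Set.pi (Finset.range (k + 1) : Set ℕ) fun _ => Iic (1 : ℝ)).indicator 1 d := by
    filter_upwards [ae_isSpacing (r := r)] with d hd
    calc (firstIndex 1 d : ENNReal) = ∑ k ∈ Finset.range (firstIndex 1 d), 1 := by simp
      _ ≤ ∑ k ∈ Finset.range (firstIndex 1 d),
          (Set.pi (Finset.range (k + 1) : Set ℕ) fun _ => Iic (1 : ℝ)).indicator 1 d := by
        refine Finset.sum_le_sum fun k hk => ?_
        rw [indicator_of_mem]
        · rfl
        · intro i hi
          have h2 := hd.lt_firstIndex_iff.1 (Finset.mem_range.1 hk)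
          refine le_trans ?_ h2
          exact Finset.single_le_sum (f := d) (fun i _ => (hd.pos i).le) hi
      _ ≤ _ := ENNReal.sum_le_tsum _
  have hm : ∀ k : ℕ, MeasurableSet (Set.pi (Finset.range (k + 1) : Set ℕ) fun _ => Iic (1 : ℝ)) :=
    fun k => .pi (Finset.countable_toSet _) fun _ _ => measurableSet_Iic
  refine (lintegral_mono_ae h1).trans_lt ?_
  rw [lintegral_tsum fun k => (measurable_one.indicator (hm k)).aemeasurable]
  have h2 : ∀ k : ℕ, ∫⁻ d, (Set.pi (Finset.range (k + 1) : Set ℕ) fun _ => Iic (1 : ℝ)).indicator 1 d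
      ∂expSeq r = q * q ^ k := fun k => by
    rw [lintegral_indicator_one (hm k), expSeq, Measure.infinitePi_pi _ fun _ _ => measurableSet_Iic]
    simp [pow_succ', hq]
  simp only [h2]
  rw [ENNReal.tsum_mul_left, ENNReal.tsum_geometric]
  exact ENNReal.mul_lt_top (hq1.trans ENNReal.one_lt_top)
    (ENNReal.inv_lt_top.2 (tsub_pos_of_lt hq1))

lemma integrable_firstIndex : Integrable (fun d => (firstIndex 1 d : ℝ)) (expSeq r) := by
  have hm : Measurable fun d : ℕ → ℝ => (firstIndex 1 d : ℝ) :=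
    measurable_from_nat.comp (measurable_firstIndex_left 1)
  refine ⟨hm.aestronglyMeasurable, ?_⟩
  rw [HasFiniteIntegral]
  refine lt_of_eq_of_lt (lintegral_congr fun d => ?_) (lintegral_firstIndex_lt_top (r := r))
  rw [Real.enorm_natCast]

lemma tendsto_firstIndex_div : ∀ᵐ d ∂expSeq r,
    Tendsto (fun k : ℕ => (firstIndex k d : ℝ) / k) atTop (𝓝 r) := by
  filter_upwards [ae_hasSlope_firstIndex (r := r)] with d hd
  rw [Metric.tendsto_atTop]
  intro ε hε
  obtain ⟨C, hC⟩ := hd (ε / 2) (by linarith)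
  obtain ⟨n, hn⟩ := exists_nat_gt (2 * C / ε)
  refine ⟨n + 1, fun k hk => ?_⟩
  have hk0 : (0 : ℝ) < k := by exact_mod_cast (by omega : 0 < k)
  have hnk : (n : ℝ) ≤ k := by exact_mod_cast (by omega : n ≤ k)
  have h1 := hC k hk0.le
  rw [Real.dist_eq]
  have h2 : (firstIndex k d : ℝ) / k - r = (firstIndex k d - r * k) / k := by field_simp
  rw [h2, abs_div, abs_of_pos hk0, div_lt_iff₀ hk0]
  rw [div_lt_iff₀ hε] at hn
  nlinarith

lemma ae_tendsto_sum_div : ∀ᵐ p ∂clockLaw r,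
    Tendsto (fun k : ℕ => (∑ j ∈ Finset.range k, (firstIndex 1 (p.2 j) : ℝ)) / k) atTop
      (𝓝 (∫ d, (firstIndex 1 d : ℝ) ∂expSeq r)) := by
  have hmp : ∀ j : ℕ, MeasurePreserving (fun e : ℕ → ℕ → ℝ => e j)
      (Measure.infinitePi fun _ => expSeq r) (expSeq r) := fun j =>
    measurePreserving_eval_infinitePi _ j
  have hm : Measurable fun d : ℕ → ℝ => (firstIndex 1 d : ℝ) :=
    measurable_from_nat.comp (measurable_firstIndex_left 1)
  have hind : iIndepFun (fun j (e : ℕ → ℕ → ℝ) => (firstIndex 1 (e j) : ℝ))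
      (Measure.infinitePi fun _ => expSeq r) :=
    iIndepFun_infinitePi (X := fun _ d => (firstIndex 1 d : ℝ)) fun _ => hm
  have h := strong_law_ae_real (μ := Measure.infinitePi fun _ : ℕ => expSeq r)
    (fun j e => (firstIndex 1 (e j) : ℝ))
    ((hmp 0).integrable_comp_of_integrable integrable_firstIndex)
    (fun i j hij => hind.indepFun hij)
    (fun i => IdentDistrib.comp (u := fun d : ℕ → ℝ => (firstIndex 1 d : ℝ))
      ⟨(hmp i).aemeasurable, (hmp 0).aemeasurable, by rw [(hmp i).map_eq, (hmp 0).map_eq]⟩ hm)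
  have h0 : ∫ e : ℕ → ℕ → ℝ, (firstIndex 1 (e 0) : ℝ) ∂(Measure.infinitePi fun _ => expSeq r) =
      ∫ d, (firstIndex 1 d : ℝ) ∂expSeq r := by
    conv_rhs => rw [← (hmp 0).map_eq]
    exact (integral_map (hmp 0).aemeasurable hm.aestronglyMeasurable).symm
  rw [h0] at h
  exact Measure.quasiMeasurePreserving_snd.ae h

/-- The mean is found by computing one limit in two ways: the count divided by the length tends to
`r` for a single renewal sequence and to the mean per block for the concatenated clock, and the two
counts have the same law. -/
lemma integral_firstIndex : ∫ d, (firstIndex 1 d : ℝ) ∂expSeq r = r := by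
  set c := ∫ d, (firstIndex 1 d : ℝ) ∂expSeq r with hc
  have hr : 0 < r := Fact.out
  have hc0 : 0 ≤ c := integral_nonneg fun _ => Nat.cast_nonneg _
  -- Truncating above both candidate limits allows dominated convergence without affecting the
  -- limits.
  set K := c + r + 1
  have hmk : ∀ k : ℕ, Measurable fun d : ℕ → ℝ => min ((firstIndex k d : ℝ) / k) K := fun k =>
    ((measurable_from_nat.comp (measurable_firstIndex_left k)).div_const _).min measurable_const
  have hb : ∀ x : ℝ, 0 ≤ x → ‖min x K‖ ≤ K := fun x hx => by
    rw [Real.norm_of_nonneg (le_min hx (by positivity))]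
    exact min_le_right _ _
  have h1 : Tendsto (fun k : ℕ => ∫ d, min ((firstIndex k d : ℝ) / k) K ∂expSeq r) atTop
      (𝓝 (∫ _, min r K ∂expSeq r)) := by
    refine tendsto_integral_of_dominated_convergence (fun _ => K)
      (fun k => (hmk k).aestronglyMeasurable) (integrable_const K)
      (fun k => Eventually.of_forall fun d => hb _ (by positivity)) ?_
    filter_upwards [tendsto_firstIndex_div (r := r)] with d hd
    exact hd.min tendsto_const_nhds
  have h2 : Tendsto (fun k : ℕ => ∫ p, min ((firstIndex k (clockBlocks k p) : ℝ) / k) K ∂clockLaw r)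
      atTop (𝓝 (∫ _, min c K ∂clockLaw r)) := by
    refine tendsto_integral_of_dominated_convergence (fun _ => K)
      (fun k => ((hmk k).comp (measurePreserving_clockBlocks (r := r) k).measurable).aestronglyMeasurable)
      (integrable_const K) (fun k => Eventually.of_forall fun d => hb _ (by positivity)) ?_
    filter_upwards [ae_tendsto_sum_div (r := r), ae_isClockSpacing (r := r)] with p hp hsp
    refine (hp.min tendsto_const_nhds).congr fun k => ?_
    rw [← hsp.countIoc_left, hsp.countIoc_left_eq_sum]
    push_cast
    rfl
  have h3 : ∀ k : ℕ, ∫ p, min ((firstIndex k (clockBlocks k p) : ℝ) / k) K ∂clockLaw r =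
      ∫ d, min ((firstIndex k d : ℝ) / k) K ∂expSeq r := fun k => by
    have hmp := measurePreserving_clockBlocks (r := r) k
    rw [← hmp.map_eq]
    exact (integral_map hmp.aemeasurable (hmk k).aestronglyMeasurable).symm
  simp only [h3] at h2
  have h4 := tendsto_nhds_unique h1 h2
  rw [integral_const, integral_const, min_eq_left (by linarith : r ≤ K),
    min_eq_left (by linarith : c ≤ K)] at h4
  simpa using h4.symm

lemma ae_hasDensityGE_clockSet : ∀ᵐ p ∂clockLaw r, HasDensityGE (clockSet p) r := by
  filter_upwards [ae_isClockSpacing (r := r), ae_tendsto_sum_div (r := r),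
    Measure.quasiMeasurePreserving_fst.ae (ae_hasSlope_firstIndex (r := r))] with p hp h1 h2
  refine hasDensityGE_of_hasSlope hp.isLocFinite ?_ ?_
  · simpa only [hp.countIoc_right] using h2
  · refine HasSlope.of_nat (Fact.out : 0 < r).le (fun x y hx hxy => ?_) ?_
    · rw [← hp.isLocFinite.countIoc_add (neg_le_neg hxy) (neg_nonpos.2 hx)]
      exact Nat.le_add_left _ _
    · rw [integral_firstIndex] at h1
      refine h1.congr fun k => ?_
      rw [hp.countIoc_left_eq_sum]
      push_cast
      rfl

end

section

/-! ### The coupling of the chains for different cutoffs -/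

variable {r r' : ℝ}

/-- The law of the noise which drives the chains for all cutoffs. -/
def coupledLaw (r r' : ℝ) [Fact (0 < r)] [Fact (0 < r')] :
    Measure (ℕ → (Bool × ℕ → ℝ) × ClockNoise) :=
  Measure.infinitePi fun _ => (Measure.infinitePi fun _ => expMeasure r).prod (clockLaw r')

/-- The noise of the chain with cutoff `L`. -/
def noiseAt (L : ℝ) (w : ℕ → (Bool × ℕ → ℝ) × ClockNoise) (t : ℕ) : StepNoise :=
  ((w t).1, clockFrom L (w t).2)

/-- The chain with cutoff `L`, driven by the joint noise. -/
def coupledChain (L : ℝ) (w : ℕ → (Bool × ℕ → ℝ) × ClockNoise) (t : ℕ) : List ℝ × List ℝ :=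
  noiseChain (clockTransition L) ([], []) (noiseAt L w) t

/-- The spacings of the joint noise are regular and its densities are `r` and `r'`. -/
def IsRegularCoupling (r r' : ℝ) (w : ℕ → (Bool × ℕ → ℝ) × ClockNoise) : Prop :=
  ∀ t, IsLineSpacing (w t).1 ∧ HasDensityLE (poissonLine (w t).1) r ∧ IsClockSpacing (w t).2 ∧
    HasDensityGE (clockSet (w t).2) r'

section

variable [Fact (0 < r)] [Fact (0 < r')]

instance : IsProbabilityMeasure (coupledLaw r r') := by unfold coupledLaw; infer_instance

lemma measurePreserving_noiseAt (L : ℝ) :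
    MeasurePreserving (noiseAt L) (coupledLaw r r') (noiseLaw r r') := by
  have h : MeasurePreserving (fun e : (Bool × ℕ → ℝ) × ClockNoise => (e.1, clockFrom L e.2))
      ((Measure.infinitePi fun _ => expMeasure r).prod (clockLaw r')) (stepLaw r r') :=
    (MeasurePreserving.id _).prod (measurePreserving_clockFrom L)
  refine ⟨measurable_pi_lambda _ fun t => h.measurable.comp (measurable_pi_apply t), ?_⟩
  have h2 := Measure.infinitePi_map_pi (fun _ : ℕ =>
    (Measure.infinitePi fun _ : Bool × ℕ => expMeasure r).prod (clockLaw r'))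
    (f := fun _ e => (e.1, clockFrom L e.2)) fun _ => h.measurable
  rw [h.map_eq] at h2
  exact h2

lemma ae_isRegularCoupling : ∀ᵐ w ∂coupledLaw r r', IsRegularCoupling r r' w := by
  have hm : ∀ t, MeasurePreserving (eval t) (coupledLaw r r')
      ((Measure.infinitePi fun _ => expMeasure r).prod (clockLaw r')) := fun t =>
    measurePreserving_eval_infinitePi _ t
  refine ae_all_iff.2 fun t => (hm t).quasiMeasurePreserving.ae
    (p := fun e => IsLineSpacing e.1 ∧ HasDensityLE (poissonLine e.1) r ∧ IsClockSpacing e.2 ∧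
      HasDensityGE (clockSet e.2) r') ?_
  filter_upwards [Measure.quasiMeasurePreserving_fst.ae (ae_isLineSpacing (r := r)),
    Measure.quasiMeasurePreserving_fst.ae (ae_hasDensityLE_poissonLine (r := r)),
    Measure.quasiMeasurePreserving_snd.ae (ae_isClockSpacing (r := r')),
    Measure.quasiMeasurePreserving_snd.ae (ae_hasDensityGE_clockSet (r := r'))] with e h1 h2 h3 h4
  exact ⟨h1, h2, h3, h4⟩

end

lemma IsGoodNoise.isConfig {L : ℝ} {y : ℕ → StepNoise} (h : IsGoodNoise L y) (t : ℕ) :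
    IsConfig L (noiseChain (clockTransition L) ([], []) y t) := by
  -- Any noise sequence is the `stepNoise` of suitable families; the index is lowered by one because
  -- `stepNoise` reads its families at time `t + 1`.
  have h' : IsGoodNoise L (stepNoise (fun i => (y (i.1 - 1)).1 i.2) fun i => (y (i.1 - 1)).2 i.2) := h
  have := h'.isGenericNoise.isConfig t
  rwa [clockChain_eq_noiseChain] at this

/-- General position holds almost surely for each cutoff but not for all cutoffs at once, hence the
restriction to a set `S`, later countable. -/
lemma isTame_coupledChain (hr : r < r') {S : Set ℝ} {w : ℕ → (Bool × ℕ → ℝ) × ClockNoise}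
    (hw : IsRegularCoupling r r' w) (hS : ∀ L ∈ S, IsGoodNoise L (noiseAt L w)) (t : ℕ) :
    IsTame S fun L => stepHeight (coupledChain L w t) := by
  induction t with
  | zero =>
    refine ⟨fun ε hε => ⟨0, fun L _ x => ?_⟩, fun M => ⟨0, fun L _ L' _ _ _ x _ => rfl⟩⟩
    have : stepHeight (coupledChain L w 0) x = 0 := rfl
    rw [this, Nat.cast_zero, zero_add]
    exact mul_nonneg hε.le (abs_nonneg x)
  | succ t ih =>
    obtain ⟨h1, h2, h3, h4⟩ := hw t
    have hc : ∀ L ∈ S, IsConfig L (coupledChain L w t) := fun L hL => (hS L hL).isConfig t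
    have hAN : ∀ L ∈ S, ∀ x, x ∈ nucleations L (w t).1 ↔ x ∈ poissonLine (w t).1 ∩ Icc (-L) L :=
      fun L _ x => mem_nucleations h1
    by_cases ho : Odd (t + 1)
    · have e : (fun L => stepHeight (coupledChain L w (t + 1))) = fun L => stepHeight
          (clockStep L (nucleations L (w t).1) (clockFrom L (w t).2) (coupledChain L w t)) := by
        funext L
        rw [coupledChain, noiseChain, clockTransition, if_pos ho]
        rfl
      rw [e]
      exact ih.clockStep hr hc (fun L _ => h3.clockFrom L)
        (fun L hL => (hS L hL t).1.isFresh (hS L hL t).2.1 (hS L hL t).2.2) hAN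
        (fun L _ => h3.poissonHalfLine_clockFrom L) (isLocFinite_poissonLine h1) h2 h4
    · have e : (fun L => stepHeight (coupledChain L w (t + 1))) = fun L => stepHeight
          (mirror (clockStep L (nucleations L (w t).1) (clockFrom L (w t).2)
            (mirror (coupledChain L w t)))) := by
        funext L
        rw [coupledChain, noiseChain, clockTransition, if_neg ho]
        rfl
      have hf : ∀ L ∈ S, IsFresh L (nucleations L (w t).1)
          (poissonHalfLine (-L) (clockFrom L (w t).2)) (mirror (coupledChain L w t)) := fun L hL =>
        (hS L hL t).1.isFresh (hS L hL t).2.2.reverse_map_neg (hS L hL t).2.1.reverse_map_neg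
      rw [e]
      refine ((ih.mirror fun L hL => (hc L hL).length_eq).clockStep hr (fun L hL => (hc L hL).mirror)
        (fun L _ => h3.clockFrom L) hf hAN (fun L _ => h3.poissonHalfLine_clockFrom L)
        (isLocFinite_poissonLine h1) h2 h4).mirror fun L hL => ?_
      exact ((hc L hL).mirror.clockStep (h3.clockFrom L) (hf L hL)).1.length_eq

/-! ### The limit of the coupled chains -/

lemma IsTame.toUC {S : Set ℝ} {s : ℝ → List ℝ × List ℝ} (h : IsTame S fun L => stepHeight (s L))
    (M : ℝ) : ∃ L₀, ∀ L ∈ S, ∀ L' ∈ S, L₀ ≤ L → L₀ ≤ L' → ∀ x, |x| ≤ M →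
      (toUC (stepHeight (s L))).1 x = (toUC (stepHeight (s L'))).1 x := by
  obtain ⟨L₀, hL₀⟩ := h.stable (M + 1)
  refine ⟨L₀, fun L hL L' hL' h1 h2 x hx => ?_⟩
  have hv : ∀ᶠ v in 𝓝[<] x, x - 1 < v :=
    (lt_mem_nhds (by linarith)).filter_mono nhdsWithin_le_nhds
  obtain ⟨v, ⟨e1, e2⟩, h3, h4⟩ := (((eventually_stepHeight_left (s L) x).and
    (eventually_stepHeight_left (s L') x)).and (hv.and self_mem_nhdsWithin)).exists
  have h4 : v < x := h4
  have h5 : |v| ≤ M + 1 := by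
    rw [abs_le] at hx ⊢
    constructor <;> linarith [hx.1, hx.2]
  rw [toUC_stepHeight, toUC_stepHeight, uscMod_stepHeight, uscMod_stepHeight, ← e1, ← e2]
  have := hL₀ L hL L' hL' h1 h2
  rw [this v h5, this x (by linarith)]

/-- The sequence `F` agrees with `f` on every bounded interval, from some index on. -/
def UC.IsStableLimit (F : ℕ → UC) (f : UC) : Prop :=
  ∀ M : ℕ, ∀ᶠ n in atTop, ∀ x : ℝ, |x| ≤ M → (F n).1 x = f.1 x

/-- The limit at `x` is the value at an index stable on a window containing `x`; upper
semicontinuity is local and is inherited from a single member of the sequence. -/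
lemma UC.exists_isStableLimit {F : ℕ → UC}
    (h : ∀ M : ℕ, ∃ n₀, ∀ m ≥ n₀, ∀ n ≥ n₀, ∀ x : ℝ, |x| ≤ M → (F m).1 x = (F n).1 x) :
    ∃ f, UC.IsStableLimit F f := by
  choose n₀ hn₀ using h
  have key : ∀ M : ℕ, ∀ n ≥ n₀ M, ∀ x : ℝ, |x| ≤ M → (F n).1 x = (F (n₀ ⌈|x|⌉₊)).1 x := by
    intro M n hn x hx
    have h1 := hn₀ M n hn (max n (n₀ ⌈|x|⌉₊)) (hn.trans (le_max_left _ _)) x hx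
    have h2 := hn₀ ⌈|x|⌉₊ (n₀ ⌈|x|⌉₊) le_rfl (max n (n₀ ⌈|x|⌉₊)) (le_max_right _ _) x (Nat.le_ceil _)
    rw [h1, h2]
  refine ⟨⟨fun x => (F (n₀ ⌈|x|⌉₊)).1 x, fun x k hk => ?_⟩, fun M => ?_⟩
  · obtain ⟨M, hM⟩ := exists_nat_gt |x|
    have hev : ∀ᶠ y : ℝ in 𝓝 x, |y| < M := continuous_abs.continuousAt.eventually_lt_const hM
    have hk' : (F (n₀ M)).1 x < k := (key M (n₀ M) le_rfl x hM.le).trans_lt hk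
    filter_upwards [hev, (F (n₀ M)).2 x k hk'] with y hy1 hy2
    exact (key M (n₀ M) le_rfl y hy1.le).symm.trans_lt hy2
  · filter_upwards [eventually_ge_atTop (n₀ M)] with n hn x hx
    exact key M n hn x hx

/-- The interface of the coupled chain with cutoff `L`. -/
def coupledHeight (L : ℝ) (w : ℕ → (Bool × ℕ → ℝ) × ClockNoise) (t : ℕ) : UC :=
  toUC (stepHeight (coupledChain L w t))

/-- The limit of the interfaces as the cutoff tends to infinity. -/
def limitHeight (w : ℕ → (Bool × ℕ → ℝ) × ClockNoise) (t : ℕ) : UC :=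
  if h : ∃ f, UC.IsStableLimit (fun n => coupledHeight n w t) f then h.choose
  else ⟨fun _ => 0, upperSemicontinuous_const⟩

lemma tendsto_coupledHeight (hr : r < r') {w : ℕ → (Bool × ℕ → ℝ) × ClockNoise}
    (hw : IsRegularCoupling r r' w) {u : ℕ → ℝ} (hu : Tendsto u atTop atTop)
    (h1 : ∀ n : ℕ, IsGoodNoise n (noiseAt n w)) (h2 : ∀ k, IsGoodNoise (u k) (noiseAt (u k) w))
    (t : ℕ) : Tendsto (fun k => coupledHeight (u k) w t) atTop (𝓝 (limitHeight w t)) := by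
  -- The limit is defined along the integers. Including both the integers and the given sequence in
  -- `S` shows that the limit does not depend on the sequence.
  have hS : ∀ L ∈ range (Nat.cast : ℕ → ℝ) ∪ range u, IsGoodNoise L (noiseAt L w) := by
    rintro _ (⟨n, rfl⟩ | ⟨k, rfl⟩)
    · exact h1 n
    · exact h2 k
  have ht := (isTame_coupledChain hr hw hS t).toUC
  have hex : ∃ f, UC.IsStableLimit (fun n => coupledHeight n w t) f := by
    refine UC.exists_isStableLimit fun M => ?_
    obtain ⟨L₀, hL₀⟩ := ht M
    obtain ⟨n₀, hn₀⟩ := exists_nat_ge L₀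
    exact ⟨n₀, fun m hm n hn x hx => hL₀ m (Or.inl ⟨m, rfl⟩) n (Or.inl ⟨n, rfl⟩)
      (hn₀.trans (Nat.cast_le.2 hm)) (hn₀.trans (Nat.cast_le.2 hn)) x hx⟩
  refine UC.tendsto_of_eventually_eq fun M => ?_
  obtain ⟨L₀, hL₀⟩ := ht M
  obtain ⟨n, hn1, hn2⟩ := ((hex.choose_spec M).and
    (tendsto_natCast_atTop_atTop.eventually_ge_atTop L₀)).exists
  filter_upwards [hu.eventually_ge_atTop L₀] with k hk x hx
  have e : limitHeight w t = hex.choose := dif_pos hex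
  rw [e, ← hn1 x hx]
  exact hL₀ _ (Or.inr ⟨k, rfl⟩) n (Or.inl ⟨n, rfl⟩) hk hn2 x hx

variable [Fact (0 < r)] [Fact (0 < r')]

lemma ae_tendsto_coupledHeight (hr : r < r') {u : ℕ → ℝ} (hu : Tendsto u atTop atTop) :
    ∀ᵐ w ∂coupledLaw r r', ∀ t,
      Tendsto (fun k => coupledHeight (u k) w t) atTop (𝓝 (limitHeight w t)) := by
  have hg : ∀ L, ∀ᵐ w ∂coupledLaw r r', IsGoodNoise L (noiseAt L w) := fun L =>
    (measurePreserving_noiseAt L).quasiMeasurePreserving.ae (ae_isGoodNoise L)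
  filter_upwards [ae_isRegularCoupling (r := r) (r' := r'), ae_all_iff.2 fun n : ℕ => hg n,
    ae_all_iff.2 fun k => hg (u k)] with w h1 h2 h3 t
  exact tendsto_coupledHeight hr h1 hu h2 h3 t

lemma measurable_coupledHeight (L : ℝ) (t : ℕ) :
    Measurable fun w => coupledHeight L w t := by
  have h := (measurable_noiseChain (measurable_clockTransition L) t).comp
    ((measurable_const (a := (([], []) : List ℝ × List ℝ))).prodMk
      (measurePreserving_noiseAt (r := 1) (r' := 1) L).measurable)
  exact measurable_toUC_stepHeight.comp h

lemma aemeasurable_limitHeight (hr : r < r') (t : ℕ) :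
    AEMeasurable (fun w => limitHeight w t) (coupledLaw r r') := by
  refine aemeasurable_of_tendsto_metrizable_ae atTop
    (f := fun (n : ℕ) w => coupledHeight n w t) (fun n => (measurable_coupledHeight n t).aemeasurable) ?_
  filter_upwards [ae_tendsto_coupledHeight hr tendsto_natCast_atTop_atTop] with w h
  exact h t

/-- The law of the limit of the coupled chains, with time in `[0, T]`. -/
def limitLaw (r r' : ℝ) [Fact (0 < r)] [Fact (0 < r')] (T : ℝ) :
    Measure (Icc (0 : ℝ) T → UC) :=
  (coupledLaw r r').map fun w i => limitHeight w ⌊(i : ℝ)⌋₊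

lemma aemeasurable_limitHeight_floor (hr : r < r') (T : ℝ) :
    AEMeasurable (fun w (i : Icc (0 : ℝ) T) => limitHeight w ⌊(i : ℝ)⌋₊) (coupledLaw r r') :=
  (show Measurable fun (f : ℕ → UC) (i : Icc (0 : ℝ) T) => f ⌊(i : ℝ)⌋₊ by
    fun_prop).comp_aemeasurable (aemeasurable_pi_iff.2 (aemeasurable_limitHeight hr))

lemma isProbabilityMeasure_limitLaw (hr : r < r') (T : ℝ) :
    IsProbabilityMeasure (limitLaw r r' T) :=
  Measure.isProbabilityMeasure_map (aemeasurable_limitHeight_floor hr T)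

/-- Processes whose laws are those of the coupled chains converge weakly. -/
lemma isWeakLimit_limitLaw (hr : r < r') {T : ℝ} {Ω : Type*} [MeasurableSpace Ω] {P : Measure Ω}
    [IsProbabilityMeasure P] {X : ℝ → Ω → Icc (0 : ℝ) T → UC}
    (hX : ∀ L (I : Finset (Icc (0 : ℝ) T)), HasLaw (fun ω (i : I) => X L ω i)
      ((coupledLaw r r').map fun w (i : I) => coupledHeight L w ⌊(i : ℝ)⌋₊) P)
    [IsProbabilityMeasure (limitLaw r r' T)] : IsWeakLimit P X (limitLaw r r' T) := by
  intro I
  have hI : Measurable fun (p : Icc (0 : ℝ) T → UC) (i : I) => p i := by fun_prop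
  -- The filter at infinity is countably generated, so sequences of cutoffs suffice; along each of
  -- them the coupled interfaces converge almost surely.
  refine ⟨fun L => (hX L I).aemeasurable, hI.aemeasurable, tendsto_of_seq_tendsto fun u hu => ?_⟩
  have hlim := (aemeasurable_limitHeight_floor (r := r) (r' := r') hr T)
  have h := tendstoInDistribution_of_ae_tendsto (μ' := coupledLaw r r') (l := atTop)
    (X := fun (k : ℕ) w (i : I) => coupledHeight (u k) w ⌊(i : ℝ)⌋₊)
    (Z := fun w (i : I) => limitHeight w ⌊(i : ℝ)⌋₊)
    (fun k => (measurable_pi_lambda _ fun i => measurable_coupledHeight _ _).aemeasurable)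
    (hI.comp_aemeasurable hlim)
    ((ae_tendsto_coupledHeight hr hu).mono fun w hw => tendsto_pi_nhds.2 fun i => hw _)
  have e : (limitLaw r r' T).map (fun p (i : I) => p i) =
      (coupledLaw r r').map fun w (i : I) => limitHeight w ⌊(i : ℝ)⌋₊ :=
    AEMeasurable.map_map_of_aemeasurable hI.aemeasurable hlim
  simp only [e]
  refine h.tendsto.congr fun k => ?_
  exact Subtype.ext (hX (u k) I).map_eq.symm

/-- Weak limits are unique. -/
lemma IsWeakLimit.unique {T : ℝ} {Ω : Type*} [MeasurableSpace Ω] {P : Measure Ω}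
    [IsProbabilityMeasure P] {X : ℝ → Ω → Icc (0 : ℝ) T → UC} {μ ν : Measure (Icc (0 : ℝ) T → UC)}
    [IsProbabilityMeasure μ] [IsProbabilityMeasure ν] (hμ : IsWeakLimit P X μ)
    (hν : IsWeakLimit P X ν) : μ = ν := by
  have h : ∀ I : Finset (Icc (0 : ℝ) T), μ.map I.restrict = ν.map I.restrict := fun I =>
    tendstoInDistribution_unique _ (hμ I) (hν I)
  have hf : ∀ I : Finset (Icc (0 : ℝ) T), IsFiniteMeasure (ν.map I.restrict) := fun I => inferInstance
  -- Finite-dimensional marginals determine a finite measure on the product σ-algebra.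
  exact IsProjectiveLimit.unique (P := fun I => ν.map I.restrict) h fun I => rfl

/-! ### The laws of the two processes -/

lemma map_coupledHeight (L : ℝ) {ι : Type*} (τ : ι → ℕ) :
    (coupledLaw r r').map (fun w (i : ι) => coupledHeight L w (τ i)) = (noiseLaw r r').map
      fun y i => toUC (stepHeight (noiseChain (clockTransition L) ([], []) y (τ i))) := by
  have hm := measurePreserving_noiseAt (r := r) (r' := r') L
  rw [← hm.map_eq, Measure.map_map _ hm.measurable]
  · rfl
  · exact measurable_pi_lambda _ fun i => measurable_toUC_stepHeight.comp
      ((measurable_noiseChain (measurable_clockTransition L) _).comp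
        (measurable_const.prodMk measurable_id))

variable {Ω : Type*} [MeasurableSpace Ω] {P : Measure Ω} [IsProbabilityMeasure P]
  {a : ℕ × Bool × ℕ → Ω → ℝ} {d : ℕ × ℕ → Ω → ℝ}

lemma IsExponentialNoise.hasLaw_growthProcess (h : IsExponentialNoise P r r' a d) (L : ℝ)
    {ι : Type*} (τ : ι → ℝ) :
    HasLaw (fun ω i => growthProcess L (fun j => a j ω) (fun j => d j ω) (τ i))
      ((coupledLaw r r').map fun w i => coupledHeight L w ⌊τ i⌋₊) P := by
  have hl := h.hasLaw_stepNoise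
  have hm : Measurable fun (y : ℕ → StepNoise) (i : ι) =>
      toUC (stepHeight (noiseChain (clockTransition L) ([], []) y ⌊τ i⌋₊)) :=
    measurable_pi_lambda _ fun i => measurable_toUC_stepHeight.comp
      ((measurable_noiseChain (measurable_clockTransition L) _).comp
        (measurable_const.prodMk measurable_id))
  have h2 : HasLaw _ _ P := (HasLaw.mk hm.aemeasurable rfl).comp hl
  rw [map_coupledHeight]
  refine h2.congr ?_
  have hg := ae_isGoodNoise (r := r) (r' := r') L
  rw [← hl.map_eq] at hg
  filter_upwards [ae_of_ae_map hl.aemeasurable hg] with ω hω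
  funext i
  rw [hω.isGenericNoise.growthProcess_eq, clockChain_eq_noiseChain]
  rfl

/-- The equality in law of the two configuration chains up to time `T` puts the particle system
under the same coupling as the growth process, so no separate convergence argument is needed for it.
-/
lemma IsExponentialNoise.hasLaw_heightProcess (h : IsExponentialNoise P r r' a d) (L : ℝ)
    {ι : Type*} {τ : ι → ℝ} {T : ℕ} (hτ : ∀ i, τ i ≤ T) :
    HasLaw (fun ω i => heightProcess L (fun j => a j ω) (fun j => d j ω) (τ i))
      ((coupledLaw r r').map fun w i => coupledHeight L w ⌊τ i⌋₊) P := by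
  have hl := h.hasLaw_stepNoise
  have hmin : ∀ i, min ⌊τ i⌋₊ T = ⌊τ i⌋₊ := fun i => min_eq_left (Nat.floor_le_of_le (hτ i))
  let φ : (ℕ → List ℝ × List ℝ) → ι → UC := fun c i => toUC (stepHeight (c ⌊τ i⌋₊))
  have hφ : Measurable φ := measurable_pi_lambda _ fun i =>
    measurable_toUC_stepHeight.comp (measurable_pi_apply _)
  have hmc : ∀ {f : ℕ → List ℝ × List ℝ → StepNoise → List ℝ × List ℝ},
      (∀ t, Measurable fun p : (List ℝ × List ℝ) × StepNoise => f t p.1 p.2) →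
      Measurable fun (y : ℕ → StepNoise) t => noiseChain f ([], []) y (min t T) := fun hf =>
    measurable_pi_lambda _ fun t =>
      (measurable_noiseChain hf _).comp (measurable_const.prodMk measurable_id)
  have e : (noiseLaw r r').map (fun y i =>
      toUC (stepHeight (noiseChain (clockTransition L) ([], []) y ⌊τ i⌋₊))) =
      (noiseLaw r r').map fun y i =>
        toUC (stepHeight (noiseChain (queueTransition L) ([], []) y ⌊τ i⌋₊)) := by
    have h1 := congrArg (Measure.map φ) (map_noiseChain_eq (stepLaw r r')
      (measurable_clockTransition L) (measurable_queueTransition L) (map_clockTransition_eq L) T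
      ([], []))
    rw [Measure.map_map hφ (hmc (measurable_clockTransition L)),
      Measure.map_map hφ (hmc (measurable_queueTransition L))] at h1
    simp only [φ, Function.comp_def, hmin] at h1
    exact h1
  have hm : Measurable fun (y : ℕ → StepNoise) (i : ι) =>
      toUC (stepHeight (noiseChain (queueTransition L) ([], []) y ⌊τ i⌋₊)) :=
    measurable_pi_lambda _ fun i => measurable_toUC_stepHeight.comp
      ((measurable_noiseChain (measurable_queueTransition L) _).comp
        (measurable_const.prodMk measurable_id))
  have h2 : HasLaw _ _ P := (HasLaw.mk hm.aemeasurable rfl).comp hl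
  rw [map_coupledHeight, e]
  refine h2.congr ?_
  have hg := ae_nonneg_isLineSpacing_noiseLaw (r := r) (r' := r')
  rw [← hl.map_eq] at hg
  filter_upwards [ae_of_ae_map hl.aemeasurable hg] with ω hω
  funext i
  rw [heightProcess_eq (fun t => (hω t).1) (fun t => (hω t).2), queueChain_eq_noiseChain]
  rfl

end

end

theorem mainTheorem2 (v : ℝ) (hv0 : 0 < v) (hv1 : v < 1) (n : ℕ)
    {Ω : Type*} [MeasurableSpace Ω] (P : Measure Ω) [IsProbabilityMeasure P]
    (U : ℕ × Bool × ℕ → Ω → ℝ) (D : ℕ × ℕ → Ω → ℝ)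
    (hUD : IsExponentialNoise P v v⁻¹ U D)
    {Ω' : Type*} [MeasurableSpace Ω'] (P' : Measure Ω') [IsProbabilityMeasure P']
    (N : ℕ × Bool × ℕ → Ω' → ℝ) (ζ : ℕ × ℕ → Ω' → ℝ)
    (hNζ : IsExponentialNoise P' v v⁻¹ N ζ) :
    let h : ℝ → Ω → Icc (0 : ℝ) (2 * n) → UC := fun L ω t =>
      growthProcess L (fun i => U i ω) (fun i => D i ω) t
    let 𝔥 : ℝ → Ω' → Icc (0 : ℝ) (2 * n) → UC := fun L ω t =>
      heightProcess L (fun i => N i ω) (fun i => ζ i ω) t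
    (∃ (μ : Measure (Icc (0 : ℝ) (2 * n) → UC)) (_ : IsProbabilityMeasure μ), IsWeakLimit P h μ) ∧
    (∃ (ν : Measure (Icc (0 : ℝ) (2 * n) → UC)) (_ : IsProbabilityMeasure ν), IsWeakLimit P' 𝔥 ν) ∧
    ∀ (μ ν : Measure (Icc (0 : ℝ) (2 * n) → UC)) [IsProbabilityMeasure μ] [IsProbabilityMeasure ν],
      IsWeakLimit P h μ → IsWeakLimit P' 𝔥 ν → μ = ν := by
  have : Fact (0 < v) := ⟨hv0⟩
  have : Fact (0 < v⁻¹) := ⟨inv_pos.2 hv0⟩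
  -- This is where `v < 1` enters: rings are denser than nucleations, so the free walks have
  -- negative drift.
  have hr : v < v⁻¹ := hv1.trans ((one_lt_inv₀ hv0).2 hv1)
  have := isProbabilityMeasure_limitLaw hr (2 * n)
  intro h 𝔥
  have h1 : IsWeakLimit P h (limitLaw v v⁻¹ (2 * n)) :=
    isWeakLimit_limitLaw hr fun L I =>
      hUD.hasLaw_growthProcess L fun i : I => ((i : Icc (0 : ℝ) (2 * n)) : ℝ)
  have h2 : IsWeakLimit P' 𝔥 (limitLaw v v⁻¹ (2 * n)) :=
    isWeakLimit_limitLaw hr fun L I => hNζ.hasLaw_heightProcess L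
      (τ := fun i : I => ((i : Icc (0 : ℝ) (2 * n)) : ℝ)) (T := 2 * n) fun i => by
        push_cast
        exact (i : Icc (0 : ℝ) (2 * n)).2.2
  exact ⟨⟨_, this, h1⟩, ⟨_, this, h2⟩, fun μ ν _ _ hμ hν => (hμ.unique h1).trans (h2.unique hν)⟩
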